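/- **Definitions.** Let $D$ be the closure of a braid word on $b\ge 1$ strands, with writhe $w$, representing an oriented link $L\subset S^3$. At a crossing let $i,j$ be the left and right incoming edges and $k,l$ the left and right outgoing edges (so the strands of $L$ run $i\to l$ and $j\to k$). Marks (bivalent vertices with one incoming and one outgoing edge) may be placed on the edges. The edge ring $R(D)$ is $\mathbb{Q}[X_e : e \text{ an edge of } D]$ modulo the relations $X_k+X_l=X_i+X_j$ at the crossings and $X_e=X_f$ at the marks, graded by $q(X_e)=2$, and $R_r=R_r(D)\subset R(D)$ is the subring generated by all differences $X_e-X_f$. Let $R_r\{i,j,k\}$ be the free $R_r$-module of rank one with generator in degree $(i,j,k)=(q,2\,\mathrm{gr}_h,2\,\mathrm{gr}_v)$. A positive and a negative crossing are assigned the squares $$\begin{array}{ccc} R_r\{0,-2,0\}&\xrightarrow{\,X_k-X_i\,}&R_r\{0,0,0\}\\ {\scriptstyle X_j-X_k}\uparrow&&\uparrow{\scriptstyle 1}\\ R_r\{2,-2,-2\}&\xrightarrow{-(X_k-X_i)(X_k-X_j)}&R_r\{0,0,-2\}\end{array}\qquad \begin{array}{ccc} R_r\{0,-2,2\}&\xrightarrow{-(X_k-X_i)(X_k-X_j)}&R_r\{-2,0,2\}\\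 {\scriptstyle 1}\uparrow&&\uparrow{\scriptstyle X_j-X_k}\\ R_r\{0,-2,0\}&\xrightarrow{\,X_k-X_i\,}&R_r\{0,0,0\}\end{array}$$ respectively, with horizontal differential $d_+$ of degree $(2,2,0)$ and vertical differential $d_v$ of degree $(0,0,2)$. Let $C_r(D)$ be the tensor product over $R_r$ of the squares of all crossings and, if the diagram $D$ has $c>1$ connected components, of $c-1$ further factors $R_r\{0,-2,0\}\oplus R_r\{0,0,0\}$ with $d_+=d_v=0$. The reduced HOMFLY homology of $L$ is the triply graded rational vector space $$\overline H(L)=H\bigl(H(C_r(D),d_+),d_v^*\bigr)\{-w+b-1,\;w+b-1,\;w-b+1\}.$$ Put $\mathrm{gr}_+=\mathrm{gr}_h+\mathrm{gr}_v$ and $\mathrm{gr}'_{-1}=q-2\,\mathrm{gr}_h$; in degree $(i,j,k)$ these are $(j+k)/2$ and $i-j$. **Theorem.** Let $L\subset S^3$ be an oriented link with $\ell\ge 1$ components, represented by a diagram $D$ as above, and let $U^\ell$ be the $\ell$-component unlink, represented by $\ell$ disjoint circles without crossings (the closure of the trivial braid on $\ell$ strands). There is a spectral sequence $E_k(-1)$,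 $k\ge 2$, of triply graded rational vector spaces, with $E_2$ term isomorphic to $\overline H(L)$ as a triply graded space, whose differentials $d_k$ are homogeneous of degree $(2-2k,\,2-2k,\,2k)$; in particular they raise $\mathrm{gr}_+$ by $1$ and preserve $\mathrm{gr}'_{-1}$. It converges to $\overline H(U^\ell)$, bigraded by $(\mathrm{gr}_+,\mathrm{gr}'_{-1})$: all $d_k$ with $k$ large vanish, and each bigraded part of $\overline H(U^\ell)$ has a finite decreasing filtration, indexed by $2\,\mathrm{gr}_v$, whose associated graded pieces are isomorphic to the parts of $E_\infty$ of the corresponding triple degrees. If $\ell=1$, that is, if $L$ is a knot, the sequence converges to $\mathbb{Q}$, placed in bidegree $(0,0)$. -/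

import Mathlib

open CategoryTheory
open scoped Kronecker

noncomputable section

namespace KR

/-! ### Closed braid diagrams -/

/-- An elementary braid on `b` strands: a crossing of the strands in the (zero-based) positions
`pos` and `pos + 1`, with its sign. -/
structure BraidGen (b : ℕ) where
  pos : ℕ
  lt : pos + 1 < b
  positive : Bool

/-- The left one of the two positions that meet in the crossing. -/
def BraidGen.left {b : ℕ} (g : BraidGen b) : Fin b := ⟨g.pos, Nat.lt_of_succ_lt g.lt⟩

/-- The right one of the two positions that meet in the crossing. -/
def BraidGen.right {b : ℕ} (g : BraidGen b) : Fin b := ⟨g.pos + 1, g.lt⟩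

/-- A braid word on `b` strands, read from the bottom to the top. It stands for the oriented link
diagram which is its closure (all strands are oriented upwards). -/
abbrev BraidWord (b : ℕ) : Type := List (BraidGen b)

variable {b : ℕ}

/-- The number of positive crossings minus the number of negative crossings. -/
def writhe (β : BraidWord b) : ℤ :=
  (β.map fun g => if g.positive then (1 : ℤ) else -1).sum

/-- The edges of the closed braid: the edge `(t, u)` runs in position `u` at level `t`, between the
crossings number `t - 1` and `t`. Each strand that does not take part in the crossing number `t`
carries a mark (a bivalent vertex) there, and the closing arc in position `u`, which joins the
last level to the first one, carries a mark too. -/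
abbrev Edge (β : BraidWord b) : Type := Fin (β.length + 1) × Fin b

/-- The four edges at a crossing: `i`, `j` are incoming, `k`, `l` are outgoing; `k` lies above `i`
and `l` lies above `j`, and the two strands of the link run from `i` to `l` and from `j` to `k`. -/
structure Crossing (E : Type) where
  i : E
  j : E
  k : E
  l : E
  positive : Bool

/-- The crossing number `t` of the closed braid. -/
def crossing (β : BraidWord b) (t : Fin β.length) : Crossing (Edge β) where
  i := (t.castSucc, (β.get t).left)
  j := (t.castSucc, (β.get t).right)
  k := (t.succ, (β.get t).left)
  l := (t.succ, (β.get t).right)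
  positive := (β.get t).positive

/-- There is a mark with incoming edge `e` and outgoing edge `f`. -/
def IsMark (β : BraidWord b) (e f : Edge β) : Prop :=
  (∃ (t : Fin β.length) (u : Fin b), u ≠ (β.get t).left ∧ u ≠ (β.get t).right ∧
    e = (t.castSucc, u) ∧ f = (t.succ, u)) ∨
  (∃ u : Fin b, e = (Fin.last β.length, u) ∧ f = (0, u))

/-- Consecutive edges of the link: one follows the link through a mark or straight through a
crossing. -/
def LinkStep (β : BraidWord b) (e f : Edge β) : Prop :=
  IsMark β e f ∨ ∃ t : Fin β.length,
    (e = (crossing β t).i ∧ f = (crossing β t).l) ∨ (e = (crossing β t).j ∧ f = (crossing β t).k)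

/-- The number of components of the link which is the closure of the braid. -/
def numLinkComponents (β : BraidWord b) : ℕ := Nat.card (Quot (LinkStep β))

/-- Edges which meet in a vertex of the diagram, one incoming and one outgoing. -/
def DiagramStep (β : BraidWord b) (e f : Edge β) : Prop :=
  IsMark β e f ∨ ∃ t : Fin β.length,
    (e = (crossing β t).i ∨ e = (crossing β t).j) ∧ (f = (crossing β t).k ∨ f = (crossing β t).l)

/-- The number of connected components of the diagram (as a planar graph). -/
def numDiagramComponents (β : BraidWord b) : ℕ := Nat.card (Quot (DiagramStep β))

/-- The crossingless diagram of the unlink with `n` components: `n` circles. -/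
def unlink (n : ℕ) : BraidWord n := []

/-! ### The edge ring and the reduced ring -/

/-- The linear relators of the vertices: the sum of the variables of the outgoing edges minus the
sum of the variables of the incoming edges. -/
def relators (β : BraidWord b) : Set (MvPolynomial (Edge β) ℚ) :=
  {ρ | ∃ t : Fin β.length, ρ = MvPolynomial.X (crossing β t).k + MvPolynomial.X (crossing β t).l
      - MvPolynomial.X (crossing β t).i - MvPolynomial.X (crossing β t).j} ∪
  {ρ | ∃ e f : Edge β, IsMark β e f ∧ ρ = MvPolynomial.X f - MvPolynomial.X e}

/-- The edge ring `R(D)`. -/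
abbrev EdgeRing (β : BraidWord b) : Type :=
  MvPolynomial (Edge β) ℚ ⧸ Ideal.span (relators β)

/-- The class of the variable `X_e` in the edge ring. -/
def edgeVar (β : BraidWord b) (e : Edge β) : EdgeRing β :=
  Ideal.Quotient.mk (Ideal.span (relators β)) (MvPolynomial.X e)

/-- The part of degree `n` of the edge ring, for the grading with `q(X_e) = 2`. -/
def edgeRingDeg (β : BraidWord b) (n : ℤ) : Submodule ℚ (EdgeRing β) :=
  (MvPolynomial.weightedHomogeneousSubmodule ℚ (fun _ : Edge β => (2 : ℤ)) n).map
    (Ideal.Quotient.mkₐ ℚ (Ideal.span (relators β))).toLinearMap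

/-- The reduced ring `R_r(D)`: the subring generated by the differences `X_e - X_f`. -/
def ReducedRing (β : BraidWord b) : Subalgebra ℚ (EdgeRing β) :=
  Algebra.adjoin ℚ {x | ∃ e f : Edge β, x = edgeVar β e - edgeVar β f}

/-- The element `X_e - X_f` of the reduced ring. -/
def edgeDiff (β : BraidWord b) (e f : Edge β) : ReducedRing β :=
  ⟨edgeVar β e - edgeVar β f, Algebra.subset_adjoin ⟨e, f, rfl⟩⟩

/-- The part of degree `n` of the reduced ring. -/
def reducedRingDeg (β : BraidWord b) (n : ℤ) : Submodule ℚ (ReducedRing β) :=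
  (edgeRingDeg β n).comap (ReducedRing β).val.toLinearMap

theorem edgeDiff_mem (β : BraidWord b) (e f : Edge β) : edgeDiff β e f ∈ reducedRingDeg β 2 := by
  refine ⟨MvPolynomial.X e - MvPolynomial.X f, ?_, ?_⟩
  · exact Submodule.sub_mem _ (MvPolynomial.isWeightedHomogeneous_X ℚ _ e)
      (MvPolynomial.isWeightedHomogeneous_X ℚ _ f)
  · simp [edgeDiff, edgeVar]

theorem edgeRingDeg_mul (β : BraidWord b) {m n : ℤ} {x y : EdgeRing β}
    (hx : x ∈ edgeRingDeg β m) (hy : y ∈ edgeRingDeg β n) : x * y ∈ edgeRingDeg β (m + n) := by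
  obtain ⟨p, hp, rfl⟩ := hx
  obtain ⟨r, hr, rfl⟩ := hy
  exact ⟨p * r, MvPolynomial.IsWeightedHomogeneous.mul hp hr, by simp⟩

theorem reducedRingDeg_mul (β : BraidWord b) {m n : ℤ} {x y : ReducedRing β}
    (hx : x ∈ reducedRingDeg β m) (hy : y ∈ reducedRingDeg β n) :
    x * y ∈ reducedRingDeg β (m + n) := by
  have := edgeRingDeg_mul β (show (x : EdgeRing β) ∈ _ from hx) (show (y : EdgeRing β) ∈ _ from hy)
  exact this

theorem one_mem_reducedRingDeg (β : BraidWord b) : (1 : ReducedRing β) ∈ reducedRingDeg β 0 :=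
  ⟨1, MvPolynomial.isWeightedHomogeneous_one ℚ _, by simp⟩

/-! ### Signs -/

section Signs

variable {A : Type} [CommRing A]

/-- The sign `(-1) ^ n` in `A`. -/
def sgn (A : Type) [CommRing A] (n : ℤ) : A := ((n.negOnePow : ℤˣ) : ℤ)

theorem sgn_succ (n : ℤ) : sgn A (n + 1) = -sgn A n := by
  simp [sgn, Int.negOnePow_succ]

theorem sgn_mul_self (n : ℤ) : sgn A n * sgn A n = 1 := by
  unfold sgn
  rw [← Int.cast_mul, ← Units.val_mul, Int.units_mul_self]
  simp

/-- The diagonal matrix of the signs `(-1) ^ g`. -/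
def signMatrix (A : Type) [CommRing A] {ι : Type} [DecidableEq ι] (g : ι → ℤ) : Matrix ι ι A :=
  Matrix.diagonal fun x => sgn A (g x)

theorem signMatrix_mul_self {ι : Type} [Fintype ι] [DecidableEq ι] (g : ι → ℤ) :
    signMatrix A g * signMatrix A g = 1 := by
  simp [signMatrix, sgn_mul_self]

theorem signMatrix_anti {ι : Type} [Fintype ι] [DecidableEq ι] (g : ι → ℤ) (M : Matrix ι ι A)
    (hM : ∀ x y, M x y ≠ 0 → g x = g y + 1) : signMatrix A g * M = -(M * signMatrix A g) := by
  ext x y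
  by_cases h : M x y = 0
  · simp [signMatrix, h]
  · simp [signMatrix, hM x y h, sgn_succ, mul_comm]

theorem signMatrix_comm {ι : Type} [Fintype ι] [DecidableEq ι] (g : ι → ℤ) (M : Matrix ι ι A)
    (hM : ∀ x y, M x y ≠ 0 → g x = g y) : signMatrix A g * M = M * signMatrix A g := by
  ext x y
  by_cases h : M x y = 0
  · simp [signMatrix, h]
  · simp [signMatrix, hM x y h, mul_comm]

end Signs

/-! ### Complexes of free graded modules with two commuting differentials -/

/-- A free module of finite rank over `A`, with a homogeneous basis `ι`, polynomial grading `q`,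
homological gradings `h` (horizontal) and `v` (vertical), and with commuting differentials `dp`
(that is `d_+`), homogeneous of degree `(2, 1, 0)`, and `dv` (that is `d_v`), homogeneous of degree
`(0, 0, 1)` for `(q, h, v)`. The entry `dp x y` is the coefficient of `x` in `d_+ y`.
`𝒜 n` is the part of degree `n` of `A`. (Only `d_+` and `d_v` enter into the HOMFLY homology; the
differential `d_-` of a matrix factorization, which is `0` for the parameter `p = 0`, is not
recorded.) -/
structure FreeComplex (A : Type) [CommRing A] [Algebra ℚ A] (𝒜 : ℤ → Submodule ℚ A) where
  ι : Type
  [fintype : Fintype ι]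
  [decEq : DecidableEq ι]
  q : ι → ℤ
  h : ι → ℤ
  v : ι → ℤ
  dp : Matrix ι ι A
  dv : Matrix ι ι A
  dp_deg : ∀ x y, dp x y ≠ 0 → h x = h y + 1 ∧ v x = v y
  dv_deg : ∀ x y, dv x y ≠ 0 → h x = h y ∧ v x = v y + 1
  dp_mem : ∀ x y, dp x y ∈ 𝒜 (q y + 2 - q x)
  dv_mem : ∀ x y, dv x y ∈ 𝒜 (q y - q x)
  dp_dp : dp * dp = 0
  dv_dv : dv * dv = 0
  dp_dv : dp * dv = dv * dp

attribute [instance] FreeComplex.fintype FreeComplex.decEq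

section Complexes

variable {A : Type} [CommRing A] [Algebra ℚ A] {𝒜 : ℤ → Submodule ℚ A}

theorem sgn_mul_mem (n : ℤ) {a : A} {m : ℤ} (ha : a ∈ 𝒜 m) : sgn A n * a ∈ 𝒜 m := by
  unfold sgn
  rcases Int.units_eq_one_or n.negOnePow with h | h <;> simp [h, ha]

/-- The complex `A` with generator in degree `(0, 0, 0)`. -/
def FreeComplex.unit (𝒜 : ℤ → Submodule ℚ A) : FreeComplex A 𝒜 where
  ι := Unit
  q _ := 0
  h _ := 0
  v _ := 0
  dp := 0
  dv := 0
  dp_deg _ _ hx := absurd rfl hx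
  dv_deg _ _ hx := absurd rfl hx
  dp_mem _ _ := Submodule.zero_mem _
  dv_mem _ _ := Submodule.zero_mem _
  dp_dp := by simp
  dv_dv := by simp
  dp_dv := by simp

theorem kron_apply (C D : FreeComplex A 𝒜) (M : Matrix C.ι C.ι A) (N : Matrix D.ι D.ι A)
    (g : C.ι → ℤ) (x y : C.ι × D.ι) :
    (M ⊗ₖ (1 : Matrix D.ι D.ι A) + signMatrix A g ⊗ₖ N) x y =
      (if x.2 = y.2 then M x.1 y.1 else 0) + (if x.1 = y.1 then sgn A (g x.1) * N x.2 y.2 else 0) := by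
  obtain ⟨x1, x2⟩ := x
  obtain ⟨y1, y2⟩ := y
  simp only [Matrix.add_apply, signMatrix]
  congr 1 <;> split_ifs with h <;> simp [h]

/-- The tensor product over `A`; both differentials are those of a tensor product of cochain
complexes, `d (x ⊗ y) = d x ⊗ y + (-1) ^ |x| x ⊗ d y`, with `|x|` the horizontal degree for `d_+` and
the vertical degree for `d_v`. -/
def FreeComplex.tensor (C D : FreeComplex A 𝒜) : FreeComplex A 𝒜 where
  ι := C.ι × D.ι
  q x := C.q x.1 + D.q x.2
  h x := C.h x.1 + D.h x.2
  v x := C.v x.1 + D.v x.2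
  dp := C.dp ⊗ₖ (1 : Matrix D.ι D.ι A) + signMatrix A C.h ⊗ₖ D.dp
  dv := C.dv ⊗ₖ (1 : Matrix D.ι D.ι A) + signMatrix A C.v ⊗ₖ D.dv
  dp_deg x y hxy := by
    rw [kron_apply] at hxy
    by_cases h1 : (if x.2 = y.2 then C.dp x.1 y.1 else 0) = 0
    · rw [h1, zero_add] at hxy
      obtain ⟨h2, h3⟩ := ite_ne_right_iff.1 hxy
      have := D.dp_deg _ _ (right_ne_zero_of_mul h3)
      rw [h2]; omega
    · obtain ⟨h2, h3⟩ := ite_ne_right_iff.1 h1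
      have := C.dp_deg _ _ h3
      rw [h2]; omega
  dv_deg x y hxy := by
    rw [kron_apply] at hxy
    by_cases h1 : (if x.2 = y.2 then C.dv x.1 y.1 else 0) = 0
    · rw [h1, zero_add] at hxy
      obtain ⟨h2, h3⟩ := ite_ne_right_iff.1 hxy
      have := D.dv_deg _ _ (right_ne_zero_of_mul h3)
      rw [h2]; omega
    · obtain ⟨h2, h3⟩ := ite_ne_right_iff.1 h1
      have := C.dv_deg _ _ h3
      rw [h2]; omega
  dp_mem x y := by
    rw [kron_apply]
    refine Submodule.add_mem _ ?_ ?_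
    · split_ifs with h
      · have := C.dp_mem x.1 y.1
        rw [h]; convert this using 2; ring
      · exact Submodule.zero_mem _
    · split_ifs with h
      · have := sgn_mul_mem (C.h x.1) (D.dp_mem x.2 y.2)
        rw [← h]; convert this using 2; ring
      · exact Submodule.zero_mem _
  dv_mem x y := by
    rw [kron_apply]
    refine Submodule.add_mem _ ?_ ?_
    · split_ifs with h
      · have := C.dv_mem x.1 y.1
        rw [h]; convert this using 2; ring
      · exact Submodule.zero_mem _
    · split_ifs with h
      · have := sgn_mul_mem (C.v x.1) (D.dv_mem x.2 y.2)
        rw [← h]; convert this using 2; ring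
      · exact Submodule.zero_mem _
  dp_dp := by
    have h := signMatrix_anti C.h C.dp fun x y hxy => (C.dp_deg x y hxy).1
    simp only [mul_add, add_mul, ← Matrix.mul_kronecker_mul, C.dp_dp, D.dp_dp, mul_one, one_mul, h]
    ext; simp
  dv_dv := by
    have h := signMatrix_anti C.v C.dv fun x y hxy => (C.dv_deg x y hxy).2
    simp only [mul_add, add_mul, ← Matrix.mul_kronecker_mul, C.dv_dv, D.dv_dv, mul_one, one_mul, h]
    ext; simp
  dp_dv := by
    have h1 := signMatrix_comm C.v C.dp fun x y hxy => (C.dp_deg x y hxy).2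
    have h2 := signMatrix_comm C.h C.dv fun x y hxy => (C.dv_deg x y hxy).1
    have h3 : signMatrix A C.h * signMatrix A C.v = signMatrix A C.v * signMatrix A C.h := by
      simp [signMatrix, mul_comm]
    simp only [mul_add, add_mul, ← Matrix.mul_kronecker_mul, C.dp_dv, D.dp_dv, mul_one, one_mul,
      h1, h2, h3]
    abel

/-- The tensor product of a list of complexes. -/
def FreeComplex.tensorList : List (FreeComplex A 𝒜) → FreeComplex A 𝒜
  | [] => FreeComplex.unit 𝒜
  | C :: l => C.tensor (FreeComplex.tensorList l)

/-! ### Homology -/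

/-- The homology of an endomorphism `d` (with `d ∘ d = 0` in all uses): kernel modulo image. -/
abbrev Homology {M : Type} [AddCommGroup M] [Module ℚ M] (d : M →ₗ[ℚ] M) : Type :=
  LinearMap.ker d ⧸ (LinearMap.range d).submoduleOf (LinearMap.ker d)

/-- The part of the homology that a subspace of homogeneous elements descends to: the classes of
the cycles in the subspace. -/
def homologyPiece {M : Type} [AddCommGroup M] [Module ℚ M] (d : M →ₗ[ℚ] M) (P : Submodule ℚ M) :
    Submodule ℚ (Homology d) :=
  (P.submoduleOf (LinearMap.ker d)).map
    ((LinearMap.range d).submoduleOf (LinearMap.ker d)).mkQ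

/-- The endomorphism of the homology of `d` which is induced by an endomorphism `f` that commutes
with `d`. -/
def homologyMap {M : Type} [AddCommGroup M] [Module ℚ M] (d f : M →ₗ[ℚ] M)
    (hf : ∀ m, f (d m) = d (f m)) : Homology d →ₗ[ℚ] Homology d :=
  Submodule.mapQ _ _
    (f.restrict (p := LinearMap.ker d) (q := LinearMap.ker d) fun m hm => by
      rw [LinearMap.mem_ker] at hm ⊢
      rw [← hf, hm, map_zero])
    (by
      rintro ⟨m, hm⟩ ⟨x, hx⟩
      exact ⟨f x, by rw [← hf, hx]; rfl⟩)

namespace FreeComplex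

variable (C : FreeComplex A 𝒜)

/-- The underlying module. -/
abbrev Carrier : Type := C.ι → A

/-- The differential `d_+`. -/
def dPlus : C.Carrier →ₗ[ℚ] C.Carrier := C.dp.mulVecLin.restrictScalars ℚ

/-- The differential `d_v`. -/
def dVert : C.Carrier →ₗ[ℚ] C.Carrier := C.dv.mulVecLin.restrictScalars ℚ

theorem dVert_dPlus (m : C.Carrier) : C.dVert (C.dPlus m) = C.dPlus (C.dVert m) := by
  simp [dPlus, dVert, C.dp_dv]

/-- The part `C^{i,j,k}`, with `(i, j, k) = (q, 2 gr_h, 2 gr_v)`. -/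
def piece (d : ℤ × ℤ × ℤ) : Submodule ℚ C.Carrier where
  carrier := {m | ∀ x, m x ∈ 𝒜 (d.1 - C.q x) ∧ (m x ≠ 0 → 2 * C.h x = d.2.1 ∧ 2 * C.v x = d.2.2)}
  add_mem' {m n} hm hn x := by
    refine ⟨Submodule.add_mem _ (hm x).1 (hn x).1, fun h => ?_⟩
    by_cases h0 : m x = 0
    · exact (hn x).2 fun h1 => h (by simp [h0, h1])
    · exact (hm x).2 h0
  zero_mem' x := ⟨Submodule.zero_mem _, fun h => absurd rfl h⟩
  smul_mem' c m hm x := by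
    refine ⟨Submodule.smul_mem _ c (hm x).1, fun h => (hm x).2 fun h0 => h ?_⟩
    simp [h0]

/-- The map `d_v^*` induced by `d_v` on `H(C, d_+)`. -/
def dVertStar : Homology C.dPlus →ₗ[ℚ] Homology C.dPlus :=
  homologyMap C.dPlus C.dVert C.dVert_dPlus

/-- The double homology `H(H(C, d_+), d_v^*)`. -/
abbrev DoubleHomology : Type := Homology C.dVertStar

/-- The triple grading on the double homology. -/
def doubleHomologyPiece (d : ℤ × ℤ × ℤ) : Submodule ℚ C.DoubleHomology :=
  homologyPiece C.dVertStar (homologyPiece C.dPlus (C.piece d))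

end FreeComplex

/-! ### The local complexes -/

/-- The complex of a positive crossing, where `a = X_k - X_i` and `c = X_k - X_j`. The basis vector
`(x, y)` sits in the left (`x = false`) or right column and in the lower (`y = false`) or upper
row of the square
```
  A{0,-2,0}  --- a ---->  A{0,0,0}
     ^ -c                   ^ 1
  A{2,-2,-2} -- -ac --->  A{0,0,-2}
```
where `{i,j,k}` is the value of `(q, 2 h, 2 v)` at the generator. -/
def positiveCrossing (h1 : (1 : A) ∈ 𝒜 0)
    (hmul : ∀ {m n : ℤ} {x y : A}, x ∈ 𝒜 m → y ∈ 𝒜 n → x * y ∈ 𝒜 (m + n))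
    (a c : A) (ha : a ∈ 𝒜 2) (hc : c ∈ 𝒜 2) : FreeComplex A 𝒜 where
  ι := Bool × Bool
  q x := match x with
    | (false, false) => 2
    | _ => 0
  h x := if x.1 then 0 else -1
  v x := if x.2 then 0 else -1
  dp := Matrix.of fun x y => match x, y with
    | (true, true), (false, true) => a
    | (true, false), (false, false) => -(a * c)
    | _, _ => 0
  dv := Matrix.of fun x y => match x, y with
    | (false, true), (false, false) => -c
    | (true, true), (true, false) => 1
    | _, _ => 0
  dp_deg := by rintro ⟨_ | _, _ | _⟩ ⟨_ | _, _ | _⟩ <;> simp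
  dv_deg := by rintro ⟨_ | _, _ | _⟩ ⟨_ | _, _ | _⟩ <;> simp
  dp_mem := by
    have := hmul ha hc
    norm_num at this
    rintro ⟨_ | _, _ | _⟩ ⟨_ | _, _ | _⟩ <;> simp [ha, this]
  dv_mem := by
    rintro ⟨_ | _, _ | _⟩ ⟨_ | _, _ | _⟩ <;> simp [hc, h1]
  dp_dp := by
    ext ⟨_ | _, _ | _⟩ ⟨_ | _, _ | _⟩ <;> simp [Matrix.mul_apply, Fintype.sum_prod_type]
  dv_dv := by
    ext ⟨_ | _, _ | _⟩ ⟨_ | _, _ | _⟩ <;> simp [Matrix.mul_apply, Fintype.sum_prod_type]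
  dp_dv := by
    ext ⟨_ | _, _ | _⟩ ⟨_ | _, _ | _⟩ <;> simp [Matrix.mul_apply, Fintype.sum_prod_type]

/-- The complex of a negative crossing, where `a = X_k - X_i` and `c = X_k - X_j`:
```
  A{0,-2,2}  -- -ac --->  A{-2,0,2}
     ^ 1                    ^ -c
  A{0,-2,0}  --- a ---->  A{0,0,0}
```
-/
def negativeCrossing (h1 : (1 : A) ∈ 𝒜 0)
    (hmul : ∀ {m n : ℤ} {x y : A}, x ∈ 𝒜 m → y ∈ 𝒜 n → x * y ∈ 𝒜 (m + n))
    (a c : A) (ha : a ∈ 𝒜 2) (hc : c ∈ 𝒜 2) : FreeComplex A 𝒜 where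
  ι := Bool × Bool
  q x := match x with
    | (true, true) => -2
    | _ => 0
  h x := if x.1 then 0 else -1
  v x := if x.2 then 1 else 0
  dp := Matrix.of fun x y => match x, y with
    | (true, true), (false, true) => -(a * c)
    | (true, false), (false, false) => a
    | _, _ => 0
  dv := Matrix.of fun x y => match x, y with
    | (false, true), (false, false) => 1
    | (true, true), (true, false) => -c
    | _, _ => 0
  dp_deg := by rintro ⟨_ | _, _ | _⟩ ⟨_ | _, _ | _⟩ <;> simp
  dv_deg := by rintro ⟨_ | _, _ | _⟩ ⟨_ | _, _ | _⟩ <;> simp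
  dp_mem := by
    have := hmul ha hc
    norm_num at this
    rintro ⟨_ | _, _ | _⟩ ⟨_ | _, _ | _⟩ <;> simp [ha, this]
  dv_mem := by
    rintro ⟨_ | _, _ | _⟩ ⟨_ | _, _ | _⟩ <;> simp [hc, h1]
  dp_dp := by
    ext ⟨_ | _, _ | _⟩ ⟨_ | _, _ | _⟩ <;> simp [Matrix.mul_apply, Fintype.sum_prod_type]
  dv_dv := by
    ext ⟨_ | _, _ | _⟩ ⟨_ | _, _ | _⟩ <;> simp [Matrix.mul_apply, Fintype.sum_prod_type]
  dp_dv := by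
    ext ⟨_ | _, _ | _⟩ ⟨_ | _, _ | _⟩ <;> simp [Matrix.mul_apply, Fintype.sum_prod_type, mul_comm]

/-- The factor `A{0,-2,0} ⊕ A{0,0,0}` with `d_+ = d_v = 0` by which the unreduced complex differs
from the complex `C(D)`. -/
def unreducedFactor (𝒜 : ℤ → Submodule ℚ A) : FreeComplex A 𝒜 where
  ι := Bool
  q _ := 0
  h x := if x then 0 else -1
  v _ := 0
  dp := 0
  dv := 0
  dp_deg _ _ hx := absurd rfl hx
  dv_deg _ _ hx := absurd rfl hx
  dp_mem _ _ := Submodule.zero_mem _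
  dv_mem _ _ := Submodule.zero_mem _
  dp_dp := by simp
  dv_dv := by simp
  dp_dv := by simp

end Complexes

/-! ### The reduced HOMFLY homology -/

/-- The local factor of the globally reduced complex at the crossing number `t`. -/
def crossingComplex (β : BraidWord b) (t : Fin β.length) :
    FreeComplex (ReducedRing β) (reducedRingDeg β) :=
  let χ := crossing β t
  if χ.positive then
    positiveCrossing (one_mem_reducedRingDeg β) (reducedRingDeg_mul β)
      (edgeDiff β χ.k χ.i) (edgeDiff β χ.k χ.j) (edgeDiff_mem β _ _) (edgeDiff_mem β _ _)
  else
    negativeCrossing (one_mem_reducedRingDeg β) (reducedRingDeg_mul β)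
      (edgeDiff β χ.k χ.i) (edgeDiff β χ.k χ.j) (edgeDiff_mem β _ _) (edgeDiff_mem β _ _)

/-- The globally reduced complex of the closed braid: the tensor product over the reduced ring of
the local factors of the crossings and, if the diagram is disconnected, of one unreduced factor for
each connected component of the diagram but one. -/
def reducedComplex (β : BraidWord b) : FreeComplex (ReducedRing β) (reducedRingDeg β) :=
  FreeComplex.tensorList (List.ofFn (crossingComplex β) ++
    List.replicate (numDiagramComponents β - 1) (unreducedFactor (reducedRingDeg β)))

/-- The overall shift `{-w+b-1, w+b-1, w-b+1}`, for a braid with `b` strands and writhe `w`. -/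
def shift (β : BraidWord b) : ℤ × ℤ × ℤ :=
  (-writhe β + b - 1, writhe β + b - 1, writhe β - b + 1)

/-- The group `H̄^{i,j,k}(L)` of the reduced HOMFLY homology of the link `L` which is the closure of
the braid, as a subspace of `H̄(L) = H(H(C_r(D), d_+), d_v^*)`. -/
def reducedHomflyPiece (β : BraidWord b) (d : ℤ × ℤ × ℤ) :
    Submodule ℚ (reducedComplex β).DoubleHomology :=
  (reducedComplex β).doubleHomologyPiece (d - shift β)

/-- `H̄^{i,j,k}(L)` as an object of the category of rational vector spaces. -/
def reducedHomfly (β : BraidWord b) (d : ℤ × ℤ × ℤ) : ModuleCat.{0} ℚ :=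
  ModuleCat.of ℚ (reducedHomflyPiece β d)

/-! ### Gradings and spectral sequences -/

/-- Twice the cohomological grading `gr_+ = gr_h + gr_v`, that is `j + k` in the degree
`(i, j, k) = (q, 2 gr_h, 2 gr_v)`. -/
def twiceGrPlus (d : ℤ × ℤ × ℤ) : ℤ := d.2.1 + d.2.2

/-- The polynomial grading `gr'_{-1} = q - 2 gr_h`, that is `i - j`. -/
def grMinusOne (d : ℤ × ℤ × ℤ) : ℤ := d.1 - d.2.1

/-- `H̄(L)` with the bigrading `(2 gr_+, gr'_{-1})` obtained by collapsing the triple grading. -/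
def reducedHomflyBigraded (β : BraidWord b) (s t : ℤ) : ModuleCat.{0} ℚ :=
  ModuleCat.of ℚ (⨆ (d : ℤ × ℤ × ℤ) (_ : twiceGrPlus d = s ∧ grMinusOne d = t),
    reducedHomflyPiece β d : Submodule ℚ (reducedComplex β).DoubleHomology)

/-- `ℚ`, placed in the bidegree `(0, 0)`. -/
def rationalBigraded (s t : ℤ) : ModuleCat.{0} ℚ :=
  if s = 0 ∧ t = 0 then ModuleCat.of ℚ ℚ else ModuleCat.of ℚ PUnit

/-- Triply graded spectral sequences of rational vector spaces, starting with the second page,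
whose differential `d_r` is homogeneous of degree `(2 - 2r, 2 - 2r, 2r)`. -/
abbrev TripleSpectralSequence : Type 1 :=
  SpectralSequence (ModuleCat.{0} ℚ)
    (fun r : ℤ => ComplexShape.up' ((2 - 2 * r, 2 - 2 * r, 2 * r) : ℤ × ℤ × ℤ)) 2

/-- Convergence to a space `A` with a bigrading `(s, t) = (2 gr_+, gr'_{-1})`: all differentials
vanish from some page on, and the stable page is the associated graded space of a finite decreasing
filtration of each `A s t`. The filtration degree is `k = 2 gr_v`, so that the degree `k` part of the
associated graded of `A s t` corresponds to the triple degree `(i, j, k)` with `j + k = s` and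
`i - j = t`. -/
def ConvergesTo (E : TripleSpectralSequence) (A : ℤ → ℤ → ModuleCat.{0} ℚ) : Prop :=
  ∃ F : ∀ s t : ℤ, ℤ → Submodule ℚ (A s t),
    (∀ s t, Antitone (F s t)) ∧ (∀ s t, ∃ k, F s t k = ⊤) ∧ (∀ s t, ∃ k, F s t k = ⊥) ∧
    ∃ (r₀ : ℤ) (h₀ : 2 ≤ r₀), ∀ (r : ℤ) (hr : r₀ ≤ r),
      (∀ d d', (E.page r (h₀.trans hr)).d d d' = 0) ∧
      ∀ d : ℤ × ℤ × ℤ, Nonempty ((E.page r (h₀.trans hr)).X d ≃ₗ[ℚ]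
        (F (twiceGrPlus d) (grMinusOne d) d.2.2 ⧸
          (F (twiceGrPlus d) (grMinusOne d) (d.2.2 + 1)).submoduleOf
            (F (twiceGrPlus d) (grMinusOne d) d.2.2)))

end KR

end

noncomputable section

namespace KR

/-! ### Subquotients and linear relations -/

/-! Put the total differential `D = d_+ + (-1)^{gr_h} d_v` on `C_r(D)` and filter by `2 gr_v`. Since
`d_+` preserves `gr_v` and `d_v` raises `2 gr_v` by `2`, the spectral sequence of this filtration,
with page `r` measuring jumps of `2r`, has second page `H(H(C, d_+), d_v^*)` (`second_page_equiv`).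
Both parts of `D` raise `gr_+` by `1` and preserve `gr'_{-1}`, which together with the jump `2r`
fixes the triple degree of `d_r`. The filtration is finite, so the sequence converges to `H(C, D)`
(`FilteredSpace.convergesTo`).

The total homology is much simpler than the iterated one. In the square of a crossing the column
whose vertical arrow is `1` is acyclic for `D`, so only the other column matters: a two-term complex
with map `c = X_k - X_j` up to sign. Hence `H(C, D)` is, up to shifts, the Koszul homology over
`R_r` of the linear forms `X_k - X_j`, together with one zero form for each diagram component but
one. The ring `R_r` is a polynomial ring with as many variables `n` as there are forms. A nonzero
form is a nonzerodivisor and disappears together with one variable; a zero form doubles the homology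
exactly as an unreduced factor does (`totH_equiv_standard`).

Setting `X_k = X_j` turns the crossing relation into `X_l = X_i`, so all edges of a link component
become equal (`relatorVectors_sup_paramVectors`). The forms therefore have rank `n - (ℓ - 1)`
(`finrank_paramSpan_localFactors`), and what is left is a polynomial ring in `ℓ - 1` variables with
`ℓ - 1` unreduced factors, which depends only on `ℓ` (`totH_reducedComplex_equiv`). For the
crossingless diagram of the unlink `D = 0`, so the same computation identifies this with its HOMFLY
homology; for `ℓ = 1` it is `ℚ`. -/

/-- The subquotient `Z / (B ∩ Z)`. -/
abbrev Subquotient {M : Type} [AddCommGroup M] [Module ℚ M] (Z B : Submodule ℚ M) : Type :=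
  Z ⧸ B.submoduleOf Z

section Subquotient

variable {M M' N : Type} [AddCommGroup M] [Module ℚ M] [AddCommGroup M'] [Module ℚ M']
  [AddCommGroup N] [Module ℚ N]

/-- The linear relation parametrized by `f` and `g` induces an isomorphism of subquotients if it is
total in both directions and matches the denominators. -/
theorem subquotient_equiv {Z B : Submodule ℚ M} {Z' B' : Submodule ℚ M'}
    (f : N →ₗ[ℚ] M) (g : N →ₗ[ℚ] M') (h1 : ∀ x ∈ Z, ∃ n, f n = x ∧ g n ∈ Z')
    (h2 : ∀ y ∈ Z', ∃ n, g n = y ∧ f n ∈ Z)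
    (h3 : ∀ n, f n ∈ Z → g n ∈ Z' → (f n ∈ B ↔ g n ∈ B')) :
    Nonempty (Subquotient Z B ≃ₗ[ℚ] Subquotient Z' B') := by
  -- Both subquotients are quotients of `N₀`; `h1` and `h2` give surjectivity, and `h3` says that
  -- the two kernels coincide.
  let N₀ : Submodule ℚ N := Z.comap f ⊓ Z'.comap g
  let f' : N₀ →ₗ[ℚ] Subquotient Z B := (B.submoduleOf Z).mkQ ∘ₗ
    LinearMap.codRestrict Z (f ∘ₗ N₀.subtype) fun x => x.2.1
  let g' : N₀ →ₗ[ℚ] Subquotient Z' B' := (B'.submoduleOf Z').mkQ ∘ₗ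
    LinearMap.codRestrict Z' (g ∘ₗ N₀.subtype) fun x => x.2.2
  have hf : Function.Surjective f' := by
    intro q
    obtain ⟨⟨x, hx⟩, rfl⟩ := Submodule.mkQ_surjective _ q
    obtain ⟨n, rfl, hn⟩ := h1 x hx
    exact ⟨⟨n, hx, hn⟩, rfl⟩
  have hg : Function.Surjective g' := by
    intro q
    obtain ⟨⟨y, hy⟩, rfl⟩ := Submodule.mkQ_surjective _ q
    obtain ⟨n, rfl, hn⟩ := h2 y hy
    exact ⟨⟨n, hn, hy⟩, rfl⟩
  have hk : LinearMap.ker f' = LinearMap.ker g' := by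
    ext ⟨n, hx, hy⟩
    simp only [f', g', LinearMap.mem_ker, LinearMap.comp_apply, Submodule.mkQ_apply,
      Submodule.Quotient.mk_eq_zero]
    exact h3 n hx hy
  exact ⟨(f'.quotKerEquivOfSurjective hf).symm ≪≫ₗ Submodule.quotEquivOfEq _ _ hk ≪≫ₗ
    g'.quotKerEquivOfSurjective hg⟩

theorem subquotient_subsingleton {Z B : Submodule ℚ M} (h : Z ≤ B) :
    Subsingleton (Subquotient Z B) := by
  exact Submodule.Quotient.subsingleton_iff.2 (Submodule.comap_subtype_eq_top.2 h)

end Subquotient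

/-! ### The spectral sequence of a filtered bigraded differential space -/

/-- A rational vector space with a differential `D` of degree `(2, 0)` for a bigrading by the
subspaces `P s t`, and with a bounded decreasing filtration `F` preserved by `D`, which jumps only
in degrees of one parity. -/
structure FilteredSpace where
  M : Type
  [grp : AddCommGroup M]
  [mod : Module ℚ M]
  D : M →ₗ[ℚ] M
  P : ℤ → ℤ → Submodule ℚ M
  F : ℤ → Submodule ℚ M
  D_D : ∀ x, D (D x) = 0
  D_P : ∀ {s t x}, x ∈ P s t → D x ∈ P (s + 2) t
  D_F : ∀ {k x}, x ∈ F k → D x ∈ F k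
  F_anti : Antitone F
  -- Either nothing drops from `k` to `k + 1`, or `k` has the parity of the drops and nothing drops
  -- after a degree of the other parity.
  F_parity : ∀ k, F k = F (k + 1) ∨ ∀ j : ℤ, F (k + 2 * j + 1) = F (k + 2 * j + 2)
  lo : ℤ
  hi : ℤ
  F_lo : F lo = ⊤
  F_hi : F hi = ⊥

attribute [instance] FilteredSpace.grp FilteredSpace.mod

namespace FilteredSpace

variable (S : FilteredSpace)

/-- The homology in bidegree `(s, t)`. -/
abbrev H (s t : ℤ) : Type := Subquotient (LinearMap.ker S.D ⊓ S.P s t) ((S.P (s - 2) t).map S.D)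

/-- The numerator of the page `r` in degree `d`. -/
def Z (r : ℤ) (d : ℤ × ℤ × ℤ) : Submodule ℚ S.M :=
  S.P (twiceGrPlus d) (grMinusOne d) ⊓ S.F d.2.2 ⊓ (S.F (d.2.2 + 2 * r)).comap S.D

/-- The denominator of the page `r` in degree `d`. -/
def B (r : ℤ) (d : ℤ × ℤ × ℤ) : Submodule ℚ S.M :=
  (S.P (twiceGrPlus d) (grMinusOne d) ⊓ S.F (d.2.2 + 1) ⊓ (S.F (d.2.2 + 2 * r)).comap S.D) ⊔
    ((S.P (twiceGrPlus d - 2) (grMinusOne d) ⊓ S.F (d.2.2 - 2 * r + 1)).map S.D ⊓ S.F d.2.2)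

theorem mem_Z {r : ℤ} {d : ℤ × ℤ × ℤ} {x : S.M} :
    x ∈ S.Z r d ↔ (x ∈ S.P (twiceGrPlus d) (grMinusOne d) ∧ x ∈ S.F d.2.2) ∧
      S.D x ∈ S.F (d.2.2 + 2 * r) := Iff.rfl

/-- In a degree of the parity of the drops, `F (k - 2r + 1)` is `F (k - 2(r - 1))` and `F (k + 1)`
is `F (k + 2)`, so this is the classical denominator with filtration steps of size `2`. -/
theorem mem_B {r : ℤ} {d : ℤ × ℤ × ℤ} {x : S.M} :
    x ∈ S.B r d ↔ ∃ u y, u ∈ S.P (twiceGrPlus d) (grMinusOne d) ∧ u ∈ S.F (d.2.2 + 1) ∧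
      S.D u ∈ S.F (d.2.2 + 2 * r) ∧ y ∈ S.P (twiceGrPlus d - 2) (grMinusOne d) ∧
      y ∈ S.F (d.2.2 - 2 * r + 1) ∧ S.D y ∈ S.F d.2.2 ∧ x = u + S.D y := by
  unfold B
  rw [Submodule.mem_sup]
  constructor
  · rintro ⟨u, ⟨⟨h1, h2⟩, h3⟩, _, ⟨⟨y, ⟨h4, h5⟩, rfl⟩, h6⟩, rfl⟩
    exact ⟨u, y, h1, h2, h3, h4, h5, h6, rfl⟩
  · rintro ⟨u, y, h1, h2, h3, h4, h5, h6, rfl⟩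
    exact ⟨u, ⟨⟨h1, h2⟩, h3⟩, _, ⟨⟨y, ⟨h4, h5⟩, rfl⟩, h6⟩, rfl⟩

/-- The degree of the differential of the page `r`. -/
abbrev pageDegree (r : ℤ) : ℤ × ℤ × ℤ := (2 - 2 * r, 2 - 2 * r, 2 * r)

theorem degree_add {r : ℤ} {d d' : ℤ × ℤ × ℤ} (h : d + pageDegree r = d') :
    twiceGrPlus d' = twiceGrPlus d + 2 ∧ grMinusOne d' = grMinusOne d ∧
      d'.2.2 = d.2.2 + 2 * r := by
  subst h
  simp only [twiceGrPlus, grMinusOne, pageDegree, Prod.fst_add, Prod.snd_add]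
  refine ⟨by ring, by ring, trivial⟩

theorem D_mem_Z {r : ℤ} {d d' : ℤ × ℤ × ℤ} (h : d + pageDegree r = d') {x : S.M}
    (hx : x ∈ S.Z r d) : S.D x ∈ S.Z r d' := by
  obtain ⟨h1, h2, h3⟩ := degree_add h
  rw [mem_Z] at hx ⊢
  rw [h1, h2, h3, S.D_D]
  exact ⟨⟨S.D_P hx.1.1, hx.2⟩, zero_mem _⟩

/-- `D` kills the exact summand, and the deeper summand `u` becomes the `y` of the target: its bound
`k + 1` is the target degree `k + 2r` minus `2r`, plus `1`. -/
theorem D_mem_B {r : ℤ} {d d' : ℤ × ℤ × ℤ} (h : d + pageDegree r = d') {x : S.M}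
    (hx : x ∈ S.B r d) : S.D x ∈ S.B r d' := by
  obtain ⟨h1, h2, h3⟩ := degree_add h
  rw [mem_B] at hx ⊢
  rw [h1, h2, h3]
  obtain ⟨u, y, hu1, hu2, hu3, -, -, -, rfl⟩ := hx
  refine ⟨0, u, zero_mem _, zero_mem _, by simp, by simpa using hu1, ?_, hu3, by simp [S.D_D]⟩
  convert hu2 using 2
  ring

/-- This makes every page vanish in degrees where the filtration does not drop. -/
theorem Z_le_B (r : ℤ) {d : ℤ × ℤ × ℤ} (h : S.F d.2.2 = S.F (d.2.2 + 1)) : S.Z r d ≤ S.B r d :=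
  fun x hx => (S.mem_B).2 ⟨x, 0, hx.1.1, h ▸ hx.1.2, hx.2, zero_mem _, zero_mem _, by simp,
    by simp⟩

/-- The term of the page `r` in degree `d`. -/
abbrev E (r : ℤ) (d : ℤ × ℤ × ℤ) : Type := Subquotient (S.Z r d) (S.B r d)

/-- The map induced by the differential between the terms of a page. -/
def dE {r : ℤ} {d d' : ℤ × ℤ × ℤ} (h : d + pageDegree r = d') : S.E r d →ₗ[ℚ] S.E r d' :=
  Submodule.mapQ _ _ (S.D.restrict fun _ hx => S.D_mem_Z h hx) fun _ hx => S.D_mem_B h hx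

open scoped Classical in
/-- The page `r`. -/
def page (r : ℤ) : HomologicalComplex (ModuleCat.{0} ℚ)
    (ComplexShape.up' ((2 - 2 * r, 2 - 2 * r, 2 * r) : ℤ × ℤ × ℤ)) where
  X d := ModuleCat.of ℚ (S.E r d)
  d d d' := if h : d + pageDegree r = d' then ModuleCat.ofHom (S.dE h) else 0
  shape d d' h := dif_neg h
  d_comp_d' d d' d'' h h' := by
    rw [dif_pos (show d + pageDegree r = d' from h), dif_pos (show d' + pageDegree r = d'' from h')]
    ext ⟨x, hx⟩
    have : S.dE h' (S.dE h (Submodule.Quotient.mk ⟨x, hx⟩)) =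
        Submodule.Quotient.mk ⟨S.D (S.D x), S.D_mem_Z h' (S.D_mem_Z h hx)⟩ := rfl
    refine Eq.trans this ((Submodule.Quotient.mk_eq_zero _).2 ?_)
    change S.D (S.D x) ∈ S.B r d''
    rw [S.D_D]
    exact zero_mem _

theorem page_d {r : ℤ} {d d' : ℤ × ℤ × ℤ} (h : d + pageDegree r = d') :
    (S.page r).d d d' = ModuleCat.ofHom (S.dE h) := dif_pos h

theorem mk_mem_ker {r : ℤ} {d d' : ℤ × ℤ × ℤ} (h : d + pageDegree r = d') (x : S.Z r d) :
    (Submodule.Quotient.mk x : S.E r d) ∈ LinearMap.ker (S.dE h) ↔ S.D x ∈ S.B r d' :=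
  Submodule.Quotient.mk_eq_zero _

theorem mk_mem_range {r : ℤ} {d d' : ℤ × ℤ × ℤ} (h : d + pageDegree r = d') (x : S.Z r d') :
    (Submodule.Quotient.mk x : S.E r d') ∈ LinearMap.range (S.dE h) ↔
      ∃ z ∈ S.Z r d, (x : S.M) - S.D z ∈ S.B r d' := by
  rw [LinearMap.mem_range]
  constructor
  · rintro ⟨z, hz⟩
    obtain ⟨z, rfl⟩ := Submodule.mkQ_surjective _ z
    exact ⟨z, z.2, (Submodule.Quotient.eq ((S.B r d').submoduleOf (S.Z r d'))).1 hz.symm⟩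
  · rintro ⟨z, hz, hxz⟩
    exact ⟨Submodule.Quotient.mk ⟨z, hz⟩, ((Submodule.Quotient.eq
      ((S.B r d').submoduleOf (S.Z r d'))).2 hxz).symm⟩

/-- The homology of a page is the next page. -/
theorem homology_equiv {r : ℤ} {d₀ d d₁ : ℤ × ℤ × ℤ} (h₀ : d₀ + pageDegree r = d)
    (h₁ : d + pageDegree r = d₁) :
    Nonempty (Subquotient (LinearMap.ker (S.dE h₁)) (LinearMap.range (S.dE h₀)) ≃ₗ[ℚ]
      S.E (r + 1) d) := by
  obtain ⟨a1, a2, a3⟩ := degree_add h₁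
  obtain ⟨b1, b2, b3⟩ := degree_add h₀
  have key : ∀ x ∈ S.Z r d, x ∈ S.B r d → ∀ hx, (Submodule.Quotient.mk ⟨x, hx⟩ : S.E r d) = 0 :=
    fun x _ hB hx => (Submodule.Quotient.mk_eq_zero _).2 hB
  refine subquotient_equiv (Submodule.mkQ _) (S.Z r d).subtype ?_ ?_ ?_
  · intro e he
    obtain ⟨⟨x, hx⟩, rfl⟩ := Submodule.mkQ_surjective _ e
    -- In a degree without a drop the class is zero, and `0` represents it.
    rcases S.F_parity d.2.2 with hp | hp
    · exact ⟨0, by simpa using (key x hx (S.Z_le_B r hp hx) hx).symm, zero_mem _⟩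
    -- The cycle condition reads `D x = u + D y` with `y` one step deeper than `x`. Replacing `x` by
    -- `x - y` keeps the class on page `r` and makes the differential equal to `u`, which lies in `F
    -- (k + 2r + 1) = F (k + 2r + 2)` by parity.
    · obtain ⟨u, y, hu1, hu2, hu3, hy1, hy2, hy3, h⟩ := S.mem_B.1 ((S.mk_mem_ker h₁ _).1 he)
      rw [a1, a2] at hy1
      rw [a3] at hu2 hy2 hy3
      have hyZ : y ∈ S.P (twiceGrPlus d) (grMinusOne d) ∧ y ∈ S.F (d.2.2 + 1) ∧
          S.D y ∈ S.F (d.2.2 + 2 * r) :=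
        ⟨by simpa using hy1, by convert hy2 using 2; ring, hy3⟩
      have hyB : y ∈ S.B r d := S.mem_B.2 ⟨y, 0, hyZ.1, hyZ.2.1, hyZ.2.2, zero_mem _, zero_mem _,
        by simp, by simp⟩
      have hyF : y ∈ S.F d.2.2 := S.F_anti (by omega) hyZ.2.1
      have hxy : x - y ∈ S.Z r d := sub_mem hx ⟨⟨hyZ.1, hyF⟩, hyZ.2.2⟩
      refine ⟨⟨x - y, hxy⟩, (Submodule.Quotient.eq _).2 ?_, hxy.1, ?_⟩
      · show x - y - x ∈ S.B r d
        rw [sub_sub_cancel_left]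
        exact neg_mem hyB
      · show S.D (x - y) ∈ S.F _
        have h' : S.D (x - y) = u := by
          rw [map_sub, sub_eq_iff_eq_add]; exact h
        rw [h', show d.2.2 + 2 * (r + 1) = d.2.2 + 2 * r + 2 by ring, ← hp]
        exact hu2
  · intro y hy
    have hyZ : y ∈ S.Z r d := ⟨hy.1, S.F_anti (by omega) hy.2⟩
    refine ⟨⟨y, hyZ⟩, rfl, (S.mk_mem_ker h₁ _).2 ?_⟩
    refine S.mem_B.2 ⟨S.D y, 0, ?_, ?_, by simp [S.D_D], zero_mem _, zero_mem _, by simp, by simp⟩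
    · rw [a1, a2]; exact S.D_P hy.1.1
    · exact S.F_anti (by omega) hy.2
  · rintro ⟨z, hz⟩ - hy
    refine (S.mk_mem_range h₀ ⟨z, hz⟩).trans ?_
    change z ∈ S.Z (r + 1) d at hy
    change _ ↔ z ∈ S.B (r + 1) d
    constructor
    · rintro ⟨w, hw, hB⟩
      obtain ⟨u, y, hu1, hu2, hu3, hy1, hy2, hy3, h⟩ := S.mem_B.1 hB
      -- The element `w` that witnesses membership in the range is absorbed into the exact part.
      -- This is possible because page `r + 1` allows boundaries of elements from lower filtration.
      -- Since `D z = D u`, the stronger condition on `z` passes to `u`.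
      have e1 : z = u + S.D (y + w) := by
        rw [map_add, ← add_assoc, ← h]; simp
      have e2 : S.D z = S.D u := by rw [e1]; simp [S.D_D]
      refine S.mem_B.2 ⟨u, y + w, hu1, hu2, e2 ▸ hy.2, add_mem hy1 ?_, add_mem ?_ ?_, ?_, e1⟩
      · rw [b1, b2]; simpa using hw.1.1
      · exact S.F_anti (by omega) hy2
      · exact S.F_anti (by omega) hw.1.2
      · rw [map_add]
        refine add_mem hy3 ?_
        rw [b3]; exact hw.2
    · intro hB
      rcases S.F_parity d.2.2 with hp | hp
      · exact ⟨0, zero_mem _, by simpa using S.Z_le_B r hp hz⟩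
      · obtain ⟨u, y, hu1, hu2, hu3, hy1, hy2, hy3, rfl⟩ := S.mem_B.1 hB
        refine ⟨y, ⟨⟨?_, ?_⟩, ?_⟩, ?_⟩
        · rw [b1, b2] at hy1; simpa using hy1
        -- Parity sharpens the bound `k - 2(r + 1) + 1` on `y` to `k - 2r`, the filtration degree of
        -- the source.
        · have := hp (-r - 1)
          rw [show d₀.2.2 = d.2.2 + 2 * (-r - 1) + 2 by rw [b3]; ring, ← this]
          rwa [show d.2.2 + 2 * (-r - 1) + 1 = d.2.2 - 2 * (r + 1) + 1 by ring]
        · show S.D y ∈ S.F _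
          rw [← b3]; exact hy3
        · simp only [add_sub_cancel_right]
          exact S.mem_B.2 ⟨u, 0, hu1, hu2, S.F_anti (by omega) hu3, zero_mem _, zero_mem _,
            by simp, by simp⟩

theorem page_homology_iso (r : ℤ) (d : ℤ × ℤ × ℤ) :
    Nonempty ((S.page r).homology d ≅ (S.page (r + 1)).X d) := by
  have h₁ : d + pageDegree r = (ComplexShape.up' (pageDegree r)).next d :=
    (ComplexShape.next_eq' _ (show (ComplexShape.up' (pageDegree r)).Rel d _ from rfl)).symm
  have h₀ : (ComplexShape.up' (pageDegree r)).prev d + pageDegree r = d := by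
    rw [ComplexShape.prev_eq' _ (show (ComplexShape.up' (pageDegree r)).Rel (d - pageDegree r) d
      from sub_add_cancel _ _), sub_add_cancel]
  obtain ⟨e⟩ := S.homology_equiv h₀ h₁
  have hf : ((S.page r).sc d).f.hom = S.dE h₀ := by
    show ((S.page r).d _ _).hom = _
    rw [S.page_d h₀]; rfl
  have hg : ((S.page r).sc d).g.hom = S.dE h₁ := by
    show ((S.page r).d _ _).hom = _
    rw [S.page_d h₁]; rfl
  refine ⟨((S.page r).sc d).moduleCatHomologyIso ≪≫ LinearEquiv.toModuleIso ?_⟩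
  have hker := congrArg LinearMap.ker hg
  refine (Submodule.Quotient.equiv (LinearMap.range ((S.page r).sc d).moduleCatToCycles)
    ((LinearMap.range (S.dE h₀)).submoduleOf (LinearMap.ker (S.dE h₁)))
    (LinearEquiv.ofEq _ _ hker) ?_).trans e
  ext ⟨x, hx⟩
  simp only [Submodule.mem_map, LinearMap.mem_range]
  constructor
  · rintro ⟨_, ⟨y, rfl⟩, h⟩
    exact ⟨y, by rw [← hf]; exact congrArg Subtype.val h⟩
  · rintro ⟨y, h⟩
    exact ⟨_, ⟨y, rfl⟩, Subtype.ext (by rw [← hf] at h; exact h)⟩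

/-- The spectral sequence of a filtered bigraded differential space. -/
def spectralSequence : TripleSpectralSequence where
  page r _ := S.page r
  iso r _ d h _ := h ▸ (S.page_homology_iso r d).some

theorem F_eq_of_lt {k : ℤ} (h : k < S.lo ∨ S.hi ≤ k) : S.F k = S.F (k + 1) := by
  rcases h with h | h
  · have h1 : S.F k = ⊤ := top_le_iff.1 (S.F_lo ▸ S.F_anti (by omega))
    have h2 : S.F (k + 1) = ⊤ := top_le_iff.1 (S.F_lo ▸ S.F_anti (by omega))
    rw [h1, h2]
  · have h1 : S.F k = ⊥ := le_bot_iff.1 (S.F_hi ▸ S.F_anti (by omega))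
    have h2 : S.F (k + 1) = ⊥ := le_bot_iff.1 (S.F_hi ▸ S.F_anti (by omega))
    rw [h1, h2]

/-- The filtration of the homology. -/
def filH (s t k : ℤ) : Submodule ℚ (S.H s t) :=
  ((S.F k).submoduleOf (LinearMap.ker S.D ⊓ S.P s t)).map (Submodule.mkQ _)

/-- When `2r` is at least the length of the filtration and the filtration drops at `k`, the
condition `D x ∈ F (k + 2r)` means `D x = 0`, and the bound on `y` is empty. The page is then cycles
in `F k` modulo cycles in `F (k + 1)` and all boundaries. -/
theorem stable_page_equiv {r : ℤ} (hr : S.hi - S.lo ≤ 2 * r) (d : ℤ × ℤ × ℤ) :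
    Nonempty (S.E r d ≃ₗ[ℚ] Subquotient (S.filH (twiceGrPlus d) (grMinusOne d) d.2.2)
      (S.filH (twiceGrPlus d) (grMinusOne d) (d.2.2 + 1))) := by
  by_cases hk : S.F d.2.2 = S.F (d.2.2 + 1)
  · have := subquotient_subsingleton (S.Z_le_B r hk)
    have : Subsingleton (Subquotient (S.filH (twiceGrPlus d) (grMinusOne d) d.2.2)
      (S.filH (twiceGrPlus d) (grMinusOne d) (d.2.2 + 1))) :=
      subquotient_subsingleton (by unfold filH; rw [hk])
    exact ⟨0, 0, fun _ => Subsingleton.elim _ _, fun _ => Subsingleton.elim _ _⟩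
  have hlo : S.lo ≤ d.2.2 ∧ d.2.2 < S.hi := by
    by_contra h
    exact hk (S.F_eq_of_lt (by omega))
  have hbot : S.F (d.2.2 + 2 * r) = ⊥ := le_bot_iff.1 (S.F_hi ▸ S.F_anti (by omega))
  have htop : S.F (d.2.2 - 2 * r + 1) = ⊤ := top_le_iff.1 (S.F_lo ▸ S.F_anti (by omega))
  refine subquotient_equiv (LinearMap.ker S.D ⊓
    S.P (twiceGrPlus d) (grMinusOne d)).subtype (Submodule.mkQ _) ?_ ?_ ?_
  · rintro x ⟨⟨h1, h2⟩, h3⟩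
    have h3' : S.D x = 0 := (Submodule.mem_bot ℚ).1 (hbot ▸ h3)
    have hx : x ∈ LinearMap.ker S.D ⊓ S.P (twiceGrPlus d) (grMinusOne d) := ⟨h3', h1⟩
    exact ⟨⟨x, hx⟩, rfl, ⟨x, hx⟩, h2, rfl⟩
  · rintro _ ⟨⟨x, hx⟩, h2, rfl⟩
    refine ⟨⟨x, hx⟩, rfl, ⟨hx.2, h2⟩, ?_⟩
    change S.D x ∈ S.F (d.2.2 + 2 * r)
    rw [show S.D x = 0 from hx.1]
    exact zero_mem _
  · rintro ⟨z, hz⟩ hx -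
    refine S.mem_B.trans ?_
    change z ∈ S.Z r d at hx
    change (∃ u y, _ ∧ _ ∧ _ ∧ _ ∧ _ ∧ _ ∧ z = _) ↔ _
    have hD : S.D z = 0 := hz.1
    constructor
    · rintro ⟨u, y, hu1, hu2, hu3, hy1, hy2, hy3, rfl⟩
      have hu : u ∈ LinearMap.ker S.D ⊓ S.P (twiceGrPlus d) (grMinusOne d) :=
        ⟨by simpa [S.D_D] using hD, hu1⟩
      refine ⟨⟨u, hu⟩, hu2, (Submodule.Quotient.eq _).2 ?_⟩
      refine ⟨-y, neg_mem hy1, ?_⟩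
      simp
    · rintro ⟨⟨u, hu⟩, hu2, h⟩
      obtain ⟨y, hy1, hy⟩ := (Submodule.Quotient.eq _).1 h
      have hu2' : u ∈ S.F (d.2.2 + 1) := hu2
      have e : z = u + S.D (-y) := by
        rw [map_neg, hy]; simp
      refine ⟨u, -y, hu.2, hu2', ?_, neg_mem hy1, htop ▸ trivial, ?_, e⟩
      · rw [show S.D u = 0 from hu.1]; exact zero_mem _
      · have h1 : S.D (-y) = z - u := by rw [e]; simp
        rw [h1]
        exact sub_mem hx.1.2 (S.F_anti (by omega) hu2')

/-- Where the filtration drops, an element of the numerator is already a `D`-cycle; elsewhere the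
source is zero. -/
theorem stable_page_d_eq_zero {r : ℤ} (hr : S.hi - S.lo ≤ 2 * r)
    (d d' : ℤ × ℤ × ℤ) : (S.page r).d d d' = 0 := by
  by_cases h : d + pageDegree r = d'
  swap
  · exact (S.page r).shape _ _ h
  rw [S.page_d h]
  have : S.dE h = 0 := by
    by_cases hk : S.F d.2.2 = S.F (d.2.2 + 1)
    · have := subquotient_subsingleton (S.Z_le_B r hk)
      exact LinearMap.ext fun x => by rw [Subsingleton.elim x 0, map_zero, map_zero]
    have hlo : S.lo ≤ d.2.2 ∧ d.2.2 < S.hi := by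
      by_contra h
      exact hk (S.F_eq_of_lt (by omega))
    have hbot : S.F (d.2.2 + 2 * r) = ⊥ := le_bot_iff.1 (S.F_hi ▸ S.F_anti (by omega))
    ext ⟨x, hx⟩
    refine (Submodule.Quotient.mk_eq_zero _).2 ?_
    have : S.D x = 0 := (Submodule.mem_bot ℚ).1 (hbot ▸ hx.2)
    change S.D x ∈ S.B r d'
    rw [this]; exact zero_mem _
  rw [this]; rfl

/-- The spectral sequence converges to the homology. -/
theorem convergesTo (A : ℤ → ℤ → ModuleCat.{0} ℚ)
    (hA : ∀ s t, Nonempty (S.H s t ≃ₗ[ℚ] A s t)) : ConvergesTo S.spectralSequence A := by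
  -- The bound is not sharp: only `S.hi - S.lo ≤ 2 * r` is needed.
  refine ⟨fun s t k => (S.filH s t k).map (hA s t).some.toLinearMap, ?_, ?_, ?_,
    max 2 (S.hi - S.lo), le_max_left _ _, ?_⟩
  · intro s t k k' h
    exact Submodule.map_mono (Submodule.map_mono (Submodule.comap_mono (S.F_anti h)))
  · intro s t
    refine ⟨S.lo, ?_⟩
    beta_reduce
    rw [filH, S.F_lo, show (⊤ : Submodule ℚ S.M).submoduleOf (LinearMap.ker S.D ⊓ S.P s t) = ⊤ from rfl, Submodule.map_top,
      Submodule.range_mkQ, Submodule.map_top, LinearEquiv.range]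
  · intro s t
    refine ⟨S.hi, ?_⟩
    beta_reduce
    rw [filH, S.F_hi, show (⊥ : Submodule ℚ S.M).submoduleOf (LinearMap.ker S.D ⊓ S.P s t) = ⊥ from
        Submodule.ker_subtype _,
      Submodule.map_bot, Submodule.map_bot]
  · intro r hr
    have hr' : S.hi - S.lo ≤ 2 * r := by omega
    refine ⟨fun d d' => S.stable_page_d_eq_zero hr' d d', fun d => ?_⟩
    obtain ⟨e⟩ := S.stable_page_equiv hr' d
    set f := (hA (twiceGrPlus d) (grMinusOne d)).some
    obtain ⟨e'⟩ := subquotient_equiv (Z := S.filH (twiceGrPlus d) (grMinusOne d) d.2.2)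
      (B := S.filH (twiceGrPlus d) (grMinusOne d) (d.2.2 + 1))
      (Z' := (S.filH (twiceGrPlus d) (grMinusOne d) d.2.2).map f.toLinearMap)
      (B' := (S.filH (twiceGrPlus d) (grMinusOne d) (d.2.2 + 1)).map f.toLinearMap)
      LinearMap.id f.toLinearMap (fun x hx => ⟨x, rfl, Submodule.mem_map_of_mem hx⟩)
      (by rintro _ ⟨x, hx, rfl⟩; exact ⟨x, rfl, hx⟩)
      (fun x _ _ => (f.injective.mem_set_image).symm)
    exact ⟨e ≪≫ₗ e'⟩

theorem spectralSequence_d_ne_zero {r : ℤ} (hr : 2 ≤ r) {d d' : ℤ × ℤ × ℤ}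
    (h : (S.spectralSequence.page r hr).d d d' ≠ 0) :
    d' = d + (2 - 2 * r, 2 - 2 * r, 2 * r) ∧
      twiceGrPlus d' = twiceGrPlus d + 2 ∧ grMinusOne d' = grMinusOne d := by
  have h' : d + pageDegree r = d' := by
    by_contra h1
    exact h ((S.page r).shape _ _ h1)
  exact ⟨h'.symm, (degree_add h').1, (degree_add h').2.1⟩

end FilteredSpace

/-! ### The total complex of a free complex -/

section Total

variable {A : Type} [CommRing A] [Algebra ℚ A] {𝒜 : ℤ → Submodule ℚ A}

/-- Projections to the homogeneous parts of a graded algebra. -/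
structure GradedProjection (𝒜 : ℤ → Submodule ℚ A) where
  proj : ℤ → A →ₗ[ℚ] A
  mem : ∀ n a, proj n a ∈ 𝒜 n
  self : ∀ {n a}, a ∈ 𝒜 n → proj n a = a
  mul : ∀ {m a}, a ∈ 𝒜 m → ∀ n x, proj (m + n) (a * x) = a * proj n x

namespace FreeComplex

variable (C : FreeComplex A 𝒜)

/-- The sign `(-1) ^ gr_h`. -/
def parity : C.Carrier →ₗ[ℚ] C.Carrier where
  toFun m x := sgn A (C.h x) * m x
  map_add' m n := by ext x; simp [mul_add]
  map_smul' c m := by ext x; simp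

theorem parity_apply (m : C.Carrier) (x : C.ι) : C.parity m x = sgn A (C.h x) * m x := rfl

@[simp]
theorem parity_parity (m : C.Carrier) : C.parity (C.parity m) = m := by
  ext x
  rw [parity_apply, parity_apply, ← mul_assoc, sgn_mul_self, one_mul]

theorem parity_eq (m : C.Carrier) : C.parity m = (signMatrix A C.h).mulVec m := by
  ext x
  simp [parity_apply, signMatrix, Matrix.mulVec_diagonal]

theorem dPlus_apply (m : C.Carrier) : C.dPlus m = C.dp.mulVec m := rfl

theorem dVert_apply (m : C.Carrier) : C.dVert m = C.dv.mulVec m := rfl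

theorem dPlus_dPlus (m : C.Carrier) : C.dPlus (C.dPlus m) = 0 := by
  simp [dPlus_apply, C.dp_dp]

theorem dVert_dVert (m : C.Carrier) : C.dVert (C.dVert m) = 0 := by
  simp [dVert_apply, C.dv_dv]

theorem dPlus_parity (m : C.Carrier) : C.dPlus (C.parity m) = -C.parity (C.dPlus m) := by
  rw [parity_eq, parity_eq, dPlus_apply, dPlus_apply, Matrix.mulVec_mulVec, Matrix.mulVec_mulVec,
    signMatrix_anti C.h C.dp fun x y h => (C.dp_deg x y h).1, Matrix.neg_mulVec, neg_neg]

theorem dVert_parity (m : C.Carrier) : C.dVert (C.parity m) = C.parity (C.dVert m) := by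
  rw [parity_eq, parity_eq, dVert_apply, dVert_apply, Matrix.mulVec_mulVec, Matrix.mulVec_mulVec,
    signMatrix_comm C.h C.dv fun x y h => (C.dv_deg x y h).1]

/-- The total differential `d_+ + (-1) ^ gr_h d_v`. -/
def totD : C.Carrier →ₗ[ℚ] C.Carrier := C.dPlus + C.parity ∘ₗ C.dVert

theorem totD_apply (m : C.Carrier) : C.totD m = C.dPlus m + C.parity (C.dVert m) := rfl

/-- The two differentials commute, so a sign is needed: `d_+` anticommutes with the parity and `d_v`
commutes with it, hence the mixed terms cancel. -/
theorem totD_totD (m : C.Carrier) : C.totD (C.totD m) = 0 := by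
  simp only [totD_apply, map_add, dPlus_dPlus, dPlus_parity, dVert_parity, dVert_dVert,
    dVert_dPlus, map_zero]
  abel

theorem parity_smul (a : A) (m : C.Carrier) : C.parity (a • m) = a • C.parity m := by
  ext x
  simp only [parity_apply, Pi.smul_apply, smul_eq_mul]
  ring

theorem totD_smul (a : A) (m : C.Carrier) : C.totD (a • m) = a • C.totD m := by
  simp only [totD_apply, dPlus_apply, dVert_apply, Matrix.mulVec_smul, parity_smul, smul_add]

/-- The part of bidegree `(s, t)` for `(2 gr_+, gr'_{-1})`. -/
def totPiece (s t : ℤ) : Submodule ℚ C.Carrier where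
  -- A coefficient of degree `n` at the basis vector `x` contributes `q = n + C.q x`, so `q - 2 gr_h
  -- = t` fixes `n = t + 2 * C.h x - C.q x`.
  carrier := {m | ∀ x, m x ∈ 𝒜 (t + 2 * C.h x - C.q x) ∧ (m x ≠ 0 → 2 * C.h x + 2 * C.v x = s)}
  add_mem' {m n} hm hn x := by
    refine ⟨Submodule.add_mem _ (hm x).1 (hn x).1, fun h => ?_⟩
    by_cases h0 : m x = 0
    · exact (hn x).2 fun h1 => h (by simp [h0, h1])
    · exact (hm x).2 h0
  zero_mem' x := ⟨Submodule.zero_mem _, fun h => absurd rfl h⟩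
  smul_mem' c m hm x := by
    refine ⟨Submodule.smul_mem _ c (hm x).1, fun h => (hm x).2 fun h0 => h ?_⟩
    simp [h0]

/-- The filtration by `2 gr_v`. -/
def vfil (k : ℤ) : Submodule ℚ C.Carrier where
  carrier := {m | ∀ x, m x ≠ 0 → k ≤ 2 * C.v x}
  add_mem' {m n} hm hn x h := by
    by_cases h0 : m x = 0
    · exact hn x fun h1 => h (by simp [h0, h1])
    · exact hm x h0
  zero_mem' x h := absurd rfl h
  smul_mem' c m hm x h := hm x fun h0 => h (by simp [h0])

theorem exists_of_dPlus_ne_zero {m : C.Carrier} {x : C.ι} (h : C.dPlus m x ≠ 0) :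
    ∃ y, C.dp x y ≠ 0 ∧ m y ≠ 0 := by
  obtain ⟨y, -, hy⟩ := Finset.exists_ne_zero_of_sum_ne_zero h
  exact ⟨y, left_ne_zero_of_mul hy, right_ne_zero_of_mul hy⟩

theorem exists_of_dVert_ne_zero {m : C.Carrier} {x : C.ι} (h : C.dVert m x ≠ 0) :
    ∃ y, C.dv x y ≠ 0 ∧ m y ≠ 0 := by
  obtain ⟨y, -, hy⟩ := Finset.exists_ne_zero_of_sum_ne_zero h
  exact ⟨y, left_ne_zero_of_mul hy, right_ne_zero_of_mul hy⟩

omit [Algebra ℚ A] in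
theorem sgn_mul_ne_zero {n : ℤ} {a : A} (h : sgn A n * a ≠ 0) : a ≠ 0 := right_ne_zero_of_mul h

theorem parity_mem_totPiece {s t : ℤ} {m : C.Carrier} (hm : m ∈ C.totPiece s t) :
    C.parity m ∈ C.totPiece s t := fun x =>
  ⟨sgn_mul_mem _ (hm x).1, fun h => (hm x).2 (sgn_mul_ne_zero h)⟩

theorem parity_mem_piece {d : ℤ × ℤ × ℤ} {m : C.Carrier} (hm : m ∈ C.piece d) :
    C.parity m ∈ C.piece d := fun x =>
  ⟨sgn_mul_mem _ (hm x).1, fun h => (hm x).2 (sgn_mul_ne_zero h)⟩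

theorem parity_mem_vfil {k : ℤ} {m : C.Carrier} (hm : m ∈ C.vfil k) :
    C.parity m ∈ C.vfil k := fun x h => hm x (sgn_mul_ne_zero h)

theorem dPlus_mem_vfil {k : ℤ} {m : C.Carrier} (hm : m ∈ C.vfil k) :
    C.dPlus m ∈ C.vfil k := fun x h => by
  obtain ⟨y, h1, h2⟩ := C.exists_of_dPlus_ne_zero h
  rw [(C.dp_deg x y h1).2]
  exact hm y h2

theorem dVert_mem_vfil {k : ℤ} {m : C.Carrier} (hm : m ∈ C.vfil k) :
    C.dVert m ∈ C.vfil (k + 2) := fun x h => by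
  obtain ⟨y, h1, h2⟩ := C.exists_of_dVert_ne_zero h
  have := hm y h2
  have := (C.dv_deg x y h1).2
  omega

theorem vfil_anti : Antitone C.vfil := fun _ _ h _ hm x hx => h.trans (hm x hx)

theorem totD_mem_vfil {k : ℤ} {m : C.Carrier} (hm : m ∈ C.vfil k) : C.totD m ∈ C.vfil k :=
  add_mem (C.dPlus_mem_vfil hm)
    (C.parity_mem_vfil (C.vfil_anti (by omega) (C.dVert_mem_vfil hm)))

variable (hmul : ∀ {m n : ℤ} {x y : A}, x ∈ 𝒜 m → y ∈ 𝒜 n → x * y ∈ 𝒜 (m + n))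

-- `d_+` raises `q` by `2` and `gr_h` by `1`, and `d_v` raises only `gr_v`, by `1`. Both therefore
-- raise `2 gr_+` by `2` and preserve `q - 2 gr_h`.
include hmul in
theorem totD_mem_totPiece {s t : ℤ} {m : C.Carrier} (hm : m ∈ C.totPiece s t) :
    C.totD m ∈ C.totPiece (s + 2) t := by
  refine add_mem (fun x => ⟨?_, fun h => ?_⟩) (C.parity_mem_totPiece fun x => ⟨?_, fun h => ?_⟩)
  · refine Submodule.sum_mem _ fun y _ => ?_
    by_cases h : C.dp x y = 0
    · simp [h]
    · convert hmul (C.dp_mem x y) (hm y).1 using 2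
      have := C.dp_deg x y h
      omega
  · obtain ⟨y, h1, h2⟩ := C.exists_of_dPlus_ne_zero h
    have := C.dp_deg x y h1
    have := (hm y).2 h2
    omega
  · refine Submodule.sum_mem _ fun y _ => ?_
    by_cases h : C.dv x y = 0
    · simp [h]
    · convert hmul (C.dv_mem x y) (hm y).1 using 2
      have := C.dv_deg x y h
      omega
  · obtain ⟨y, h1, h2⟩ := C.exists_of_dVert_ne_zero h
    have := C.dv_deg x y h1
    have := (hm y).2 h2
    omega

/-- The homology of the total complex in bidegree `(s, t)`. -/
abbrev totH (s t : ℤ) : Type :=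
  Subquotient (LinearMap.ker C.totD ⊓ C.totPiece s t) ((C.totPiece (s - 2) t).map C.totD)

theorem vfil_succ {k : ℤ} (hk : k % 2 = 1) : C.vfil k = C.vfil (k + 1) := by
  refine le_antisymm (fun m hm x hx => ?_) (C.vfil_anti (by omega))
  have := hm x hx
  omega

/-- The total complex with the filtration by `gr_v` and with shifted degrees. -/
def filteredSpace (σ : ℤ × ℤ × ℤ) : FilteredSpace where
  M := C.Carrier
  D := C.totD
  P s t := C.totPiece (s - twiceGrPlus σ) (t - grMinusOne σ)
  F k := C.vfil (k - σ.2.2)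
  D_D := C.totD_totD
  D_P {s t x} hx := by
    have := C.totD_mem_totPiece hmul hx
    rwa [show s - twiceGrPlus σ + 2 = s + 2 - twiceGrPlus σ by ring] at this
  D_F hx := C.totD_mem_vfil hx
  F_anti _ _ h := C.vfil_anti (by omega)
  -- The values `2 * C.v x` are even, so drops occur only right after degrees `k` with `k - σ.2.2`
  -- even.
  F_parity k := by
    rcases Int.emod_two_eq_zero_or_one (k - σ.2.2) with h | h
    · right
      intro j
      rw [show k + 2 * j + 2 - σ.2.2 = k + 2 * j + 1 - σ.2.2 + 1 by ring]
      exact C.vfil_succ (by omega)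
    · left
      rw [show k + 1 - σ.2.2 = k - σ.2.2 + 1 by ring]
      exact C.vfil_succ h
  -- The sum dominates each `|2 * C.v x|`; the extra `1` in `hi` puts it strictly above all values.
  lo := -(∑ x, |2 * C.v x|) + σ.2.2
  hi := ∑ x, |2 * C.v x| + 1 + σ.2.2
  F_lo := by
    refine top_le_iff.1 fun m _ x _ => ?_
    have := Finset.single_le_sum (f := fun x => |2 * C.v x|) (fun _ _ => abs_nonneg _)
      (Finset.mem_univ x)
    have := neg_abs_le (2 * C.v x)
    omega
  F_hi := by
    refine le_bot_iff.1 fun m hm => (Submodule.mem_bot ℚ).2 ?_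
    ext x
    by_contra h
    have := hm x h
    have := Finset.single_le_sum (f := fun x => |2 * C.v x|) (fun _ _ => abs_nonneg _)
      (Finset.mem_univ x)
    have := le_abs_self (2 * C.v x)
    omega

/-! ### The second page -/

/-- The component of vertical degree `2 gr_v = k`. -/
def vcomp (k : ℤ) : C.Carrier →ₗ[ℚ] C.Carrier where
  toFun m x := if 2 * C.v x = k then m x else 0
  map_add' m n := by ext x; simp only [Pi.add_apply]; split_ifs <;> simp
  map_smul' c m := by ext x; simp

theorem vcomp_apply (k : ℤ) (m : C.Carrier) (x : C.ι) :
    C.vcomp k m x = if 2 * C.v x = k then m x else 0 := rfl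

theorem vcomp_parity (k : ℤ) (m : C.Carrier) : C.vcomp k (C.parity m) = C.parity (C.vcomp k m) := by
  ext x
  simp [vcomp_apply, parity_apply]

-- A projection commutes with a differential if it does so on every nonzero matrix entry. It is used
-- with `c` the identity for vertical components and with `c` a homogeneous projection of the ring.
omit [Algebra ℚ A] in
theorem ite_map_sum {ι : Type} [Fintype ι] (a m m' : ι → A) (c : A →+ A) (P : Prop) [Decidable P]
    (h : ∀ y, a y ≠ 0 → (if P then c (a y * m y) else 0) = a y * m' y) :
    (if P then c (∑ y, a y * m y) else 0) = ∑ y, a y * m' y := by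
  have h' : ∀ y, (if P then c (a y * m y) else 0) = a y * m' y := fun y => by
    by_cases h0 : a y = 0
    · simp [h0]
    · exact h y h0
  simp only [← h']
  split_ifs <;> simp

theorem vcomp_dPlus (k : ℤ) (m : C.Carrier) : C.vcomp k (C.dPlus m) = C.dPlus (C.vcomp k m) := by
  ext x
  refine ite_map_sum (C.dp x) m _ (AddMonoidHom.id A) _ fun y hy => ?_
  rw [vcomp_apply, (C.dp_deg x y hy).2]
  simp

theorem vcomp_dVert (k : ℤ) (m : C.Carrier) :
    C.vcomp (k + 2) (C.dVert m) = C.dVert (C.vcomp k m) := by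
  ext x
  refine ite_map_sum (C.dv x) m _ (AddMonoidHom.id A) _ fun y hy => ?_
  rw [vcomp_apply, (C.dv_deg x y hy).2]
  simp only [mul_add, mul_one, add_left_inj]
  simp

theorem vcomp_of_mem_vfil {k j : ℤ} (h : j < k) {m : C.Carrier} (hm : m ∈ C.vfil k) :
    C.vcomp j m = 0 := by
  ext x
  rw [vcomp_apply]
  split_ifs with hx
  · by_contra h0
    have := hm x h0
    omega
  · rfl

theorem vcomp_mem_vfil (k : ℤ) (m : C.Carrier) : C.vcomp k m ∈ C.vfil k := fun _ h =>
  (ite_ne_right_iff.1 h).1.ge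

theorem sub_vcomp_mem_vfil {k : ℤ} {m : C.Carrier} (hm : m ∈ C.vfil k) :
    m - C.vcomp k m ∈ C.vfil (k + 1) := fun x h => by
  rw [Pi.sub_apply, vcomp_apply] at h
  split_ifs at h with h1
  · simp at h
  · rw [sub_zero] at h
    have := hm x h
    omega

theorem vcomp_mem_piece {s t k : ℤ} {m : C.Carrier} (hm : m ∈ C.totPiece s t) :
    C.vcomp k m ∈ C.piece (t + (s - k), s - k, k) := fun x => by
  rw [vcomp_apply]
  split_ifs with h
  · by_cases h0 : m x = 0
    · simp [h0]
    have := (hm x).2 h0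
    refine ⟨?_, fun _ => ⟨by simp only; omega, h⟩⟩
    convert (hm x).1 using 2
    simp only; omega
  · simp

theorem vcomp_of_mem_piece {d : ℤ × ℤ × ℤ} {m : C.Carrier} (hm : m ∈ C.piece d) :
    C.vcomp d.2.2 m = m := by
  ext x
  rw [vcomp_apply]
  split_ifs with h
  · rfl
  · by_contra h0
    exact h ((hm x).2 (Ne.symm h0)).2

theorem piece_le_vfil (d : ℤ × ℤ × ℤ) : C.piece d ≤ C.vfil d.2.2 := fun _ hm x h =>
  ((hm x).2 h).2.ge

theorem piece_le_totPiece (d : ℤ × ℤ × ℤ) :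
    C.piece d ≤ C.totPiece (twiceGrPlus d) (grMinusOne d) := fun m hm x => by
  refine ⟨?_, fun h => ?_⟩
  · by_cases h : m x = 0
    · simp [h]
    convert (hm x).1 using 2
    have := (hm x).2 h
    simp only [grMinusOne]; omega
  · have := (hm x).2 h
    simp only [twiceGrPlus]; omega

/-- The cycles of the double homology. -/
def doubleZ (d : ℤ × ℤ × ℤ) : Submodule ℚ C.Carrier :=
  C.piece d ⊓ LinearMap.ker C.dPlus ⊓ ((C.piece (d + (-2, -2, 2))).map C.dPlus).comap C.dVert

/-- The boundaries of the double homology. -/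
def doubleB (d : ℤ × ℤ × ℤ) : Submodule ℚ C.Carrier :=
  (C.piece (d - (2, 2, 0))).map C.dPlus ⊔
    (C.piece (d - (0, 0, 2)) ⊓ LinearMap.ker C.dPlus).map C.dVert

/-- The degree `d + (-2, -2, 2)` is the one that `d_+` carries to `d + (0, 0, 2)`, the degree of
`d_v m`. -/
theorem mem_doubleZ {d : ℤ × ℤ × ℤ} {m : C.Carrier} : m ∈ C.doubleZ d ↔
    (m ∈ C.piece d ∧ C.dPlus m = 0) ∧ ∃ y ∈ C.piece (d + (-2, -2, 2)), C.dPlus y = C.dVert m :=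
  Iff.rfl

theorem mem_doubleB {d : ℤ × ℤ × ℤ} {m : C.Carrier} : m ∈ C.doubleB d ↔
    ∃ u ∈ C.piece (d - (2, 2, 0)), ∃ w ∈ C.piece (d - (0, 0, 2)), C.dPlus w = 0 ∧
      m = C.dPlus u + C.dVert w := by
  rw [doubleB, Submodule.mem_sup]
  constructor
  · rintro ⟨_, ⟨u, hu, rfl⟩, _, ⟨w, hw, rfl⟩, rfl⟩
    exact ⟨u, hu, w, hw.1, hw.2, rfl⟩
  · rintro ⟨u, hu, w, hw, hw', rfl⟩
    exact ⟨_, ⟨u, hu, rfl⟩, _, ⟨w, ⟨hw, hw'⟩, rfl⟩, rfl⟩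

theorem vcomp_mem_piece' {s t k : ℤ} {m : C.Carrier} (hm : m ∈ C.totPiece s t) {d : ℤ × ℤ × ℤ}
    (h1 : twiceGrPlus d = s) (h2 : grMinusOne d = t) (h3 : d.2.2 = k) : C.vcomp k m ∈ C.piece d := by
  have := C.vcomp_mem_piece (k := k) hm
  convert this using 2
  simp only [twiceGrPlus, grMinusOne] at h1 h2
  ext <;> simp only <;> omega

theorem mem_totPiece_of_piece {s t : ℤ} {m : C.Carrier} {d : ℤ × ℤ × ℤ} (hm : m ∈ C.piece d)
    (h1 : twiceGrPlus d = s) (h2 : grMinusOne d = t) : m ∈ C.totPiece s t := by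
  subst h1 h2
  exact C.piece_le_totPiece d hm

/-- The isomorphism takes the lowest vertical component. For `x = x_k + x_{k+2} + ...` the condition
`D x ∈ F (k + 4)` splits into `d_+ x_k = 0` and `d_+ x_{k+2} + (-1)^{gr_h} d_v x_k = 0`. These say
that `x_k` is a `d_+`-cycle whose `d_v` is a `d_+`-boundary. -/
theorem second_page_equiv_double (σ d : ℤ × ℤ × ℤ) :
    Nonempty ((C.filteredSpace hmul σ).E 2 d ≃ₗ[ℚ]
      Subquotient (C.doubleZ (d - σ)) (C.doubleB (d - σ))) := by
  set S := C.filteredSpace hmul σ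
  set e := d - σ with he
  have e1 : twiceGrPlus d - twiceGrPlus σ = twiceGrPlus e := by
    simp [twiceGrPlus, he]; ring
  have e2 : grMinusOne d - grMinusOne σ = grMinusOne e := by
    simp [grMinusOne, he]; ring
  have e3 : d.2.2 - σ.2.2 = e.2.2 := by simp [he]
  have hZ : ∀ x, x ∈ S.Z 2 d ↔ (x ∈ C.totPiece (twiceGrPlus e) (grMinusOne e) ∧
      x ∈ C.vfil e.2.2) ∧ C.totD x ∈ C.vfil (e.2.2 + 4) := by
    intro x
    rw [S.mem_Z, ← e1, ← e2, ← e3, show d.2.2 - σ.2.2 + 4 = d.2.2 + 2 * 2 - σ.2.2 by ring]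
    rfl
  have hB : ∀ x, x ∈ S.B 2 d ↔ ∃ u y, u ∈ C.totPiece (twiceGrPlus e) (grMinusOne e) ∧
      u ∈ C.vfil (e.2.2 + 1) ∧ C.totD u ∈ C.vfil (e.2.2 + 4) ∧
      y ∈ C.totPiece (twiceGrPlus e - 2) (grMinusOne e) ∧ y ∈ C.vfil (e.2.2 - 3) ∧
      C.totD y ∈ C.vfil e.2.2 ∧ x = u + C.totD y := by
    intro x
    rw [S.mem_B, ← e1, ← e2, ← e3, show d.2.2 - σ.2.2 + 4 = d.2.2 + 2 * 2 - σ.2.2 by ring,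
      show d.2.2 - σ.2.2 + 1 = d.2.2 + 1 - σ.2.2 by ring,
      show d.2.2 - σ.2.2 - 3 = d.2.2 - 2 * 2 + 1 - σ.2.2 by ring,
      show twiceGrPlus d - twiceGrPlus σ - 2 = twiceGrPlus d - 2 - twiceGrPlus σ by ring]
    rfl
  set k := e.2.2 with hk
  refine subquotient_equiv (LinearMap.id : C.Carrier →ₗ[ℚ] C.Carrier) (C.vcomp k) ?_ ?_ ?_
  · intro (x : C.Carrier) hx
    obtain ⟨⟨h1, h2⟩, h3⟩ := (hZ x).1 hx
    refine ⟨x, rfl, C.mem_doubleZ.2 ⟨⟨C.vcomp_mem_piece' h1 rfl rfl rfl, ?_⟩,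
      C.parity (C.vcomp (k + 2) x), C.parity_mem_piece (C.vcomp_mem_piece' h1 ?_ ?_ ?_), ?_⟩⟩
    · have h4 := C.vcomp_of_mem_vfil (j := k) (by omega) h3
      rw [show C.totD x = C.dPlus x + C.parity (C.dVert x) from rfl, map_add, vcomp_dPlus,
        vcomp_parity, C.vcomp_of_mem_vfil (j := k) (by omega) (C.dVert_mem_vfil h2), map_zero, add_zero] at h4
      exact h4
    · simp [twiceGrPlus]; ring
    · simp [grMinusOne]
    · simp [hk]
    · have h4 := C.vcomp_of_mem_vfil (j := k + 2) (by omega) h3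
      rw [totD_apply, map_add, vcomp_dPlus, vcomp_parity, vcomp_dVert] at h4
      rw [dPlus_parity, eq_neg_of_add_eq_zero_left h4, map_neg, neg_neg, parity_parity]
  · intro y hy
    obtain ⟨⟨h1, h2⟩, z, hz, h3⟩ := C.mem_doubleZ.1 hy
    have hz2 : z ∈ C.vfil (k + 2) := by
      have := C.piece_le_vfil _ hz
      simpa [hk] using this
    -- With `d_+ z = d_v y` the correction `C.parity z` cancels `d_v y`, so that only `d_v z`
    -- survives, two steps deeper.
    refine ⟨y + C.parity z, ?_, (hZ _).2 ⟨⟨add_mem (C.piece_le_totPiece _ h1)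
      (C.parity_mem_totPiece (C.mem_totPiece_of_piece hz ?_ ?_)), add_mem (C.piece_le_vfil _ h1)
      (C.vfil_anti (by omega) (C.parity_mem_vfil hz2))⟩, ?_⟩⟩
    · rw [map_add, C.vcomp_of_mem_piece h1,
        C.vcomp_of_mem_vfil (by omega) (C.parity_mem_vfil hz2), add_zero]
    · simp [twiceGrPlus]; ring
    · simp [grMinusOne]
    · have : C.totD (y + C.parity z) = C.dVert z := by
        simp only [totD_apply, map_add, h2, dPlus_parity, h3, dVert_parity, parity_parity]
        abel
      change C.totD (y + C.parity z) ∈ _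
      rw [this]
      have := C.dVert_mem_vfil hz2
      rwa [show k + 4 = k + 2 + 2 by ring]
  · intro x hx _
    obtain ⟨⟨h1, h2⟩, h3⟩ := (hZ x).1 hx
    refine (hB x).trans (Iff.trans ?_ C.mem_doubleB.symm)
    constructor
    · rintro ⟨u, y, hu1, hu2, hu3, hy1, hy2, hy3, h⟩
      have hy4 := C.vcomp_of_mem_vfil (j := k - 2) (by omega) hy3
      have hy5 := C.dVert_mem_vfil hy2
      rw [totD_apply, map_add, vcomp_dPlus, vcomp_parity,
        C.vcomp_of_mem_vfil (j := k - 2) (by omega) hy5, map_zero, add_zero] at hy4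
      -- The part `y_{k-2}` is a `d_+`-cycle because `D y` has no component in degree `k - 2`. The
      -- degree `k` component of `D y` is `d_+ y_k` plus `d_v` of the signed `y_{k-2}`.
      refine ⟨C.vcomp k y, C.vcomp_mem_piece' hy1 ?_ ?_ ?_, C.parity (C.vcomp (k - 2) y),
        C.parity_mem_piece (C.vcomp_mem_piece' hy1 ?_ ?_ ?_), ?_, ?_⟩
      · simp [twiceGrPlus]; ring
      · simp [grMinusOne]
      · simp [hk]
      · simp [twiceGrPlus]; ring
      · simp [grMinusOne]
      · simp [hk]
      · rw [dPlus_parity, hy4, map_zero, neg_zero]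
      · rw [h, map_add, C.vcomp_of_mem_vfil (by omega) hu2, zero_add, totD_apply, map_add,
          vcomp_dPlus, vcomp_parity, dVert_parity, ← vcomp_dVert, sub_add_cancel]
    · rintro ⟨u, hu, w, hw, hw', h⟩
      have hu' : u ∈ C.vfil k := by simpa [hk] using C.piece_le_vfil _ hu
      have hw'' : w ∈ C.vfil (k - 2) := by simpa [hk] using C.piece_le_vfil _ hw
      -- Conversely, `D (u + C.parity w)` has lowest component `x_k`, and its other term `d_v u`
      -- lies deeper; subtracting it from `x` leaves an element of `F (k + 1)`.
      have hy : C.totD (u + C.parity w) = C.vcomp k x + C.parity (C.dVert u) := by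
        rw [h]
        simp only [totD_apply, map_add, dPlus_parity, hw', dVert_parity, parity_parity, map_zero]
        abel
      have hyP : u + C.parity w ∈ C.totPiece (twiceGrPlus e - 2) (grMinusOne e) := by
        refine add_mem (C.mem_totPiece_of_piece hu ?_ ?_)
          (C.parity_mem_totPiece (C.mem_totPiece_of_piece hw ?_ ?_))
        · simp [twiceGrPlus]; ring
        · simp [grMinusOne]
        · simp [twiceGrPlus]; ring
        · simp [grMinusOne]
      have hyD : C.totD (u + C.parity w) ∈ C.totPiece (twiceGrPlus e) (grMinusOne e) := by
        simpa using C.totD_mem_totPiece hmul hyP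
      have hdu := C.parity_mem_vfil (C.dVert_mem_vfil hu')
      refine ⟨x - C.totD (u + C.parity w), u + C.parity w, sub_mem h1 hyD, ?_, ?_, hyP,
        add_mem (C.vfil_anti (by omega) hu')
          (C.parity_mem_vfil (C.vfil_anti (by omega) hw'')), ?_, (sub_add_cancel _ _).symm⟩
      · rw [hy, ← sub_sub]
        exact sub_mem (C.sub_vcomp_mem_vfil h2) (C.vfil_anti (by omega) hdu)
      · rw [map_sub, totD_totD, sub_zero]; exact h3
      · rw [hy]
        exact add_mem (C.vcomp_mem_vfil k x) (C.vfil_anti (by omega) hdu)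

/-- The projection to a homogeneous part. -/
def projPiece (π : GradedProjection 𝒜) (d : ℤ × ℤ × ℤ) : C.Carrier →ₗ[ℚ] C.Carrier where
  toFun m x := if 2 * C.h x = d.2.1 ∧ 2 * C.v x = d.2.2 then π.proj (d.1 - C.q x) (m x) else 0
  map_add' m n := by ext x; simp only [Pi.add_apply, map_add]; split_ifs <;> simp
  map_smul' c m := by ext x; simp

/-! ### Homogeneous projections and the grading of the double homology. -/

section Projections

variable {C} (π : GradedProjection 𝒜)

theorem projPiece_apply (d : ℤ × ℤ × ℤ) (m : C.Carrier) (x : C.ι) : C.projPiece π d m x =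
    if 2 * C.h x = d.2.1 ∧ 2 * C.v x = d.2.2 then π.proj (d.1 - C.q x) (m x) else 0 := rfl

theorem projPiece_mem (d : ℤ × ℤ × ℤ) (m : C.Carrier) : C.projPiece π d m ∈ C.piece d := fun x => by
  rw [projPiece_apply]
  split_ifs with h
  · exact ⟨π.mem _ _, fun _ => h⟩
  · simp

theorem projPiece_self {d : ℤ × ℤ × ℤ} {m : C.Carrier} (hm : m ∈ C.piece d) :
    C.projPiece π d m = m := by
  ext x
  rw [projPiece_apply]
  split_ifs with h
  · exact π.self (hm x).1
  · by_contra h0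
    exact h ((hm x).2 (Ne.symm h0))

theorem projPiece_dPlus (d : ℤ × ℤ × ℤ) (m : C.Carrier) :
    C.projPiece π (d + (2, 2, 0)) (C.dPlus m) = C.dPlus (C.projPiece π d m) := by
  ext x
  refine ite_map_sum (C.dp x) m _ (π.proj _).toAddMonoidHom _ fun y hy => ?_
  have h := C.dp_deg x y hy
  rw [projPiece_apply, mul_ite, mul_zero]
  refine if_congr ?_ ?_ rfl
  · simp only [Prod.snd_add, Prod.fst_add]; omega
  · rw [← π.mul (C.dp_mem x y)]
    simp only [Prod.fst_add, LinearMap.toAddMonoidHom_coe]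
    congr 2; ring

theorem projPiece_dVert (d : ℤ × ℤ × ℤ) (m : C.Carrier) :
    C.projPiece π (d + (0, 0, 2)) (C.dVert m) = C.dVert (C.projPiece π d m) := by
  ext x
  refine ite_map_sum (C.dv x) m _ (π.proj _).toAddMonoidHom _ fun y hy => ?_
  have h := C.dv_deg x y hy
  rw [projPiece_apply, mul_ite, mul_zero]
  refine if_congr ?_ ?_ rfl
  · simp only [Prod.snd_add, Prod.fst_add]; omega
  · rw [← π.mul (C.dv_mem x y)]
    simp only [Prod.fst_add, LinearMap.toAddMonoidHom_coe]
    congr 2; ring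

-- The definition of the double homology provides only arbitrary witnesses for boundaries, while
-- `doubleZ` and `doubleB` require homogeneous ones. Projecting a witness to the right degree
-- repairs this, because the projections commute with both differentials.
include π in
theorem double_equiv_doubleHomologyPiece (d : ℤ × ℤ × ℤ) :
    Nonempty (Subquotient (C.doubleZ d) (C.doubleB d) ≃ₗ[ℚ] C.doubleHomologyPiece d) := by
  let N : Submodule ℚ C.Carrier :=
    LinearMap.ker C.dPlus ⊓ (LinearMap.range C.dPlus).comap C.dVert
  let g₁ : N →ₗ[ℚ] Homology C.dPlus := Submodule.mkQ _ ∘ₗ Submodule.inclusion inf_le_left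
  have hg₁ : ∀ n, g₁ n ∈ LinearMap.ker C.dVertStar := by
    rintro ⟨n, h1, h2⟩
    exact (Submodule.Quotient.mk_eq_zero _).2 h2
  let g : N →ₗ[ℚ] C.DoubleHomology := Submodule.mkQ _ ∘ₗ g₁.codRestrict _ hg₁
  suffices h : Nonempty (Subquotient (C.doubleZ d) (C.doubleB d) ≃ₗ[ℚ]
      Subquotient (C.doubleHomologyPiece d) ⊥) from
    h.map fun e => e ≪≫ₗ Submodule.quotEquivOfEqBot _ (Submodule.ker_subtype _)
  refine subquotient_equiv N.subtype g ?_ ?_ ?_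
  · intro x hx
    obtain ⟨⟨h1, h2⟩, y, hy, h3⟩ := C.mem_doubleZ.1 hx
    exact ⟨⟨x, h2, y, h3⟩, rfl, ⟨g₁ ⟨x, h2, y, h3⟩, hg₁ _⟩, ⟨⟨x, h2⟩, h1, rfl⟩, rfl⟩
  · rintro _ ⟨⟨_, hα⟩, ⟨⟨x, h2⟩, h1, rfl⟩, rfl⟩
    obtain ⟨z, hz⟩ : C.dVert x ∈ LinearMap.range C.dPlus :=
      (Submodule.Quotient.mk_eq_zero ((LinearMap.range C.dPlus).submoduleOf
        (LinearMap.ker C.dPlus))).1 hα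
    refine ⟨⟨x, h2, z, hz⟩, rfl, C.mem_doubleZ.2 ⟨⟨h1, h2⟩,
      C.projPiece π (d + (-2, -2, 2)) z, projPiece_mem π _ _, ?_⟩⟩
    rw [← projPiece_dPlus, hz]
    have h4 := projPiece_dVert π d x
    rw [projPiece_self π (show x ∈ C.piece d from h1)] at h4
    change _ = C.dVert x
    rw [show d + (-2, -2, 2) + (2, 2, 0) = d + (0, 0, 2) by ext <;> simp, h4]
  · rintro ⟨x, h2, h3⟩ hx -
    have h1 : x ∈ C.piece d := hx.1.1
    refine C.mem_doubleB.trans (Iff.trans ?_ (Submodule.mem_bot ℚ).symm)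
    refine Iff.trans ?_ (Submodule.Quotient.mk_eq_zero _).symm
    have hd1 : d - (2, 2, 0) + (2, 2, 0) = d := sub_add_cancel _ _
    have hd2 : d - (0, 0, 2) + (0, 0, 2) = d := sub_add_cancel _ _
    constructor
    · rintro ⟨u, hu, w, hw, hw', h⟩
      refine ⟨Submodule.Quotient.mk ⟨w, hw'⟩, (Submodule.Quotient.eq _).2 ⟨-u, ?_⟩⟩
      change C.dPlus (-u) = C.dVert w - x
      rw [show x = _ from h, map_neg]
      abel
    · rintro ⟨α, hα⟩
      obtain ⟨⟨w, hw⟩, rfl⟩ := Submodule.mkQ_surjective _ α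
      obtain ⟨u, hu⟩ := (Submodule.Quotient.eq _).1 hα
      change C.dPlus u = C.dVert w - x at hu
      have hx' : x = C.dPlus (-u) + C.dVert w := by rw [map_neg, hu]; abel
      refine ⟨C.projPiece π _ (-u), projPiece_mem π _ _, C.projPiece π _ w, projPiece_mem π _ _,
        ?_, ?_⟩
      · rw [← projPiece_dPlus, show C.dPlus w = 0 from hw, map_zero]
      · rw [← projPiece_dPlus, ← projPiece_dVert, hd1, hd2, ← map_add, ← hx', projPiece_self π h1]
        rfl

include π in
/-- The second page of the spectral sequence is the double homology. -/
theorem second_page_equiv (σ d : ℤ × ℤ × ℤ) :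
    Nonempty ((C.filteredSpace hmul σ).E 2 d ≃ₗ[ℚ] C.doubleHomologyPiece (d - σ)) := by
  obtain ⟨e₁⟩ := C.second_page_equiv_double hmul σ d
  obtain ⟨e₂⟩ := double_equiv_doubleHomologyPiece (C := C) π (d - σ)
  exact ⟨e₁ ≪≫ₗ e₂⟩

end Projections

/-! ### Complexes without differentials -/

/-- Once `(s, t)` is fixed, the vertical degree determines the triple degree, and an element is the
finite sum of its vertical components. -/
theorem iSup_piece (σ : ℤ × ℤ × ℤ) (s t : ℤ) :
    ⨆ (d : ℤ × ℤ × ℤ) (_ : twiceGrPlus d = s ∧ grMinusOne d = t), C.piece (d - σ) =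
      C.totPiece (s - twiceGrPlus σ) (t - grMinusOne σ) := by
  refine le_antisymm (iSup₂_le ?_) fun m hm => ?_
  · rintro d ⟨rfl, rfl⟩ m hm
    refine C.mem_totPiece_of_piece hm ?_ ?_
    · simp only [twiceGrPlus, Prod.fst_sub, Prod.snd_sub]; ring
    · simp only [grMinusOne, Prod.fst_sub, Prod.snd_sub]; ring
  · have h : m = ∑ k ∈ Finset.univ.image fun x => 2 * C.v x, C.vcomp k m := by
      ext x
      simp only [Finset.sum_apply, vcomp_apply, Finset.sum_ite_eq]
      rw [if_pos (Finset.mem_image_of_mem _ (Finset.mem_univ x))]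
    rw [h]
    refine Submodule.sum_mem _ fun k _ => ?_
    have h1 := C.vcomp_mem_piece (k := k) hm
    set e : ℤ × ℤ × ℤ := (t - grMinusOne σ + (s - twiceGrPlus σ - k), s - twiceGrPlus σ - k, k)
    refine Submodule.mem_iSup_of_mem (e + σ) (Submodule.mem_iSup_of_mem ⟨?_, ?_⟩ ?_)
    · simp only [e, twiceGrPlus, Prod.fst_add, Prod.snd_add]; ring
    · simp only [e, twiceGrPlus, grMinusOne, Prod.fst_add, Prod.snd_add]; ring
    · rwa [add_sub_cancel_right]

/-- Without differentials both homologies are the module itself: `κ` is injective and maps each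
homogeneous piece onto the corresponding piece of the double homology. This is the case of the
unlink. -/
theorem totH_equiv_iSup_doubleHomologyPiece (hp : C.dp = 0) (hv : C.dv = 0) (σ : ℤ × ℤ × ℤ)
    (s t : ℤ) : Nonempty (C.totH (s - twiceGrPlus σ) (t - grMinusOne σ) ≃ₗ[ℚ]
      (⨆ (d : ℤ × ℤ × ℤ) (_ : twiceGrPlus d = s ∧ grMinusOne d = t),
        C.doubleHomologyPiece (d - σ) : Submodule ℚ C.DoubleHomology)) := by
  have hp' : ∀ m, C.dPlus m = 0 := fun m => by simp [dPlus_apply, hp]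
  have hv' : ∀ m, C.dVert m = 0 := fun m => by simp [dVert_apply, hv]
  have hD : ∀ m, C.totD m = 0 := fun m => by simp [totD_apply, hp', hv']
  have hV : ∀ α, C.dVertStar α = 0 := fun α => by
    obtain ⟨⟨x, hx⟩, rfl⟩ := Submodule.mkQ_surjective _ α
    refine (Submodule.Quotient.mk_eq_zero _).2 ?_
    change C.dVert x ∈ LinearMap.range C.dPlus
    rw [hv']
    exact zero_mem _
  let κ : C.Carrier →ₗ[ℚ] C.DoubleHomology := Submodule.mkQ _ ∘ₗ
    (Submodule.mkQ _ ∘ₗ LinearMap.id.codRestrict (LinearMap.ker C.dPlus) hp').codRestrict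
      (LinearMap.ker C.dVertStar) fun _ => hV _
  have hκ : ∀ m, κ m = 0 → m = 0 := by
    intro m hm
    obtain ⟨α, hα⟩ := (Submodule.Quotient.mk_eq_zero _).1 hm
    rw [hV] at hα
    obtain ⟨z, hz⟩ := (Submodule.Quotient.mk_eq_zero ((LinearMap.range C.dPlus).submoduleOf
        (LinearMap.ker C.dPlus))).1 hα.symm
    rw [hp'] at hz
    exact hz.symm
  have hpiece : ∀ d, C.doubleHomologyPiece d = (C.piece d).map κ := by
    intro d
    ext y
    constructor
    · rintro ⟨⟨_, hα⟩, ⟨⟨x, h2⟩, h1, rfl⟩, rfl⟩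
      exact ⟨x, h1, rfl⟩
    · rintro ⟨x, h1, rfl⟩
      exact ⟨⟨_, hV _⟩, ⟨⟨x, hp' x⟩, h1, rfl⟩, rfl⟩
  have hsup : (⨆ (d : ℤ × ℤ × ℤ) (_ : twiceGrPlus d = s ∧ grMinusOne d = t),
      C.doubleHomologyPiece (d - σ) : Submodule ℚ C.DoubleHomology) =
      (C.totPiece (s - twiceGrPlus σ) (t - grMinusOne σ)).map κ := by
    rw [← C.iSup_piece, Submodule.map_iSup]
    simp only [Submodule.map_iSup, hpiece]
  rw [hsup]
  suffices h : Nonempty (C.totH (s - twiceGrPlus σ) (t - grMinusOne σ) ≃ₗ[ℚ]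
      Subquotient ((C.totPiece (s - twiceGrPlus σ) (t - grMinusOne σ)).map κ) ⊥) from
    h.map fun e => e ≪≫ₗ Submodule.quotEquivOfEqBot _ (Submodule.ker_subtype _)
  refine subquotient_equiv LinearMap.id κ ?_ ?_ ?_
  · exact fun x hx => ⟨x, rfl, x, hx.2, rfl⟩
  · rintro _ ⟨x, hx, rfl⟩
    exact ⟨x, rfl, hD x, hx⟩
  · intro x _ _
    constructor
    · rintro ⟨y, -, hy⟩
      rw [hD] at hy
      rw [show x = 0 from hy.symm, map_zero]
      exact zero_mem _
    · intro h
      rw [hκ x ((Submodule.mem_bot ℚ).1 h), map_zero]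
      exact zero_mem _

end FreeComplex

end Total

/-! ### Homology of differential spaces -/

section Subquotient

variable {M M' : Type} [AddCommGroup M] [Module ℚ M] [AddCommGroup M'] [Module ℚ M']

/-- A map of differential spaces which is onto on homogeneous parts and on homogeneous cycles, and
which detects homogeneous boundaries, induces an isomorphism on homology. -/
theorem homology_equiv_of_surjective {d : M →ₗ[ℚ] M} {d' : M' →ₗ[ℚ] M'} {P Q : Submodule ℚ M}
    {P' Q' : Submodule ℚ M'} (π : M →ₗ[ℚ] M') (hd : ∀ m, d (d m) = 0) (hQP : ∀ m ∈ Q, d m ∈ P)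
    (hπ : ∀ m, π (d m) = d' (π m)) (hP : ∀ m ∈ P, π m ∈ P') (hQ : ∀ m ∈ Q, π m ∈ Q')
    (hQ' : ∀ y ∈ Q', ∃ m ∈ Q, π m = y)
    (hcyc : ∀ z ∈ P', d' z = 0 → ∃ m ∈ P, d m = 0 ∧ π m = z)
    (hbd : ∀ m ∈ P, d m = 0 → π m = 0 → ∃ n ∈ Q, d n = m) :
    Nonempty (Subquotient (LinearMap.ker d ⊓ P) (Q.map d) ≃ₗ[ℚ]
      Subquotient (LinearMap.ker d' ⊓ P') (Q'.map d')) := by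
  refine subquotient_equiv LinearMap.id π ?_ ?_ ?_
  · rintro m ⟨h1, h2⟩
    exact ⟨m, rfl, by
      change d' (π m) = 0
      rw [← hπ, show d m = 0 from h1, map_zero], hP m h2⟩
  · rintro z ⟨h1, h2⟩
    obtain ⟨m, hm, hdm, rfl⟩ := hcyc z h2 h1
    exact ⟨m, rfl, hdm, hm⟩
  · rintro m ⟨h1, h2⟩ -
    constructor
    · rintro ⟨n, hn, rfl⟩
      exact ⟨π n, hQ n hn, (hπ n).symm⟩
    · rintro ⟨y, hy, hym⟩
      obtain ⟨n, hn, rfl⟩ := hQ' y hy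
      -- Subtracting `d n`, where `n` lifts `y`, moves the cycle into the kernel of `π`, where `hbd`
      -- applies.
      obtain ⟨k, hk, hkm⟩ := hbd (m - d n) (sub_mem h2 (hQP n hn))
        (by rw [map_sub, hd, show d m = 0 from h1, sub_zero]) (by rw [map_sub, hπ, hym]; exact sub_self _)
      exact ⟨k + n, add_mem hk hn, by rw [map_add, hkm]; exact sub_add_cancel _ _⟩

/-- Factors in odd total degree of a tensor product contribute `-d`, whose kernel and images are
those of `d`. -/
theorem homology_neg_equiv (d : M →ₗ[ℚ] M) (P Q : Submodule ℚ M) :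
    Nonempty (Subquotient (LinearMap.ker (-d) ⊓ P) (Q.map (-d)) ≃ₗ[ℚ]
      Subquotient (LinearMap.ker d ⊓ P) (Q.map d)) := by
  refine subquotient_equiv LinearMap.id LinearMap.id ?_ ?_ ?_
  · exact fun x hx => ⟨x, rfl, neg_eq_zero.1 hx.1, hx.2⟩
  · exact fun x hx => ⟨x, rfl, neg_eq_zero.2 hx.1, hx.2⟩
  · intro x _ _
    rw [Submodule.map_neg]

theorem homology_prod_equiv (d : M →ₗ[ℚ] M) (d' : M' →ₗ[ℚ] M') (P Q : Submodule ℚ M)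
    (P' Q' : Submodule ℚ M') :
    Nonempty (Subquotient (LinearMap.ker (d.prodMap d') ⊓ P.prod P') ((Q.prod Q').map (d.prodMap d'))
      ≃ₗ[ℚ] Subquotient (LinearMap.ker d ⊓ P) (Q.map d) ×
        Subquotient (LinearMap.ker d' ⊓ P') (Q'.map d')) := by
  set Z := LinearMap.ker d ⊓ P
  set Z' := LinearMap.ker d' ⊓ P'
  suffices h : Nonempty (Subquotient (LinearMap.ker (d.prodMap d') ⊓ P.prod P')
      ((Q.prod Q').map (d.prodMap d')) ≃ₗ[ℚ] Subquotient
        (⊤ : Submodule ℚ (Subquotient Z (Q.map d) × Subquotient Z' (Q'.map d'))) ⊥) from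
    h.map fun e => e ≪≫ₗ Submodule.quotEquivOfEqBot _ (Submodule.ker_subtype _) ≪≫ₗ
      Submodule.topEquiv
  refine subquotient_equiv (Z.subtype.prodMap Z'.subtype)
    ((Submodule.mkQ _).prodMap (Submodule.mkQ _)) ?_ ?_ ?_
  · rintro ⟨x, y⟩ ⟨h1, h2, h3⟩
    obtain ⟨h4, h5⟩ := Prod.ext_iff.1 (show (d x, d' y) = 0 from h1)
    exact ⟨(⟨x, h4, h2⟩, ⟨y, h5, h3⟩), rfl, trivial⟩
  · rintro ⟨x, y⟩ -
    obtain ⟨x, rfl⟩ := Submodule.mkQ_surjective _ x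
    obtain ⟨y, rfl⟩ := Submodule.mkQ_surjective _ y
    exact ⟨(x, y), rfl, Prod.ext x.2.1 y.2.1, x.2.2, y.2.2⟩
  · rintro ⟨x, y⟩ - -
    refine Iff.trans ?_ (Submodule.mem_bot ℚ).symm
    constructor
    · rintro ⟨⟨u, v⟩, ⟨hu, hv⟩, h⟩
      obtain ⟨h4, h5⟩ := Prod.ext_iff.1 h
      exact Prod.ext ((Submodule.Quotient.mk_eq_zero _).2 ⟨u, hu, h4⟩)
        ((Submodule.Quotient.mk_eq_zero _).2 ⟨v, hv, h5⟩)
    · intro h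
      obtain ⟨h4, h5⟩ := Prod.ext_iff.1 h
      obtain ⟨u, hu, h4⟩ := (Submodule.Quotient.mk_eq_zero _).1 h4
      obtain ⟨v, hv, h5⟩ := (Submodule.Quotient.mk_eq_zero _).1 h5
      exact ⟨(u, v), ⟨hu, hv⟩, Prod.ext h4 h5⟩

end Subquotient

/-! ### Components of a tensor product -/

section Tensor

variable {A : Type} [CommRing A] [Algebra ℚ A] {𝒜 : ℤ → Submodule ℚ A}

omit [Algebra ℚ A] in
theorem sgn_add (m n : ℤ) : sgn A (m + n) = sgn A m * sgn A n := by
  simp [sgn, Int.negOnePow_add]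

omit [Algebra ℚ A] in
@[simp] theorem sgn_zero : sgn A 0 = 1 := by simp [sgn]

omit [Algebra ℚ A] in
@[simp] theorem sgn_one : sgn A 1 = -1 := by simp [sgn]

omit [Algebra ℚ A] in
@[simp] theorem sgn_neg_one : sgn A (-1) = -1 := by simp [sgn]

namespace FreeComplex

/-- The component at a basis vector of the left factor. -/
def comp (C T : FreeComplex A 𝒜) (x : C.ι) : (C.tensor T).Carrier →ₗ[ℚ] T.Carrier where
  toFun m i := m (x, i)
  map_add' _ _ := rfl
  map_smul' _ _ := rfl

theorem comp_apply (C T : FreeComplex A 𝒜) (x : C.ι) (m : (C.tensor T).Carrier) (i : T.ι) :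
    C.comp T x m i = m (x, i) := rfl

theorem comp_ext {C T : FreeComplex A 𝒜} {m n : (C.tensor T).Carrier}
    (h : ∀ x, C.comp T x m = C.comp T x n) : m = n := by
  ext ⟨x, i⟩
  exact congrFun (h x) i

theorem kron_mulVec (C T : FreeComplex A 𝒜) (M : Matrix C.ι C.ι A) (N : Matrix T.ι T.ι A)
    (g : C.ι → ℤ) (m : C.ι × T.ι → A) (x : C.ι) (i : T.ι) :
    (M ⊗ₖ (1 : Matrix T.ι T.ι A) + signMatrix A g ⊗ₖ N).mulVec m (x, i) =
      ∑ y, M x y * m (y, i) + sgn A (g x) * N.mulVec (fun j => m (x, j)) i := by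
  simp only [Matrix.mulVec, dotProduct, kron_apply, add_mul, Finset.sum_add_distrib,
    Fintype.sum_prod_type, ite_mul, zero_mul, Finset.sum_ite_eq, Finset.mem_univ, if_true,
    Finset.mul_sum, mul_assoc]
  congr 1
  rw [Finset.sum_comm]
  simp

/-- The horizontal sign of a tensor product is the product of the signs of its factors: the one of
`x` is a scalar and the other one is `T.parity`. -/
theorem comp_totD (C T : FreeComplex A 𝒜) (x : C.ι) (m : (C.tensor T).Carrier) :
    C.comp T x ((C.tensor T).totD m) = ∑ y, C.dp x y • C.comp T y m +
      sgn A (C.h x) • (T.dPlus (C.comp T x m) + T.parity (∑ y, C.dv x y • C.comp T y m +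
        sgn A (C.v x) • T.dVert (C.comp T x m))) := by
  ext i
  have h1 := kron_mulVec C T C.dp T.dp C.h m x i
  have h2 := kron_mulVec C T C.dv T.dv C.v m x i
  refine (congrArg₂ (fun u v => u + sgn A (C.h x + T.h i) * v) h1 h2).trans ?_
  simp only [sgn_add, Pi.add_apply, Pi.smul_apply, Finset.sum_apply, smul_eq_mul, parity_apply,
    comp_apply, dPlus_apply, dVert_apply]
  change _ = _ + _ * (T.dp.mulVec (fun j => m (x, j)) i + _ * (_ + _ *
    T.dv.mulVec (fun j => m (x, j)) i))
  ring

theorem mem_totPiece_tensor (C T : FreeComplex A 𝒜) {s t : ℤ} {m : (C.tensor T).Carrier} :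
    m ∈ (C.tensor T).totPiece s t ↔
      ∀ x, C.comp T x m ∈ T.totPiece (s - 2 * (C.h x + C.v x)) (t + 2 * C.h x - C.q x) := by
  constructor
  · intro hm x i
    obtain ⟨h1, h2⟩ := hm (x, i)
    refine ⟨?_, fun h => ?_⟩
    · convert h1 using 2
      · change _ = t + 2 * (C.h x + T.h i) - (C.q x + T.q i)
        ring
      · rfl
    · have : 2 * (C.h x + T.h i) + 2 * (C.v x + T.v i) = s := h2 h
      omega
  · rintro hm ⟨x, i⟩
    obtain ⟨h1, h2⟩ := hm x i
    refine ⟨?_, fun h => ?_⟩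
    · convert h1 using 2
      · change t + 2 * (C.h x + T.h i) - (C.q x + T.q i) = _
        ring
      · rfl
    · have := h2 h
      change 2 * (C.h x + T.h i) + 2 * (C.v x + T.v i) = s
      omega

theorem smul_mem_totPiece (hmul : ∀ {m n : ℤ} {x y : A}, x ∈ 𝒜 m → y ∈ 𝒜 n → x * y ∈ 𝒜 (m + n))
    {T : FreeComplex A 𝒜} {a : A} {n s t t' : ℤ} (ha : a ∈ 𝒜 n) {m : T.Carrier}
    (hm : m ∈ T.totPiece s t) (h : n + t = t') : a • m ∈ T.totPiece s t' := fun x => by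
  subst h
  refine ⟨?_, fun h => (hm x).2 (right_ne_zero_of_mul h)⟩
  convert hmul ha (hm x).1 using 2
  · ring
  · rfl

/-- The element of a tensor product with given components. -/
def ofComp {C T : FreeComplex A 𝒜} (f : C.ι → T.Carrier) : (C.tensor T).Carrier := fun p => f p.1 p.2

end FreeComplex

end Tensor

/-! ### The local complexes -/

section Squares

variable {A : Type} [CommRing A] [Algebra ℚ A] {𝒜 : ℤ → Submodule ℚ A}

/-- A function on `Bool × Bool` given by its values. -/
def quad {V : Type} (ff ft tf tt : V) : Bool × Bool → V
  | (false, false) => ff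
  | (false, true) => ft
  | (true, false) => tf
  | (true, true) => tt

namespace FreeComplex

/-- An arbitrary complex on the basis `Bool × Bool` is allowed so that both kinds of crossing are
instances by unfolding. -/
theorem square_totD {q h v : Bool × Bool → ℤ} {dp dv : Matrix (Bool × Bool) (Bool × Bool) A}
    (p₁ p₂ p₃ p₄ p₅ p₆ p₇) (T : FreeComplex A 𝒜) (f : Bool × Bool → T.Carrier) :
    ((⟨Bool × Bool, q, h, v, dp, dv, p₁, p₂, p₃, p₄, p₅, p₆, p₇⟩ : FreeComplex A 𝒜).tensor T).totD
      (ofComp f) = ofComp fun x : Bool × Bool =>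
        dp x (true, true) • f (true, true) + dp x (true, false) • f (true, false) +
        (dp x (false, true) • f (false, true) + dp x (false, false) • f (false, false)) +
        sgn A (h x) • (T.dPlus (f x) + T.parity (
          dv x (true, true) • f (true, true) + dv x (true, false) • f (true, false) +
          (dv x (false, true) • f (false, true) + dv x (false, false) • f (false, false)) +
          sgn A (v x) • T.dVert (f x))) := by
  refine comp_ext fun x => (comp_totD _ T x _).trans ?_
  have hs : ∀ f : Bool × Bool → T.Carrier, ∑ y, f y =
    f (true, true) + f (true, false) + (f (false, true) + f (false, false)) := by
    simp [Fintype.sum_prod_type]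
  exact congrArg₂ (fun u w => u + sgn A (h x) • (T.dPlus (f x) + T.parity (w +
    sgn A (v x) • T.dVert (f x)))) (hs _) (hs _)

theorem ofComp_quad_congr {C T : FreeComplex A 𝒜} {f g : C.ι → T.Carrier} (h : ∀ x, f x = g x) :
    (ofComp f : (C.tensor T).Carrier) = ofComp g := congrArg ofComp (funext h)

theorem ofComp_eq_zero {C T : FreeComplex A 𝒜} {f : C.ι → T.Carrier} (h : ∀ x, f x = 0) :
    (ofComp f : (C.tensor T).Carrier) = 0 := by
  ext p
  exact congrFun (h p.1) p.2

theorem apply_eq_zero_of_ofComp {C T : FreeComplex A 𝒜} {f : C.ι → T.Carrier}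
    (h : (ofComp f : (C.tensor T).Carrier) = 0) (x : C.ι) : f x = 0 := congrArg (comp C T x) h

variable (h1 : (1 : A) ∈ 𝒜 0)
    (hmul : ∀ {m n : ℤ} {x y : A}, x ∈ 𝒜 m → y ∈ 𝒜 n → x * y ∈ 𝒜 (m + n))
    (a c : A) (ha : a ∈ 𝒜 2) (hc : c ∈ 𝒜 2) (T : FreeComplex A 𝒜)

/-- An odd vertical degree reverses the sign of `d_v` against `d_+`. Conjugation by the parity does
the same up to an overall sign, since `P D P = -d_+ + P d_v`; this is where the conjugated
differentials come from. -/
theorem positive_totD (f : Bool × Bool → T.Carrier) :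
    ((positiveCrossing h1 hmul a c ha hc).tensor T).totD (ofComp f) = ofComp (quad
      (T.parity (T.totD (T.parity (f (false, false)))))
      (-T.totD (f (false, true)) + c • T.parity (f (false, false)))
      (-T.parity (T.totD (T.parity (f (true, false)))) - (a * c) • f (false, false))
      (T.totD (f (true, true)) + a • f (false, true) + T.parity (f (true, false)))) := by
  refine (square_totD _ _ _ _ _ _ _ T f).trans (ofComp_quad_congr ?_)
  rintro ⟨_ | _, _ | _⟩ <;>
  · simp [quad, totD_apply, dPlus_parity, dVert_parity, parity_smul, sub_eq_add_neg]
    try abel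

theorem negative_totD (f : Bool × Bool → T.Carrier) :
    ((negativeCrossing h1 hmul a c ha hc).tensor T).totD (ofComp f) = ofComp (quad
      (-T.totD (f (false, false)))
      (T.parity (T.totD (T.parity (f (false, true)))) - T.parity (f (false, false)))
      (T.totD (f (true, false)) + a • f (false, false))
      (-T.parity (T.totD (T.parity (f (true, true)))) - (a * c) • f (false, true) -
        c • T.parity (f (true, false)))) := by
  refine (square_totD _ _ _ _ _ _ _ T f).trans (ofComp_quad_congr ?_)
  rintro ⟨_ | _, _ | _⟩ <;>
  · simp [quad, totD_apply, dPlus_parity, dVert_parity, parity_smul, sub_eq_add_neg]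
    try abel

theorem positive_mem_totPiece {s t : ℤ} (f : Bool × Bool → T.Carrier) :
    (ofComp f : ((positiveCrossing h1 hmul a c ha hc).tensor T).Carrier) ∈
      ((positiveCrossing h1 hmul a c ha hc).tensor T).totPiece s t ↔
    f (false, false) ∈ T.totPiece (s + 4) (t - 4) ∧ f (false, true) ∈ T.totPiece (s + 2) (t - 2) ∧
    f (true, false) ∈ T.totPiece (s + 2) t ∧ f (true, true) ∈ T.totPiece s t := by
  rw [mem_totPiece_tensor]
  refine (Prod.forall.trans (Bool.forall_bool.trans
    (and_congr Bool.forall_bool Bool.forall_bool))).trans ?_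
  rw [and_assoc]
  refine and_congr ?_ (and_congr ?_ (and_congr ?_ ?_)) <;>
  · refine iff_of_eq (congrArg₂ (fun i j => _ ∈ T.totPiece i j) ?_ ?_) <;>
    · simp [positiveCrossing]
      try ring

theorem negative_mem_totPiece {s t : ℤ} (f : Bool × Bool → T.Carrier) :
    (ofComp f : ((negativeCrossing h1 hmul a c ha hc).tensor T).Carrier) ∈
      ((negativeCrossing h1 hmul a c ha hc).tensor T).totPiece s t ↔
    f (false, false) ∈ T.totPiece (s + 2) (t - 2) ∧ f (false, true) ∈ T.totPiece s (t - 2) ∧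
    f (true, false) ∈ T.totPiece s t ∧ f (true, true) ∈ T.totPiece (s - 2) (t + 2) := by
  rw [mem_totPiece_tensor]
  refine (Prod.forall.trans (Bool.forall_bool.trans
    (and_congr Bool.forall_bool Bool.forall_bool))).trans ?_
  rw [and_assoc]
  refine and_congr ?_ (and_congr ?_ (and_congr ?_ ?_)) <;>
  · refine iff_of_eq (congrArg₂ (fun i j => _ ∈ T.totPiece i j) ?_ ?_) <;>
    · simp [negativeCrossing]
      try ring

theorem unreduced_totD (f : Bool → T.Carrier) :
    ((unreducedFactor 𝒜).tensor T).totD (ofComp f) =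
      ofComp fun x : Bool => if x then T.totD (f x) else -T.totD (f x) := by
  refine comp_ext fun x => (comp_totD _ T x _).trans ?_
  rcases x with _ | _
  · change (∑ y : Bool, (0 : A) • f y) + sgn A (-1) • (T.dPlus (f false) + T.parity
      ((∑ y : Bool, (0 : A) • f y) + sgn A 0 • T.dVert (f false))) = -T.totD (f false)
    simp [totD_apply, add_comm]
  · change (∑ y : Bool, (0 : A) • f y) + sgn A 0 • (T.dPlus (f true) + T.parity
      ((∑ y : Bool, (0 : A) • f y) + sgn A 0 • T.dVert (f true))) = T.totD (f true)
    simp [totD_apply]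

theorem unreduced_mem_totPiece {s t : ℤ} (f : Bool → T.Carrier) :
    (ofComp f : ((unreducedFactor 𝒜).tensor T).Carrier) ∈
      ((unreducedFactor 𝒜).tensor T).totPiece s t ↔
    f false ∈ T.totPiece (s + 2) (t - 2) ∧ f true ∈ T.totPiece s t := by
  rw [mem_totPiece_tensor]
  refine Bool.forall_bool.trans (and_congr ?_ ?_) <;>
  · refine iff_of_eq (congrArg₂ (fun i j => _ ∈ T.totPiece i j) ?_ ?_) <;>
    · simp [unreducedFactor]
      try ring

/-! ### The homology of the tensor product with a local complex whose parameter vanishes -/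

section Doubling

variable {h1 a ha}

include hmul in
theorem totD_mem_totPiece' {T : FreeComplex A 𝒜} {s t : ℤ} {m : T.Carrier}
    (hm : m ∈ T.totPiece (s - 2) t) : T.totD m ∈ T.totPiece s t := by
  simpa using T.totD_mem_totPiece hmul hm

/-- The right column is a subcomplex and is acyclic because its vertical arrow is `1`. The quotient
by it, the left column, splits into two shifted copies of `T` when `c = 0`. -/
theorem positive_zero_equiv (h0 : (0 : A) ∈ 𝒜 2) (s t : ℤ) :
    Nonempty (((positiveCrossing h1 hmul a 0 ha h0).tensor T).totH s t ≃ₗ[ℚ]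
      T.totH (s + 4) (t - 4) × T.totH (s + 2) (t - 2)) := by
  set K := (positiveCrossing h1 hmul a 0 ha h0).tensor T
  obtain ⟨e₂⟩ := homology_neg_equiv T.totD (T.totPiece (s + 2) (t - 2))
    (T.totPiece (s + 2 - 2) (t - 2))
  obtain ⟨e₁⟩ := homology_prod_equiv T.totD (-T.totD) (T.totPiece (s + 4) (t - 4))
    (T.totPiece (s + 4 - 2) (t - 4)) (T.totPiece (s + 2) (t - 2)) (T.totPiece (s + 2 - 2) (t - 2))
  suffices h : Nonempty (K.totH s t ≃ₗ[ℚ] _) from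
    h.map fun e => e ≪≫ₗ e₁ ≪≫ₗ (LinearEquiv.refl ℚ _).prodCongr e₂
  let π : K.Carrier →ₗ[ℚ] T.Carrier × T.Carrier :=
    (T.parity ∘ₗ comp _ T (false, false)).prod (comp _ T (false, true))
  have hπ : ∀ f : Bool × Bool → T.Carrier,
    π (ofComp f) = (T.parity (f (false, false)), f (false, true)) := fun _ => rfl
  refine homology_equiv_of_surjective π K.totD_totD
    (fun m hm => totD_mem_totPiece' hmul hm) ?_ ?_ ?_ ?_ ?_ ?_
  · intro m
    obtain ⟨f, rfl⟩ : ∃ f : Bool × Bool → T.Carrier, m = ofComp f :=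
      ⟨fun x => comp _ T x m, rfl⟩
    rw [positive_totD, hπ, hπ]
    simp [quad]
  · intro m hm
    obtain ⟨f, rfl⟩ : ∃ f : Bool × Bool → T.Carrier, m = ofComp f :=
      ⟨fun x => comp _ T x m, rfl⟩
    have hm := (positive_mem_totPiece _ _ _ _ _ _ T f).1 hm
    exact ⟨T.parity_mem_totPiece hm.1, hm.2.1⟩
  · intro m hm
    obtain ⟨f, rfl⟩ : ∃ f : Bool × Bool → T.Carrier, m = ofComp f :=
      ⟨fun x => comp _ T x m, rfl⟩
    have hm := (positive_mem_totPiece _ _ _ _ _ _ T f).1 hm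
    refine ⟨T.parity_mem_totPiece ?_, ?_⟩
    · rw [show s + 4 - 2 = s - 2 + 4 by ring]; exact hm.1
    · rw [show s + 2 - 2 = s - 2 + 2 by ring]; exact hm.2.1
  · rintro ⟨u, v⟩ ⟨hu, hv⟩
    refine ⟨ofComp (quad (T.parity u) v 0 0), (positive_mem_totPiece _ _ _ _ _ _ T _).2
      ⟨T.parity_mem_totPiece ?_, ?_, zero_mem _, zero_mem _⟩, ?_⟩
    · rw [show s - 2 + 4 = s + 4 - 2 by ring]; exact hu
    · rw [show s - 2 + 2 = s + 2 - 2 by ring]; exact hv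
    · rw [hπ]; simp [quad]
  · rintro ⟨u, v⟩ ⟨hu, hv⟩ h
    obtain ⟨h2, h3⟩ := Prod.ext_iff.1 h
    have h2 : T.totD u = 0 := h2
    have h3 : T.totD v = 0 := neg_eq_zero.1 h3
    -- The third entry is forced by the corner `(true, true)`, where its image under the arrow `1`
    -- must cancel `a • v`.
    refine ⟨ofComp (quad (T.parity u) v (-(a • T.parity v)) 0),
      (positive_mem_totPiece _ _ _ _ _ _ T _).2
        ⟨T.parity_mem_totPiece hu, hv, neg_mem (smul_mem_totPiece hmul ha
          (T.parity_mem_totPiece hv) (by ring)), zero_mem _⟩, ?_, ?_⟩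
    · rw [positive_totD]
      refine ofComp_eq_zero ?_
      rintro ⟨_ | _, _ | _⟩ <;> simp [quad, h2, h3, parity_smul, totD_smul]
    · rw [hπ]; simp [quad]
  · intro m hm hd hm0
    obtain ⟨f, rfl⟩ : ∃ f : Bool × Bool → T.Carrier, m = ofComp f :=
      ⟨fun x => comp _ T x m, rfl⟩
    have hm := (positive_mem_totPiece _ _ _ _ _ _ T f).1 hm
    rw [hπ] at hm0
    obtain ⟨h2, h3⟩ := Prod.ext_iff.1 hm0
    have h2 : f (false, false) = 0 := by
      rw [← T.parity_parity (f (false, false)), show T.parity (f (false, false)) = 0 from h2,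
        map_zero]
    have h3 : f (false, true) = 0 := h3
    rw [positive_totD] at hd
    have h4 : T.totD (f (true, true)) + a • f (false, true) + T.parity (f (true, false)) = 0 :=
      apply_eq_zero_of_ofComp (C := positiveCrossing h1 hmul a 0 ha h0) hd (true, true)
    rw [h3, smul_zero, add_zero] at h4
    -- The arrow `1` carries this entry to `f (true, true)`; the cycle equation at that corner takes
    -- care of `f (true, false)`.
    refine ⟨ofComp (quad 0 0 (T.parity (f (true, true))) 0),
      (positive_mem_totPiece _ _ _ _ _ _ T _).2
        ⟨zero_mem _, zero_mem _, T.parity_mem_totPiece ?_, zero_mem _⟩, ?_⟩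
    · convert hm.2.2.2 using 2; ring
    · rw [positive_totD]
      refine ofComp_quad_congr ?_
      rintro ⟨_ | _, _ | _⟩
      · simp [quad, h2]
      · simp [quad, h3]
      · simp [quad, eq_neg_of_add_eq_zero_left h4]
      · simp [quad]

/-- Here the left column has the arrow `1` and is acyclic, and the right column remains as a direct
sum. The term with `a` in `π` compensates the horizontal arrow out of the left column, so that `π`
is a chain map. -/
theorem negative_zero_equiv (h0 : (0 : A) ∈ 𝒜 2) (s t : ℤ) :
    Nonempty (((negativeCrossing h1 hmul a 0 ha h0).tensor T).totH s t ≃ₗ[ℚ]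
      T.totH s t × T.totH (s - 2) (t + 2)) := by
  set K := (negativeCrossing h1 hmul a 0 ha h0).tensor T
  obtain ⟨e₂⟩ := homology_neg_equiv T.totD (T.totPiece (s - 2) (t + 2))
    (T.totPiece (s - 2 - 2) (t + 2))
  obtain ⟨e₁⟩ := homology_prod_equiv T.totD (-T.totD) (T.totPiece s t)
    (T.totPiece (s - 2) t) (T.totPiece (s - 2) (t + 2)) (T.totPiece (s - 2 - 2) (t + 2))
  suffices h : Nonempty (K.totH s t ≃ₗ[ℚ] _) from
    h.map fun e => e ≪≫ₗ e₁ ≪≫ₗ (LinearEquiv.refl ℚ _).prodCongr e₂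
  let π : K.Carrier →ₗ[ℚ] T.Carrier × T.Carrier :=
    (comp _ T (true, false) + (LinearMap.lsmul A T.Carrier a).restrictScalars ℚ ∘ₗ
      T.parity ∘ₗ comp _ T (false, true)).prod (T.parity ∘ₗ comp _ T (true, true))
  have hπ : ∀ f : Bool × Bool → T.Carrier, π (ofComp f) =
    (f (true, false) + a • T.parity (f (false, true)), T.parity (f (true, true))) := fun _ => rfl
  refine homology_equiv_of_surjective π K.totD_totD
    (fun m hm => totD_mem_totPiece' hmul hm) ?_ ?_ ?_ ?_ ?_ ?_
  · intro m
    obtain ⟨f, rfl⟩ : ∃ f : Bool × Bool → T.Carrier, m = ofComp f :=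
      ⟨fun x => comp _ T x m, rfl⟩
    rw [negative_totD, hπ, hπ]
    simp [quad, totD_smul, smul_sub]
  · intro m hm
    obtain ⟨f, rfl⟩ : ∃ f : Bool × Bool → T.Carrier, m = ofComp f :=
      ⟨fun x => comp _ T x m, rfl⟩
    have hm := (negative_mem_totPiece _ _ _ _ _ _ T f).1 hm
    exact ⟨add_mem hm.2.2.1 (smul_mem_totPiece hmul ha (T.parity_mem_totPiece hm.2.1) (by ring)),
      T.parity_mem_totPiece hm.2.2.2⟩
  · intro m hm
    obtain ⟨f, rfl⟩ : ∃ f : Bool × Bool → T.Carrier, m = ofComp f :=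
      ⟨fun x => comp _ T x m, rfl⟩
    have hm := (negative_mem_totPiece _ _ _ _ _ _ T f).1 hm
    exact ⟨add_mem hm.2.2.1 (smul_mem_totPiece hmul ha (T.parity_mem_totPiece hm.2.1) (by ring)),
      T.parity_mem_totPiece hm.2.2.2⟩
  · rintro ⟨u, v⟩ ⟨hu, hv⟩
    refine ⟨ofComp (quad 0 0 u (T.parity v)), (negative_mem_totPiece _ _ _ _ _ _ T _).2
      ⟨zero_mem _, zero_mem _, hu, T.parity_mem_totPiece hv⟩, ?_⟩
    rw [hπ]; simp [quad]
  · rintro ⟨u, v⟩ ⟨hu, hv⟩ h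
    obtain ⟨h2, h3⟩ := Prod.ext_iff.1 h
    have h2 : T.totD u = 0 := h2
    have h3 : T.totD v = 0 := neg_eq_zero.1 h3
    refine ⟨ofComp (quad 0 0 u (T.parity v)), (negative_mem_totPiece _ _ _ _ _ _ T _).2
      ⟨zero_mem _, zero_mem _, hu, T.parity_mem_totPiece hv⟩, ?_, ?_⟩
    · rw [negative_totD]
      refine ofComp_eq_zero ?_
      rintro ⟨_ | _, _ | _⟩ <;> simp [quad, h2, h3]
    · rw [hπ]; simp [quad]
  · intro m hm hd hm0
    obtain ⟨f, rfl⟩ : ∃ f : Bool × Bool → T.Carrier, m = ofComp f :=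
      ⟨fun x => comp _ T x m, rfl⟩
    have hm := (negative_mem_totPiece _ _ _ _ _ _ T f).1 hm
    rw [hπ] at hm0
    obtain ⟨h2, h3⟩ := Prod.ext_iff.1 hm0
    have h2 : f (true, false) = -(a • T.parity (f (false, true))) := eq_neg_of_add_eq_zero_left h2
    have h3 : f (true, true) = 0 := by
      rw [← T.parity_parity (f (true, true)), show T.parity (f (true, true)) = 0 from h3, map_zero]
    rw [negative_totD] at hd
    have h4 : T.parity (T.totD (T.parity (f (false, true)))) - T.parity (f (false, false)) = 0 :=
      apply_eq_zero_of_ofComp (C := negativeCrossing h1 hmul a 0 ha h0) hd (false, true)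
    have h5 : T.totD (T.parity (f (false, true))) = f (false, false) := by
      rw [← T.parity_parity (T.totD _), sub_eq_zero.1 h4, parity_parity]
    -- The preimage of `f (false, true)` under the arrow `1`, placed at its source; its horizontal
    -- image is the required `f (true, false)`.
    refine ⟨ofComp (quad (-T.parity (f (false, true))) 0 0 0),
      (negative_mem_totPiece _ _ _ _ _ _ T _).2
        ⟨neg_mem (T.parity_mem_totPiece ?_), zero_mem _, zero_mem _, zero_mem _⟩, ?_⟩
    · convert hm.2.1 using 2; ring
    · rw [negative_totD]
      refine ofComp_quad_congr ?_
      rintro ⟨_ | _, _ | _⟩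
      · simp [quad, h5]
      · simp [quad]
      · simp [quad, h2]
      · simp [quad, h3]

include hmul in
theorem unreduced_equiv (s t : ℤ) :
    Nonempty (((unreducedFactor 𝒜).tensor T).totH s t ≃ₗ[ℚ]
      T.totH (s + 2) (t - 2) × T.totH s t) := by
  set K := (unreducedFactor 𝒜).tensor T
  obtain ⟨e₂⟩ := homology_neg_equiv T.totD (T.totPiece (s + 2) (t - 2))
    (T.totPiece (s + 2 - 2) (t - 2))
  obtain ⟨e₁⟩ := homology_prod_equiv (-T.totD) T.totD (T.totPiece (s + 2) (t - 2))
    (T.totPiece (s + 2 - 2) (t - 2)) (T.totPiece s t) (T.totPiece (s - 2) t)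
  suffices h : Nonempty (K.totH s t ≃ₗ[ℚ] _) from
    h.map fun e => e ≪≫ₗ e₁ ≪≫ₗ e₂.prodCongr (LinearEquiv.refl ℚ _)
  have e : s - 2 + 2 = s + 2 - 2 := by ring
  let π : K.Carrier →ₗ[ℚ] T.Carrier × T.Carrier := (comp _ T false).prod (comp _ T true)
  have hπ : ∀ f : Bool → T.Carrier, π (ofComp f) = (f false, f true) := fun _ => rfl
  refine homology_equiv_of_surjective π K.totD_totD
    (fun m hm => totD_mem_totPiece' hmul hm) ?_ ?_ ?_ ?_ ?_ ?_
  · intro m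
    obtain ⟨f, rfl⟩ : ∃ f : Bool → T.Carrier, m = ofComp f :=
      ⟨fun x => comp _ T x m, rfl⟩
    rw [unreduced_totD, hπ, hπ]
    simp
  · intro m hm
    obtain ⟨f, rfl⟩ : ∃ f : Bool → T.Carrier, m = ofComp f :=
      ⟨fun x => comp _ T x m, rfl⟩
    exact (unreduced_mem_totPiece T f).1 hm
  · intro m hm
    obtain ⟨f, rfl⟩ : ∃ f : Bool → T.Carrier, m = ofComp f :=
      ⟨fun x => comp _ T x m, rfl⟩
    have := (unreduced_mem_totPiece T f).1 hm
    rwa [e] at this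
  · rintro ⟨u, v⟩ ⟨hu, hv⟩
    exact ⟨ofComp fun x : Bool => if x then v else u,
      (unreduced_mem_totPiece T _).2 ⟨by rw [e]; exact hu, hv⟩, rfl⟩
  · rintro ⟨u, v⟩ hz h
    obtain ⟨h2, h3⟩ := Prod.ext_iff.1 h
    have h2 : T.totD u = 0 := neg_eq_zero.1 h2
    have h3 : T.totD v = 0 := h3
    refine ⟨ofComp fun x : Bool => if x then v else u, (unreduced_mem_totPiece T _).2 hz, ?_, rfl⟩
    rw [unreduced_totD]
    exact ofComp_eq_zero (by rintro (_ | _) <;> simp [h2, h3])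
  · intro m hm hd hm0
    obtain ⟨f, rfl⟩ : ∃ f : Bool → T.Carrier, m = ofComp f :=
      ⟨fun x => comp _ T x m, rfl⟩
    rw [hπ] at hm0
    obtain ⟨h2, h3⟩ := Prod.ext_iff.1 hm0
    refine ⟨0, zero_mem _, ?_⟩
    rw [map_zero]
    exact (ofComp_eq_zero (by rintro (_ | _); exacts [h2, h3])).symm

end Doubling

end FreeComplex

end Squares

/-! ### Change of the ground ring -/

section BaseChange

variable {A : Type} [CommRing A] [Algebra ℚ A] {𝒜 : ℤ → Submodule ℚ A}
  {A' : Type} [CommRing A'] [Algebra ℚ A'] {𝒜' : ℤ → Submodule ℚ A'}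

/-- `φ` presents the graded algebra `A'` as the quotient of `A` by the element `c` of degree `2`. -/
structure IsGradedQuotient (𝒜 : ℤ → Submodule ℚ A) (𝒜' : ℤ → Submodule ℚ A') (φ : A →ₐ[ℚ] A')
    (c : A) : Prop where
  map : ∀ {n a}, a ∈ 𝒜 n → φ a ∈ 𝒜' n
  surj : ∀ {n b}, b ∈ 𝒜' n → ∃ a ∈ 𝒜 n, φ a = b
  zero : φ c = 0
  ker : ∀ {n a}, a ∈ 𝒜 n → φ a = 0 → ∃ u ∈ 𝒜 (n - 2), a = c * u

namespace FreeComplex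

/-- The complex obtained by extension of scalars. -/
def map (φ : A →ₐ[ℚ] A') (hφ : ∀ {n a}, a ∈ 𝒜 n → φ a ∈ 𝒜' n) (T : FreeComplex A 𝒜) :
    FreeComplex A' 𝒜' where
  ι := T.ι
  q := T.q
  h := T.h
  v := T.v
  dp := T.dp.map φ
  dv := T.dv.map φ
  dp_deg x y h := T.dp_deg x y fun h0 => h (by simp [h0])
  dv_deg x y h := T.dv_deg x y fun h0 => h (by simp [h0])
  dp_mem x y := hφ (T.dp_mem x y)
  dv_mem x y := hφ (T.dv_mem x y)
  dp_dp := by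
    have := congrArg φ.toRingHom.mapMatrix T.dp_dp
    rwa [map_mul, map_zero] at this
  dv_dv := by
    have := congrArg φ.toRingHom.mapMatrix T.dv_dv
    rwa [map_mul, map_zero] at this
  dp_dv := by
    have := congrArg φ.toRingHom.mapMatrix T.dp_dv
    rwa [map_mul, map_mul] at this

variable {φ : A →ₐ[ℚ] A'} (hφ : ∀ {n a}, a ∈ 𝒜 n → φ a ∈ 𝒜' n) (T : FreeComplex A 𝒜)

/-- The map to the extension of scalars. -/
def mapCarrier : T.Carrier →ₗ[ℚ] (T.map φ hφ).Carrier where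
  toFun m x := φ (m x)
  map_add' m n := by ext x; exact map_add φ _ _
  map_smul' c m := by ext x; exact map_smul φ _ _

theorem mapCarrier_smul (a : A) (m : T.Carrier) :
    T.mapCarrier hφ (a • m) = φ a • T.mapCarrier hφ m := by
  ext x
  exact map_mul φ _ _

theorem mapCarrier_totD (m : T.Carrier) :
    T.mapCarrier hφ (T.totD m) = (T.map φ hφ).totD (T.mapCarrier hφ m) := by
  ext x
  have hs : ∀ n, φ (sgn A n) = sgn A' n := fun n => by simp [sgn]
  have h1 : ∀ M : Matrix T.ι T.ι A, φ (M.mulVec m x) = (M.map φ).mulVec (fun y => φ (m y)) x := by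
    intro M
    simp only [Matrix.mulVec, dotProduct, map_sum, map_mul]
    rfl
  change φ (T.dp.mulVec m x + sgn A (T.h x) * T.dv.mulVec m x) =
    (T.dp.map φ).mulVec (fun y => φ (m y)) x +
      sgn A' (T.h x) * (T.dv.map φ).mulVec (fun y => φ (m y)) x
  rw [map_add, map_mul, hs, h1, h1]

theorem mapCarrier_mem {s t : ℤ} {m : T.Carrier} (hm : m ∈ T.totPiece s t) :
    T.mapCarrier hφ m ∈ (T.map φ hφ).totPiece s t := fun x =>
  ⟨hφ (hm x).1, fun h => (hm x).2 fun h0 => h ((congrArg φ h0).trans (map_zero φ))⟩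

theorem exists_mapCarrier_eq (hs : ∀ {n b}, b ∈ 𝒜' n → ∃ a ∈ 𝒜 n, φ a = b) {s t : ℤ}
    {y : (T.map φ hφ).Carrier} (hy : y ∈ (T.map φ hφ).totPiece s t) :
    ∃ m ∈ T.totPiece s t, T.mapCarrier hφ m = y := by
  -- The last condition keeps the support of the lift inside that of `y`, so that the cohomological
  -- degree is preserved as well.
  have h : ∀ x : T.ι, ∃ a ∈ 𝒜 (t + 2 * T.h x - T.q x), φ a = y x ∧ (a ≠ 0 → y x ≠ 0) := by
    intro x
    by_cases h0 : y x = 0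
    · exact ⟨0, zero_mem _, by rw [h0, map_zero], fun h => absurd rfl h⟩
    · obtain ⟨a, ha, h⟩ := hs (hy x).1
      exact ⟨a, ha, h, fun _ => h0⟩
  choose m h1 h2 h3 using h
  exact ⟨m, fun x => ⟨h1 x, fun h => (hy x).2 (h3 x h)⟩, funext h2⟩

theorem exists_smul_eq {c : A} (hk : ∀ {n a}, a ∈ 𝒜 n → φ a = 0 → ∃ u ∈ 𝒜 (n - 2), a = c * u)
    {s t : ℤ} {m : T.Carrier} (hm : m ∈ T.totPiece s t) (h0 : T.mapCarrier hφ m = 0) :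
    ∃ u ∈ T.totPiece s (t - 2), m = c • u := by
  have h : ∀ x : T.ι, ∃ u ∈ 𝒜 (t - 2 + 2 * T.h x - T.q x), m x = c * u ∧ (u ≠ 0 → m x ≠ 0) := by
    intro x
    by_cases h1 : m x = 0
    · exact ⟨0, zero_mem _, by rw [h1, mul_zero], fun h => absurd rfl h⟩
    · obtain ⟨u, hu, h⟩ := hk (hm x).1 (congrFun h0 x)
      refine ⟨u, ?_, h, fun _ => h1⟩
      rwa [show t - 2 + 2 * T.h x - T.q x = t + 2 * T.h x - T.q x - 2 by ring]
  choose u h1 h2 h3 using h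
  exact ⟨u, fun x => ⟨h1 x, fun h => (hm x).2 (h3 x h)⟩, funext h2⟩

/-- An isomorphism of graded rings induces isomorphisms on homology. -/
theorem totH_map_equiv (hi : Function.Injective φ)
    (hs : ∀ {n b}, b ∈ 𝒜' n → ∃ a ∈ 𝒜 n, φ a = b)
    (hmul : ∀ {m n : ℤ} {x y : A}, x ∈ 𝒜 m → y ∈ 𝒜 n → x * y ∈ 𝒜 (m + n)) (s t : ℤ) :
    Nonempty (T.totH s t ≃ₗ[ℚ] (T.map φ hφ).totH s t) := by
  have hinj : ∀ m, T.mapCarrier hφ m = 0 → m = 0 := fun m h => funext fun x =>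
    hi ((congrFun h x).trans (map_zero φ).symm)
  refine homology_equiv_of_surjective (T.mapCarrier hφ) T.totD_totD
    (fun m hm => totD_mem_totPiece' hmul hm) (T.mapCarrier_totD hφ)
    (fun m => T.mapCarrier_mem hφ) (fun m => T.mapCarrier_mem hφ)
    (fun y hy => T.exists_mapCarrier_eq hφ hs hy) ?_ ?_
  · intro z hz hd
    obtain ⟨m, hm, rfl⟩ := T.exists_mapCarrier_eq hφ hs hz
    exact ⟨m, hm, hinj _ (by rw [mapCarrier_totD, hd]), rfl⟩
  · intro m _ _ h
    exact ⟨0, zero_mem _, by rw [hinj m h, map_zero]⟩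

/-! ### Local complexes whose parameter is a nonzerodivisor. -/

section Quotient

variable {a c : A} (h1 : (1 : A) ∈ 𝒜 0)
    (hmul : ∀ {m n : ℤ} {x y : A}, x ∈ 𝒜 m → y ∈ 𝒜 n → x * y ∈ 𝒜 (m + n))
    (ha : a ∈ 𝒜 2) (hc : c ∈ 𝒜 2) (hq : IsGradedQuotient 𝒜 𝒜' φ c)
    (hreg : ∀ u : A, c * u = 0 → u = 0)

-- After the acyclic right column is discarded, the left column is the cone of multiplication by `c`
-- on `T`, up to signs. As `c` is a nonzerodivisor, its homology is that of `T` modulo `c`, read off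
-- at the target `(false, true)`.
include hq hreg in
theorem positive_quotient_equiv (s t : ℤ) :
    Nonempty (((positiveCrossing h1 hmul a c ha hc).tensor T).totH s t ≃ₗ[ℚ]
      (T.map φ hq.map).totH (s + 2) (t - 2)) := by
  set K := (positiveCrossing h1 hmul a c ha hc).tensor T
  set T' := T.map φ hq.map
  obtain ⟨e₂⟩ := homology_neg_equiv T'.totD (T'.totPiece (s + 2) (t - 2))
    (T'.totPiece (s + 2 - 2) (t - 2))
  suffices h : Nonempty (K.totH s t ≃ₗ[ℚ] _) from h.map fun e => e ≪≫ₗ e₂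
  have hregT : ∀ u : T.Carrier, c • u = 0 → u = 0 := fun u h => funext fun x =>
    hreg _ (congrFun h x)
  let π : K.Carrier →ₗ[ℚ] T'.Carrier := T.mapCarrier hq.map ∘ₗ comp _ T (false, true)
  have hπ : ∀ f : Bool × Bool → T.Carrier,
    π (ofComp f) = T.mapCarrier hq.map (f (false, true)) := fun _ => rfl
  have e : s - 2 + 2 = s + 2 - 2 := by ring
  refine homology_equiv_of_surjective π K.totD_totD
    (fun m hm => totD_mem_totPiece' hmul hm) ?_ ?_ ?_ ?_ ?_ ?_
  · intro m
    obtain ⟨f, rfl⟩ : ∃ f : Bool × Bool → T.Carrier, m = ofComp f :=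
      ⟨fun x => comp _ T x m, rfl⟩
    rw [positive_totD, hπ, hπ]
    simp [quad, mapCarrier_smul, hq.zero, mapCarrier_totD, T']
  · intro m hm
    obtain ⟨f, rfl⟩ : ∃ f : Bool × Bool → T.Carrier, m = ofComp f :=
      ⟨fun x => comp _ T x m, rfl⟩
    have hm := (positive_mem_totPiece _ _ _ _ _ _ T f).1 hm
    exact T.mapCarrier_mem _ hm.2.1
  · intro m hm
    obtain ⟨f, rfl⟩ : ∃ f : Bool × Bool → T.Carrier, m = ofComp f :=
      ⟨fun x => comp _ T x m, rfl⟩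
    have hm := (positive_mem_totPiece _ _ _ _ _ _ T f).1 hm
    exact T.mapCarrier_mem _ (by rw [← e]; exact hm.2.1)
  · intro y hy
    obtain ⟨z, hz, rfl⟩ := T.exists_mapCarrier_eq hq.map hq.surj hy
    exact ⟨ofComp (quad 0 z 0 0), (positive_mem_totPiece _ _ _ _ _ _ T _).2
      ⟨zero_mem _, by rw [e]; exact hz, zero_mem _, zero_mem _⟩, rfl⟩
  · intro y hy hd
    obtain ⟨z, hz, rfl⟩ := T.exists_mapCarrier_eq hq.map hq.surj hy
    have hd : T.mapCarrier hq.map (T.totD z) = 0 := by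
      rw [mapCarrier_totD]; exact neg_eq_zero.1 hd
    -- A cycle modulo `c` satisfies `D z = c u`. Cancelling `c` shows that `u` is a cycle, and it
    -- supplies the entry at the source of the arrow `-c`.
    obtain ⟨u, hu, hzu⟩ := T.exists_smul_eq hq.map hq.ker (T.totD_mem_totPiece hmul hz) hd
    have hDu : T.totD u = 0 := hregT _ (by rw [← totD_smul, ← hzu, totD_totD])
    refine ⟨ofComp (quad (T.parity u) z (-(a • T.parity z)) 0),
      (positive_mem_totPiece _ _ _ _ _ _ T _).2 ⟨T.parity_mem_totPiece ?_, hz,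
        neg_mem (smul_mem_totPiece hmul ha (T.parity_mem_totPiece hz) (by ring)), zero_mem _⟩,
      ?_, rfl⟩
    · rw [show s + 4 = s + 2 + 2 by ring, show t - 4 = t - 2 - 2 by ring]; exact hu
    · rw [positive_totD]
      refine ofComp_eq_zero ?_
      rintro ⟨_ | _, _ | _⟩
      · simp [quad, hDu]
      · simp [quad, hzu]
      · simp [quad, parity_smul, totD_smul, hzu, smul_smul]
      · simp [quad, parity_smul]
  · intro m hm hd hm0
    obtain ⟨f, rfl⟩ : ∃ f : Bool × Bool → T.Carrier, m = ofComp f :=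
      ⟨fun x => comp _ T x m, rfl⟩
    have hm := (positive_mem_totPiece _ _ _ _ _ _ T f).1 hm
    rw [hπ] at hm0
    obtain ⟨u, hu, hfu⟩ := T.exists_smul_eq hq.map hq.ker hm.2.1 hm0
    rw [positive_totD] at hd
    have h4 : T.totD (f (true, true)) + a • f (false, true) + T.parity (f (true, false)) = 0 :=
      apply_eq_zero_of_ofComp (C := positiveCrossing h1 hmul a c ha hc) hd (true, true)
    have h5 : -T.totD (f (false, true)) + c • T.parity (f (false, false)) = 0 :=
      apply_eq_zero_of_ofComp (C := positiveCrossing h1 hmul a c ha hc) hd (false, true)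
    have h6 : T.parity (f (false, false)) = T.totD u := by
      refine sub_eq_zero.1 (hregT _ ?_)
      rw [smul_sub, ← totD_smul, ← hfu, sub_eq_neg_add]
      exact h5
    have h7 : f (true, false) = -T.parity (T.totD (f (true, true))) - (a * c) • T.parity u := by
      rw [← T.parity_parity (f (true, false)), eq_neg_of_add_eq_zero_right h4, map_neg, map_add,
        hfu, smul_smul, parity_smul]
      abel
    -- The first entry produces `f (false, true) = c u` through the vertical arrow, the third one
    -- produces `f (true, true)` through the arrow `1`; the other two entries follow from the cycle
    -- equations.
    refine ⟨ofComp (quad (T.parity u) 0 (T.parity (f (true, true))) 0),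
      (positive_mem_totPiece _ _ _ _ _ _ T _).2
        ⟨T.parity_mem_totPiece ?_, zero_mem _, T.parity_mem_totPiece ?_, zero_mem _⟩, ?_⟩
    · rw [show s - 2 + 4 = s + 2 by ring, show t - 4 = t - 2 - 2 by ring]; exact hu
    · rw [show s - 2 + 2 = s by ring]; exact hm.2.2.2
    · rw [positive_totD]
      refine ofComp_quad_congr ?_
      rintro ⟨_ | _, _ | _⟩
      · simp [quad, ← h6]
      · simp [quad, hfu]
      · simp [quad, h7]
      · simp [quad]

-- Now the right column remains, with multiplication by `c` ending in `(true, true)`; this is why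
-- the homology is read off there.
include hq hreg in
theorem negative_quotient_equiv (s t : ℤ) :
    Nonempty (((negativeCrossing h1 hmul a c ha hc).tensor T).totH s t ≃ₗ[ℚ]
      (T.map φ hq.map).totH (s - 2) (t + 2)) := by
  set K := (negativeCrossing h1 hmul a c ha hc).tensor T
  set T' := T.map φ hq.map
  obtain ⟨e₂⟩ := homology_neg_equiv T'.totD (T'.totPiece (s - 2) (t + 2))
    (T'.totPiece (s - 2 - 2) (t + 2))
  suffices h : Nonempty (K.totH s t ≃ₗ[ℚ] _) from h.map fun e => e ≪≫ₗ e₂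
  have hregT : ∀ u : T.Carrier, c • u = 0 → u = 0 := fun u h => funext fun x =>
    hreg _ (congrFun h x)
  let π : K.Carrier →ₗ[ℚ] T'.Carrier := T.mapCarrier hq.map ∘ₗ T.parity ∘ₗ comp _ T (true, true)
  have hπ : ∀ f : Bool × Bool → T.Carrier,
    π (ofComp f) = T.mapCarrier hq.map (T.parity (f (true, true))) := fun _ => rfl
  refine homology_equiv_of_surjective π K.totD_totD
    (fun m hm => totD_mem_totPiece' hmul hm) ?_ ?_ ?_ ?_ ?_ ?_
  · intro m
    obtain ⟨f, rfl⟩ : ∃ f : Bool × Bool → T.Carrier, m = ofComp f :=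
      ⟨fun x => comp _ T x m, rfl⟩
    rw [negative_totD, hπ, hπ]
    simp [quad, mapCarrier_smul, hq.zero, mapCarrier_totD, T', parity_smul]
  · intro m hm
    obtain ⟨f, rfl⟩ : ∃ f : Bool × Bool → T.Carrier, m = ofComp f :=
      ⟨fun x => comp _ T x m, rfl⟩
    have hm := (negative_mem_totPiece _ _ _ _ _ _ T f).1 hm
    exact T.mapCarrier_mem _ (T.parity_mem_totPiece hm.2.2.2)
  · intro m hm
    obtain ⟨f, rfl⟩ : ∃ f : Bool × Bool → T.Carrier, m = ofComp f :=
      ⟨fun x => comp _ T x m, rfl⟩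
    have hm := (negative_mem_totPiece _ _ _ _ _ _ T f).1 hm
    exact T.mapCarrier_mem _ (T.parity_mem_totPiece hm.2.2.2)
  · intro y hy
    obtain ⟨z, hz, rfl⟩ := T.exists_mapCarrier_eq hq.map hq.surj hy
    exact ⟨ofComp (quad 0 0 0 (T.parity z)), (negative_mem_totPiece _ _ _ _ _ _ T _).2
      ⟨zero_mem _, zero_mem _, zero_mem _, T.parity_mem_totPiece hz⟩, by
        rw [hπ]; simp [quad]⟩
  · intro y hy hd
    obtain ⟨z, hz, rfl⟩ := T.exists_mapCarrier_eq hq.map hq.surj hy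
    have hd : T.mapCarrier hq.map (T.totD z) = 0 := by
      rw [mapCarrier_totD]; exact neg_eq_zero.1 hd
    obtain ⟨u, hu, hzu⟩ := T.exists_smul_eq hq.map hq.ker (T.totD_mem_totPiece hmul hz) hd
    have hDu : T.totD u = 0 := hregT _ (by rw [← totD_smul, ← hzu, totD_totD])
    refine ⟨ofComp (quad 0 0 (-u) (T.parity z)),
      (negative_mem_totPiece _ _ _ _ _ _ T _).2 ⟨zero_mem _, zero_mem _, neg_mem ?_,
        T.parity_mem_totPiece hz⟩, ?_, by rw [hπ]; simp [quad]⟩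
    · rw [show s = s - 2 + 2 by ring, show t = t + 2 - 2 by ring]; exact hu
    · rw [negative_totD]
      refine ofComp_eq_zero ?_
      rintro ⟨_ | _, _ | _⟩
      · simp [quad]
      · simp [quad]
      · simp [quad, hDu]
      · simp [quad, hzu, parity_smul]
  · intro m hm hd hm0
    obtain ⟨f, rfl⟩ : ∃ f : Bool × Bool → T.Carrier, m = ofComp f :=
      ⟨fun x => comp _ T x m, rfl⟩
    have hm := (negative_mem_totPiece _ _ _ _ _ _ T f).1 hm
    rw [hπ] at hm0
    obtain ⟨u, hu, hfu⟩ := T.exists_smul_eq hq.map hq.ker (T.parity_mem_totPiece hm.2.2.2) hm0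
    rw [negative_totD] at hd
    have h4 : T.parity (T.totD (T.parity (f (false, true)))) - T.parity (f (false, false)) = 0 :=
      apply_eq_zero_of_ofComp (C := negativeCrossing h1 hmul a c ha hc) hd (false, true)
    have h5 : T.totD (T.parity (f (false, true))) = f (false, false) := by
      rw [← T.parity_parity (T.totD _), sub_eq_zero.1 h4, parity_parity]
    have h6 : -T.parity (T.totD (T.parity (f (true, true)))) - (a * c) • f (false, true) -
        c • T.parity (f (true, false)) = 0 :=
      apply_eq_zero_of_ofComp (C := negativeCrossing h1 hmul a c ha hc) hd (true, true)
    -- Every term of the cycle equation at `(true, true)` is divisible by `c`, and `c` may be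
    -- cancelled.
    have h7 : -T.totD u - a • T.parity (f (false, true)) = f (true, false) := by
      refine sub_eq_zero.1 (hregT _ ?_)
      have := congrArg T.parity h6
      rw [map_sub, map_sub, map_neg, parity_parity, parity_smul, parity_smul, parity_parity,
        map_zero, hfu, totD_smul] at this
      rw [smul_sub, smul_sub, smul_neg, smul_smul, mul_comm c a]
      exact this
    have h8 : f (true, true) = c • T.parity u := by
      rw [← parity_smul, ← hfu, parity_parity]
    refine ⟨ofComp (quad (-T.parity (f (false, true))) 0 (-u) 0),
      (negative_mem_totPiece _ _ _ _ _ _ T _).2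
        ⟨neg_mem (T.parity_mem_totPiece ?_), zero_mem _, neg_mem ?_, zero_mem _⟩, ?_⟩
    · rw [show s - 2 + 2 = s by ring]; exact hm.2.1
    · rw [show t = t + 2 - 2 by ring]; exact hu
    · rw [negative_totD]
      refine ofComp_quad_congr ?_
      rintro ⟨_ | _, _ | _⟩
      · simp [quad, h5]
      · simp [quad]
      · simp [quad, ← h7, sub_eq_add_neg]
      · simp [quad, h8]

end Quotient

/-! ### Lists of local complexes -/

/-- Complexes on one and the same graded basis are compared through their matrices, the remaining
fields being proofs. -/
theorem mk_congr {ι : Type} [Fintype ι] [DecidableEq ι] {q h v : ι → ℤ} {dp dv dp' dv' : Matrix ι ι A}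
    (p₁ p₂ p₃ p₄ p₅ p₆ p₇ p₁' p₂' p₃' p₄' p₅' p₆' p₇') (e₁ : dp = dp') (e₂ : dv = dv') :
    (⟨ι, q, h, v, dp, dv, p₁, p₂, p₃, p₄, p₅, p₆, p₇⟩ : FreeComplex A 𝒜) =
      ⟨ι, q, h, v, dp', dv', p₁', p₂', p₃', p₄', p₅', p₆', p₇'⟩ := by
  subst e₁ e₂
  rfl

theorem map_tensor (C : FreeComplex A 𝒜) :
    (C.tensor T).map φ hφ = (C.map φ hφ).tensor (T.map φ hφ) := by
  have key : ∀ (M : Matrix C.ι C.ι A) (N : Matrix T.ι T.ι A) (g : C.ι → ℤ),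
      (M ⊗ₖ (1 : Matrix T.ι T.ι A) + signMatrix A g ⊗ₖ N).map φ =
        M.map φ ⊗ₖ (1 : Matrix T.ι T.ι A') + signMatrix A' g ⊗ₖ N.map φ := by
    intro M N g
    ext ⟨x, i⟩ ⟨y, j⟩
    have hs : ∀ n, φ (sgn A n) = sgn A' n := fun n => by simp [sgn]
    simp only [Matrix.map_apply, Matrix.add_apply, Matrix.kroneckerMap_apply, map_add, map_mul,
      signMatrix, Matrix.diagonal_apply, Matrix.one_apply]
    congr 2 <;> split_ifs <;> simp [hs]
  exact mk_congr _ _ _ _ _ _ _ _ _ _ _ _ _ _ (key _ _ _) (key _ _ _)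

end FreeComplex

/-- The data of a local complex: a crossing with its sign and its parameters, or an unreduced
factor. -/
inductive LocalFactor (𝒜 : ℤ → Submodule ℚ A) : Type
  | positive (a c : A) (ha : a ∈ 𝒜 2) (hc : c ∈ 𝒜 2) : LocalFactor 𝒜
  | negative (a c : A) (ha : a ∈ 𝒜 2) (hc : c ∈ 𝒜 2) : LocalFactor 𝒜
  | unreduced : LocalFactor 𝒜

/-- The properties of a graded ring which are used in the construction of the local complexes. -/
structure IsGraded (𝒜 : ℤ → Submodule ℚ A) : Prop where
  one : (1 : A) ∈ 𝒜 0
  mul : ∀ {m n : ℤ} {x y : A}, x ∈ 𝒜 m → y ∈ 𝒜 n → x * y ∈ 𝒜 (m + n)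

namespace LocalFactor

/-- The local complex. -/
def complex (h𝒜 : IsGraded 𝒜) : LocalFactor 𝒜 → FreeComplex A 𝒜
  | positive a c ha hc => positiveCrossing h𝒜.one h𝒜.mul a c ha hc
  | negative a c ha hc => negativeCrossing h𝒜.one h𝒜.mul a c ha hc
  | unreduced => unreducedFactor 𝒜

/-- The parameter of the two-term complex which is homotopy equivalent to the local complex. -/
def param : LocalFactor 𝒜 → A
  | positive _ c _ _ => c
  | negative _ c _ _ => c
  | unreduced => 0

theorem param_mem : ∀ x : LocalFactor 𝒜, x.param ∈ 𝒜 2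
  | positive _ _ _ hc => hc
  | negative _ _ _ hc => hc
  | unreduced => zero_mem _

/-- The sign of the crossing, and zero for an unreduced factor. -/
def sign : LocalFactor 𝒜 → ℤ
  | positive _ _ _ _ => 1
  | negative _ _ _ _ => -1
  | unreduced => 0

/-- Extension of scalars. -/
def map (φ : A →ₐ[ℚ] A') (hφ : ∀ {n a}, a ∈ 𝒜 n → φ a ∈ 𝒜' n) : LocalFactor 𝒜 → LocalFactor 𝒜'
  | positive a c ha hc => positive (φ a) (φ c) (hφ ha) (hφ hc)
  | negative a c ha hc => negative (φ a) (φ c) (hφ ha) (hφ hc)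
  | unreduced => unreduced

variable {φ : A →ₐ[ℚ] A'} (hφ : ∀ {n a}, a ∈ 𝒜 n → φ a ∈ 𝒜' n)

theorem param_map (x : LocalFactor 𝒜) : (x.map φ hφ).param = φ x.param := by
  cases x <;> simp [map, param]

theorem sign_map (x : LocalFactor 𝒜) : (x.map φ hφ).sign = x.sign := by
  cases x <;> rfl

theorem complex_map (h𝒜 : IsGraded 𝒜) (h𝒜' : IsGraded 𝒜') (x : LocalFactor 𝒜) :
    (x.complex h𝒜).map φ hφ = (x.map φ hφ).complex h𝒜' := by
  cases x
  · refine FreeComplex.mk_congr _ _ _ _ _ _ _ _ _ _ _ _ _ _ ?_ ?_ <;>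
    · ext ⟨_ | _, _ | _⟩ ⟨_ | _, _ | _⟩ <;>
      first
      | exact map_zero φ
      | exact map_one φ
      | rfl
      | exact map_neg φ _
      | exact (map_neg φ _).trans (congrArg Neg.neg (map_mul φ _ _))
  · refine FreeComplex.mk_congr _ _ _ _ _ _ _ _ _ _ _ _ _ _ ?_ ?_ <;>
    · ext ⟨_ | _, _ | _⟩ ⟨_ | _, _ | _⟩ <;>
      first
      | exact map_zero φ
      | exact map_one φ
      | rfl
      | exact map_neg φ _
      | exact (map_neg φ _).trans (congrArg Neg.neg (map_mul φ _ _))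
  · refine FreeComplex.mk_congr _ _ _ _ _ _ _ _ _ _ _ _ _ _ ?_ ?_ <;>
    · ext x y
      exact map_zero φ

/-- The tensor product of the local complexes. -/
def total (h𝒜 : IsGraded 𝒜) (l : List (LocalFactor 𝒜)) : FreeComplex A 𝒜 :=
  FreeComplex.tensorList (l.map (complex h𝒜))

theorem total_map (h𝒜 : IsGraded 𝒜) (h𝒜' : IsGraded 𝒜') (l : List (LocalFactor 𝒜)) :
    (total h𝒜 l).map φ hφ = total h𝒜' (l.map (map φ hφ)) := by
  induction l with
  | nil =>
    refine FreeComplex.mk_congr _ _ _ _ _ _ _ _ _ _ _ _ _ _ ?_ ?_ <;>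
    · ext x y
      exact map_zero φ
  | cons x l ih =>
    change (FreeComplex.tensor _ _).map φ hφ = FreeComplex.tensor _ _
    rw [FreeComplex.map_tensor, complex_map hφ h𝒜 h𝒜']
    exact congrArg _ ih

/-- Written with `sign`, the three cases differ from an unreduced factor only by an overall shift.
The two summands are ordered to match `unreduced_equiv`. -/
theorem totH_cons_of_param_eq_zero (h𝒜 : IsGraded 𝒜) (x : LocalFactor 𝒜) (l : List (LocalFactor 𝒜))
    (hx : x.param = 0) (s t : ℤ) :
    Nonempty ((total h𝒜 (x :: l)).totH s t ≃ₗ[ℚ]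
      (total h𝒜 l).totH (s + 2 * x.sign + 2) (t - 2 * x.sign - 2) ×
        (total h𝒜 l).totH (s + 2 * x.sign) (t - 2 * x.sign)) := by
  cases x with
  | positive a c ha hc =>
    obtain rfl : c = 0 := hx
    have := FreeComplex.positive_zero_equiv (h1 := h𝒜.one) (ha := ha) h𝒜.mul (total h𝒜 l) hc s t
    rw [show s + 4 = s + 2 * 1 + 2 by ring, show t - 4 = t - 2 * 1 - 2 by ring,
      show s + 2 = s + 2 * 1 by ring, show t - 2 = t - 2 * 1 by ring] at this
    exact this
  | negative a c ha hc =>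
    obtain rfl : c = 0 := hx
    have := FreeComplex.negative_zero_equiv (h1 := h𝒜.one) (ha := ha) h𝒜.mul (total h𝒜 l) hc s t
    change Nonempty (_ ≃ₗ[ℚ] (total h𝒜 l).totH (s + 2 * (-1) + 2) (t - 2 * (-1) - 2) ×
        (total h𝒜 l).totH (s + 2 * (-1)) (t - 2 * (-1)))
    rw [show s + 2 * (-1) + 2 = s by ring, show t - 2 * (-1) - 2 = t by ring,
      show s + 2 * (-1) = s - 2 by ring, show t - 2 * (-1) = t + 2 by ring]
    exact this
  | unreduced =>
    have := FreeComplex.unreduced_equiv h𝒜.mul (total h𝒜 l) s t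
    change Nonempty (_ ≃ₗ[ℚ] (total h𝒜 l).totH (s + 2 * 0 + 2) (t - 2 * 0 - 2) ×
        (total h𝒜 l).totH (s + 2 * 0) (t - 2 * 0))
    rw [show s + 2 * 0 = s by ring, show t - 2 * 0 = t by ring]
    exact this

theorem totH_cons_of_quotient (h𝒜 : IsGraded 𝒜) (h𝒜' : IsGraded 𝒜') (x : LocalFactor 𝒜)
    (l : List (LocalFactor 𝒜)) (hx : x.param ≠ 0) (hq : IsGradedQuotient 𝒜 𝒜' φ x.param)
    (hreg : ∀ u : A, x.param * u = 0 → u = 0) (s t : ℤ) :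
    Nonempty ((total h𝒜 (x :: l)).totH s t ≃ₗ[ℚ]
      (total h𝒜' (l.map (map φ hq.map))).totH (s + 2 * x.sign) (t - 2 * x.sign)) := by
  rw [← total_map hq.map h𝒜 h𝒜']
  cases x with
  | positive a c ha hc =>
    have := FreeComplex.positive_quotient_equiv (total h𝒜 l) h𝒜.one h𝒜.mul ha hc hq hreg s t
    rw [show s + 2 = s + 2 * 1 by ring, show t - 2 = t - 2 * 1 by ring] at this
    exact this
  | negative a c ha hc =>
    have := FreeComplex.negative_quotient_equiv (total h𝒜 l) h𝒜.one h𝒜.mul ha hc hq hreg s t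
    change Nonempty (_ ≃ₗ[ℚ] ((total h𝒜 l).map φ hq.map).totH (s + 2 * (-1)) (t - 2 * (-1)))
    rw [show s + 2 * (-1) = s - 2 by ring, show t - 2 * (-1) = t + 2 by ring]
    exact this
  | unreduced => exact absurd rfl hx

end LocalFactor

end BaseChange

/-! ### Graded polynomial rings and linear substitutions -/

section Polynomials

/-- The part of degree `n` of a polynomial ring whose variables have degree `2`. -/
abbrev polyDeg (σ : Type) (n : ℤ) : Submodule ℚ (MvPolynomial σ ℚ) :=
  MvPolynomial.weightedHomogeneousSubmodule ℚ (fun _ : σ => (2 : ℤ)) n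

theorem polyDeg_isGraded (σ : Type) : IsGraded (polyDeg σ) where
  one := MvPolynomial.isWeightedHomogeneous_one ℚ _
  mul := MvPolynomial.IsWeightedHomogeneous.mul

/-- The projections of a polynomial ring to its homogeneous parts. -/
def polyProjection (σ : Type) : GradedProjection (polyDeg σ) where
  proj n := MvPolynomial.weightedHomogeneousComponent (fun _ : σ => (2 : ℤ)) n
  mem n a := MvPolynomial.weightedHomogeneousComponent_mem _ a n
  self h := MvPolynomial.IsWeightedHomogeneous.weightedHomogeneousComponent_same h
  mul {m a} ha n x := by
    let := MvPolynomial.weightedGradedAlgebra ℚ (fun _ : σ => (2 : ℤ))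
    have h := DirectSum.coe_decompose_mul_add_of_left_mem (polyDeg σ) (j := n) (b := x) ha
    have e : ∀ k y, ((DirectSum.decompose (polyDeg σ) y k : polyDeg σ k) : MvPolynomial σ ℚ) =
        MvPolynomial.weightedHomogeneousComponent (fun _ : σ => (2 : ℤ)) k y := fun k y =>
      MvPolynomial.weightedDecomposition.decompose'_apply ℚ _ y k
    rwa [e, e] at h

variable {σ τ : Type} [Fintype σ] [Fintype τ]

/-- The linear form with the given coefficients. -/
def linForm (σ : Type) [Fintype σ] : (σ → ℚ) →ₗ[ℚ] MvPolynomial σ ℚ :=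
  Fintype.linearCombination ℚ MvPolynomial.X

theorem linForm_single [DecidableEq σ] (i : σ) :
    linForm σ (Pi.single i 1) = MvPolynomial.X i := by
  simp [linForm]

theorem linForm_injective : Function.Injective (linForm σ) :=
  linearIndependent_iff_injective_fintypeLinearCombination.1 (MvPolynomial.linearIndependent_X σ ℚ)

theorem linForm_mem (v : σ → ℚ) : linForm σ v ∈ polyDeg σ 2 := by
  rw [linForm, Fintype.linearCombination_apply]
  exact Submodule.sum_mem _ fun i _ => Submodule.smul_mem _ _
    (MvPolynomial.isWeightedHomogeneous_X ℚ _ i)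

theorem exists_linForm_eq {p : MvPolynomial σ ℚ} (hp : p ∈ polyDeg σ 2) :
    ∃ v, linForm σ v = p := by
  have h : p ∈ MvPolynomial.homogeneousSubmodule σ ℚ 1 := by
    intro d hd
    have := hp hd
    rw [Finsupp.weight_apply, Finsupp.sum] at this ⊢
    simp only [nsmul_eq_mul, ← Finset.sum_mul, Pi.one_apply, smul_eq_mul, mul_one] at this ⊢
    have h2 : ((∑ i ∈ d.support, d i : ℕ) : ℤ) * 2 = 2 := by push_cast; exact this
    omega
  rw [MvPolynomial.homogeneousSubmodule_one_eq_span_X] at h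
  rw [← LinearMap.mem_range, linForm, Fintype.range_linearCombination]
  exact h

/-- The substitution of linear forms given by a linear map. -/
def linHom (f : (σ → ℚ) →ₗ[ℚ] (τ → ℚ)) : MvPolynomial σ ℚ →ₐ[ℚ] MvPolynomial τ ℚ := by
  classical exact MvPolynomial.aeval fun i => linForm τ (f (Pi.single i 1))

theorem linHom_linForm (f : (σ → ℚ) →ₗ[ℚ] (τ → ℚ)) (v : σ → ℚ) :
    linHom f (linForm σ v) = linForm τ (f v) := by
  classical
  have : (linHom f).toLinearMap ∘ₗ linForm σ = linForm τ ∘ₗ f := by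
    refine LinearMap.pi_ext' fun i => LinearMap.ext_ring ?_
    change linHom f (linForm σ (Pi.single i 1)) = linForm τ (f (Pi.single i 1))
    rw [linForm_single, linHom, MvPolynomial.aeval_X]
  exact LinearMap.congr_fun this v

omit [Fintype σ] in
theorem linHom_mem (f : (σ → ℚ) →ₗ[ℚ] (τ → ℚ)) {n : ℤ} {p : MvPolynomial σ ℚ}
    (hp : p ∈ polyDeg σ n) : linHom f p ∈ polyDeg τ n := by
  classical
  rw [p.as_sum, map_sum]
  refine Submodule.sum_mem _ fun d hd => ?_
  rw [linHom, MvPolynomial.aeval_monomial]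
  have h := hp (MvPolynomial.mem_support_iff.1 hd)
  rw [Finsupp.weight_apply, Finsupp.sum] at h
  rw [← Algebra.smul_def, ← h]
  exact Submodule.smul_mem _ _ (MvPolynomial.IsWeightedHomogeneous.prod _ _ _ fun i _ =>
    (linForm_mem _).pow _)

theorem algHom_ext_linForm {B : Type} [CommRing B] [Algebra ℚ B] {φ ψ : MvPolynomial σ ℚ →ₐ[ℚ] B}
    (h : ∀ v, φ (linForm σ v) = ψ (linForm σ v)) : φ = ψ := by
  classical
  refine MvPolynomial.algHom_ext fun i => ?_
  rw [← linForm_single]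
  exact h _

variable {f : (σ → ℚ) →ₗ[ℚ] (τ → ℚ)} {g : (τ → ℚ) →ₗ[ℚ] (σ → ℚ)} (hfg : ∀ v, f (g v) = v)

include hfg in
theorem linHom_linHom (p : MvPolynomial τ ℚ) : linHom f (linHom g p) = p := by
  have : (linHom f).comp (linHom g) = AlgHom.id ℚ _ := algHom_ext_linForm fun v => by
    rw [AlgHom.comp_apply, linHom_linForm, linHom_linForm, hfg]; rfl
  exact AlgHom.congr_fun this p

-- Modulo the ideal generated by `ker f`, the substitution `g ∘ f` fixes every linear form, hence
-- every polynomial.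
include hfg in
theorem sub_linHom_linHom_mem (p : MvPolynomial σ ℚ) :
    p - linHom g (linHom f p) ∈ Ideal.span (linForm σ '' LinearMap.ker f) := by
  have : (Ideal.Quotient.mkₐ ℚ (Ideal.span (linForm σ '' LinearMap.ker f))).comp
      ((linHom g).comp (linHom f)) = Ideal.Quotient.mkₐ ℚ _ := by
    refine algHom_ext_linForm fun v => (Ideal.Quotient.eq.2 ?_).symm
    change _ - linHom g (linHom f (linForm σ v)) ∈ _
    rw [linHom_linForm, linHom_linForm, ← map_sub]
    exact Ideal.subset_span ⟨_, by simp [hfg], rfl⟩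
  exact Ideal.Quotient.eq.1 (AlgHom.congr_fun this p).symm

theorem exists_linear_quotient (U : Submodule ℚ (σ → ℚ)) {n : ℕ}
    (h : Module.finrank ℚ U + n = Fintype.card σ) :
    ∃ (f : (σ → ℚ) →ₗ[ℚ] (Fin n → ℚ)) (g : (Fin n → ℚ) →ₗ[ℚ] (σ → ℚ)),
      (∀ v, f (g v) = v) ∧ LinearMap.ker f = U := by
  have h1 : Module.finrank ℚ ((σ → ℚ) ⧸ U) = Module.finrank ℚ (Fin n → ℚ) := by
    have := U.finrank_quotient_add_finrank
    rw [Module.finrank_fintype_fun_eq_card] at this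
    rw [Module.finrank_fin_fun]
    omega
  let e := LinearEquiv.ofFinrankEq _ _ h1
  obtain ⟨g, hg⟩ := (e.toLinearMap ∘ₗ U.mkQ).exists_rightInverse_of_surjective
    (LinearMap.range_eq_top.2 (e.surjective.comp U.mkQ_surjective))
  refine ⟨e.toLinearMap ∘ₗ U.mkQ, g, LinearMap.congr_fun hg, ?_⟩
  rw [LinearMap.ker_comp_of_ker_eq_bot _ e.ker, U.ker_mkQ]

include hfg in
theorem linHom_isGradedQuotient {c : σ → ℚ} (hc : LinearMap.ker f = Submodule.span ℚ {c}) :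
    IsGradedQuotient (polyDeg σ) (polyDeg τ) (linHom f) (linForm σ c) where
  map := linHom_mem f
  surj {_ b} hb := ⟨linHom g b, linHom_mem g hb, linHom_linHom hfg b⟩
  zero := by
    have : c ∈ LinearMap.ker f := hc ▸ Submodule.mem_span_singleton_self c
    rw [linHom_linForm, this, map_zero]
  ker {n a} ha h0 := by
    have h1 := sub_linHom_linHom_mem hfg a
    rw [h0, map_zero, sub_zero] at h1
    have h2 : Ideal.span (linForm σ '' LinearMap.ker f) ≤ Ideal.span {linForm σ c} := by
      rw [Ideal.span_le]
      rintro _ ⟨v, hv, rfl⟩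
      rw [hc] at hv
      obtain ⟨r, rfl⟩ := Submodule.mem_span_singleton.1 hv
      rw [map_smul, Algebra.smul_def]
      exact Ideal.mul_mem_left _ _ (Ideal.mem_span_singleton_self _)
    obtain ⟨u, rfl⟩ := Ideal.mem_span_singleton.1 (h2 h1)
    -- The cofactor `u` need not be homogeneous; its part of degree `n - 2` serves as well because
    -- `a` is homogeneous.
    refine ⟨(polyProjection σ).proj (n - 2) u, (polyProjection σ).mem _ _, ?_⟩
    rw [← (polyProjection σ).mul (linForm_mem c), show 2 + (n - 2) = n by ring,
      (polyProjection σ).self ha]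

end Polynomials

/-! ### The homology of a tensor product of local complexes over a polynomial ring -/

namespace LocalFactor

section ParamSpan

variable {A : Type} [CommRing A] [Algebra ℚ A] {𝒜 : ℤ → Submodule ℚ A}
  {A' : Type} [CommRing A'] [Algebra ℚ A'] {𝒜' : ℤ → Submodule ℚ A'}

/-- The space spanned by the parameters. -/
def paramSpan (l : List (LocalFactor 𝒜)) : Submodule ℚ A :=
  Submodule.span ℚ {a | ∃ x ∈ l, x.param = a}

theorem paramSpan_nil : paramSpan ([] : List (LocalFactor 𝒜)) = ⊥ := by
  simp [paramSpan]

theorem paramSpan_cons (x : LocalFactor 𝒜) (l : List (LocalFactor 𝒜)) :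
    paramSpan (x :: l) = Submodule.span ℚ {x.param} ⊔ paramSpan l := by
  rw [paramSpan, paramSpan, ← Submodule.span_union]
  congr 1
  ext a
  simp [eq_comm]

theorem paramSpan_map {φ : A →ₐ[ℚ] A'} (hφ : ∀ {n a}, a ∈ 𝒜 n → φ a ∈ 𝒜' n)
    (l : List (LocalFactor 𝒜)) :
    paramSpan (l.map (map φ hφ)) = (paramSpan l).map φ.toLinearMap := by
  induction l with
  | nil => simp [paramSpan_nil]
  | cons x l ih =>
    rw [List.map_cons, paramSpan_cons, paramSpan_cons, ih, Submodule.map_sup, Submodule.map_span,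
      Set.image_singleton, param_map]
    rfl

instance (l : List (LocalFactor 𝒜)) : FiniteDimensional ℚ (paramSpan l) := by
  induction l with
  | nil => rw [paramSpan_nil]; infer_instance
  | cons x l ih => rw [paramSpan_cons]; infer_instance

theorem finrank_paramSpan_le (l : List (LocalFactor 𝒜)) :
    Module.finrank ℚ (paramSpan l) ≤ l.length := by
  induction l with
  | nil => simp [paramSpan_nil]
  | cons x l ih =>
    rw [paramSpan_cons, List.length_cons]
    have h1 := Submodule.finrank_add_le_finrank_add_finrank (Submodule.span ℚ {x.param})
      (paramSpan l)
    have h2 := finrank_span_le_card (R := ℚ) {x.param}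
    simp only [Set.toFinset_singleton, Finset.card_singleton] at h2
    omega

theorem paramSpan_le (l : List (LocalFactor 𝒜)) : paramSpan l ≤ 𝒜 2 := by
  rw [paramSpan, Submodule.span_le]
  rintro _ ⟨x, _, rfl⟩
  exact x.param_mem

end ParamSpan

/-- The tensor product of unreduced factors over a polynomial ring. -/
abbrev standard (n m : ℕ) : FreeComplex (MvPolynomial (Fin n) ℚ) (polyDeg (Fin n)) :=
  total (polyDeg_isGraded _) (List.replicate m unreduced)

/-- Rank-nullity on the span of the parameters: they are linear forms, so the substitution kills
exactly the multiples of `x.param`. -/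
theorem finrank_paramSpan_map_add_one {n k : ℕ} {f : (Fin n → ℚ) →ₗ[ℚ] (Fin k → ℚ)}
    {c : Fin n → ℚ} (hc : c ≠ 0) (hf : LinearMap.ker f = Submodule.span ℚ {c})
    (x : LocalFactor (polyDeg (Fin n))) (hx : linForm _ c = x.param)
    (l : List (LocalFactor (polyDeg (Fin n)))) :
    Module.finrank ℚ (paramSpan (l.map (map (linHom f) (linHom_mem f)))) + 1 =
      Module.finrank ℚ (paramSpan (x :: l)) := by
  have hfc : linHom f x.param = 0 := by
    have : c ∈ LinearMap.ker f := hf ▸ Submodule.mem_span_singleton_self c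
    rw [← hx, linHom_linForm, this, map_zero]
  set S := paramSpan (x :: l) with hS
  have hxS : x.param ∈ S := by
    rw [hS, paramSpan_cons]
    exact Submodule.mem_sup_left (Submodule.mem_span_singleton_self _)
  have h1 := ((linHom f).toLinearMap.domRestrict S).finrank_range_add_finrank_ker
  have h2 : LinearMap.range ((linHom f).toLinearMap.domRestrict S) =
      paramSpan (l.map (map (linHom f) (linHom_mem f))) := by
    rw [LinearMap.range_domRestrict, paramSpan_map, hS, paramSpan_cons, Submodule.map_sup,
      Submodule.map_span, Set.image_singleton]
    change Submodule.span ℚ {linHom f x.param} ⊔ _ = _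
    rw [hfc]
    simp
  have h3 : LinearMap.ker ((linHom f).toLinearMap.domRestrict S) =
      Submodule.span ℚ {⟨x.param, hxS⟩} := by
    ext ⟨p, hp⟩
    rw [LinearMap.mem_ker, Submodule.mem_span_singleton]
    constructor
    · intro h
      obtain ⟨v, rfl⟩ := exists_linForm_eq (paramSpan_le _ hp)
      have h : linHom f (linForm _ v) = 0 := h
      rw [linHom_linForm] at h
      have hv : v ∈ LinearMap.ker f := linForm_injective (h.trans (map_zero _).symm)
      rw [hf] at hv
      obtain ⟨r, rfl⟩ := Submodule.mem_span_singleton.1 hv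
      exact ⟨r, Subtype.ext (((map_smul (linForm _) r c).trans (by rw [hx]; rfl)).symm)⟩
    · rintro ⟨r, h⟩
      obtain rfl : r • x.param = p := congrArg Subtype.val h
      exact (map_smul (linHom f) _ _).trans (by rw [hfc, smul_zero])
  rw [h2, h3, finrank_span_singleton] at h1
  · exact h1
  · intro h0
    have h0 : x.param = 0 := congrArg Subtype.val h0
    exact hc (linForm_injective (by rw [hx, h0, map_zero]))

/-- Induction on the factors. A zero parameter splits the homology in two, as an unreduced factor on
the right-hand side does. A nonzero one removes a factor and a variable and lowers the rank by one,
so `n'` (variables minus rank) and `m` (factors minus rank) do not change. -/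
theorem totH_equiv_standard {n n' m : ℕ} (l : List (LocalFactor (polyDeg (Fin n))))
    (hn : Module.finrank ℚ (paramSpan l) + n' = n)
    (hm : Module.finrank ℚ (paramSpan l) + m = l.length) (s t : ℤ) :
    Nonempty ((total (polyDeg_isGraded _) l).totH s t ≃ₗ[ℚ]
      (standard n' m).totH (s + 2 * (l.map sign).sum) (t - 2 * (l.map sign).sum)) := by
  induction hk : l.length generalizing n m s t with
  | zero =>
    obtain rfl := List.length_eq_zero_iff.1 hk
    rw [paramSpan_nil, finrank_bot] at hn hm
    obtain rfl : n' = n := by omega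
    obtain rfl : m = 0 := by simpa using hm
    change Nonempty (_ ≃ₗ[ℚ] (standard n' 0).totH (s + 2 * 0) (t - 2 * 0))
    rw [mul_zero, add_zero, sub_zero]
    exact ⟨LinearEquiv.refl _ _⟩
  | succ k ih =>
    obtain ⟨x, l, rfl⟩ := List.exists_cons_of_length_eq_add_one hk
    have hk : l.length = k := by simpa using hk
    rw [List.length_cons] at hm
    rw [List.map_cons, List.sum_cons]
    by_cases hx : x.param = 0
    · rw [paramSpan_cons, hx, Submodule.span_zero_singleton, bot_sup_eq] at hn hm
      have h1 := finrank_paramSpan_le l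
      -- The rank is now at most `l.length`, so an unreduced factor is left on the right to match
      -- `x`.
      obtain ⟨m, rfl⟩ : ∃ m', m = m' + 1 := ⟨m - 1, by omega⟩
      obtain ⟨e⟩ := totH_cons_of_param_eq_zero (polyDeg_isGraded _) x l hx s t
      obtain ⟨e'⟩ := totH_cons_of_param_eq_zero (polyDeg_isGraded (Fin n')) unreduced
        (List.replicate m unreduced) rfl (s + 2 * (x.sign + (l.map sign).sum))
        (t - 2 * (x.sign + (l.map sign).sum))
      obtain ⟨e₁⟩ := ih (m := m) l hn (by omega) (s + 2 * x.sign + 2) (t - 2 * x.sign - 2) hk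
      obtain ⟨e₂⟩ := ih (m := m) l hn (by omega) (s + 2 * x.sign) (t - 2 * x.sign) hk
      rw [show s + 2 * x.sign + 2 + 2 * (l.map sign).sum =
          s + 2 * (x.sign + (l.map sign).sum) + 2 * 0 + 2 by ring,
        show t - 2 * x.sign - 2 - 2 * (l.map sign).sum =
          t - 2 * (x.sign + (l.map sign).sum) - 2 * 0 - 2 by ring] at e₁
      rw [show s + 2 * x.sign + 2 * (l.map sign).sum =
          s + 2 * (x.sign + (l.map sign).sum) + 2 * 0 by ring,
        show t - 2 * x.sign - 2 * (l.map sign).sum =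
          t - 2 * (x.sign + (l.map sign).sum) - 2 * 0 by ring] at e₂
      exact ⟨e ≪≫ₗ (e₁.prodCongr e₂) ≪≫ₗ e'.symm⟩
    · obtain ⟨c, hc⟩ := exists_linForm_eq x.param_mem
      have hc0 : c ≠ 0 := by
        rintro rfl
        exact hx (by rw [← hc, map_zero])
      obtain ⟨n, rfl⟩ : ∃ j, n = j + 1 := by
        refine Nat.exists_eq_succ_of_ne_zero ?_
        rintro rfl
        exact hc0 (Subsingleton.elim _ _)
      obtain ⟨f, g, hfg, hf⟩ := exists_linear_quotient (n := n) (Submodule.span ℚ {c})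
        (by rw [finrank_span_singleton hc0, Fintype.card_fin, add_comm])
      have hq := linHom_isGradedQuotient hfg hf
      rw [hc] at hq
      obtain ⟨e⟩ := totH_cons_of_quotient (polyDeg_isGraded _) (polyDeg_isGraded _) x l hx hq
        (fun u hu => (mul_eq_zero.1 hu).resolve_left hx) s t
      have h1 := finrank_paramSpan_map_add_one hc0 hf x hc l
      obtain ⟨e'⟩ := ih (l.map (map (linHom f) hq.map)) (m := m) (by omega)
        (by rw [List.length_map]; omega) (s + 2 * x.sign) (t - 2 * x.sign) (by simpa using hk)
      have h2 : (l.map (map (linHom f) hq.map)).map sign = l.map sign := by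
        rw [List.map_map]
        exact List.map_congr_left fun y _ => sign_map _ y
      rw [h2, show s + 2 * x.sign + 2 * (l.map sign).sum =
          s + 2 * (x.sign + (l.map sign).sum) by ring,
        show t - 2 * x.sign - 2 * (l.map sign).sum =
          t - 2 * (x.sign + (l.map sign).sum) by ring] at e'
      exact ⟨e ≪≫ₗ e'⟩

end LocalFactor

/-! ### The reduced ring is a polynomial ring -/

section ReducedRing

variable {b : ℕ} (β : BraidWord b)

/-- The coefficient vectors of the linear relators. -/
def relatorVectors : Set (Edge β → ℚ) :=
  {v | ∃ t : Fin β.length, v = Pi.single (crossing β t).k 1 + Pi.single (crossing β t).l 1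
      - Pi.single (crossing β t).i 1 - Pi.single (crossing β t).j 1} ∪
  {v | ∃ e f : Edge β, IsMark β e f ∧ v = Pi.single f 1 - Pi.single e 1}

theorem linForm_image_relatorVectors : linForm (Edge β) '' relatorVectors β = relators β := by
  ext p
  constructor
  · rintro ⟨v, ⟨t, rfl⟩ | ⟨e, f, h, rfl⟩, rfl⟩
    · exact Or.inl ⟨t, by simp only [map_sub, map_add, linForm_single]⟩
    · exact Or.inr ⟨e, f, h, by simp only [map_sub, linForm_single]⟩
  · rintro (⟨t, rfl⟩ | ⟨e, f, h, rfl⟩)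
    · exact ⟨_, Or.inl ⟨t, rfl⟩, by simp only [map_sub, map_add, linForm_single]⟩
    · exact ⟨_, Or.inr ⟨e, f, h, rfl⟩, by simp only [map_sub, linForm_single]⟩

/-- The linear relations between the edges, together with the relation `X_e = 0`. -/
def basedRelations (e₀ : Edge β) : Submodule ℚ (Edge β → ℚ) :=
  Submodule.span ℚ (relatorVectors β) ⊔ Submodule.span ℚ {Pi.single e₀ 1}

variable {β}

theorem edgeDiff_sub (e f g : Edge β) : edgeDiff β e g - edgeDiff β f g = edgeDiff β e f :=
  Subtype.ext (by simp [edgeDiff])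

theorem mk_relator {p : MvPolynomial (Edge β) ℚ} (hp : p ∈ relators β) :
    Ideal.Quotient.mk (Ideal.span (relators β)) p = 0 :=
  Ideal.Quotient.eq_zero_iff_mem.2 (Ideal.subset_span hp)

/-- The translation of the variables which makes `X_e` vanish. -/
def translateEdge (e₀ : Edge β) : MvPolynomial (Edge β) ℚ →ₐ[ℚ] ReducedRing β :=
  MvPolynomial.aeval fun e => edgeDiff β e e₀

/-- The coefficients of a relator sum to zero, so a common translation of all variables does not
affect it. -/
theorem translateEdge_relator (e₀ : Edge β) {p : MvPolynomial (Edge β) ℚ} (hp : p ∈ relators β) :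
    translateEdge e₀ p = 0 := by
  have h := mk_relator hp
  rcases hp with ⟨t, rfl⟩ | ⟨e, f, hm, rfl⟩
  · refine Subtype.ext ?_
    simp only [translateEdge, map_sub, map_add, MvPolynomial.aeval_X, edgeDiff,
      AddSubgroupClass.coe_sub, AddMemClass.coe_add, edgeVar, ZeroMemClass.coe_zero] at h ⊢
    linear_combination h
  · refine Subtype.ext ?_
    simp only [translateEdge, map_sub, MvPolynomial.aeval_X, edgeDiff,
      AddSubgroupClass.coe_sub, edgeVar, ZeroMemClass.coe_zero] at h ⊢
    linear_combination h

/-- The retraction of the edge ring onto the reduced ring. -/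
def edgeRetraction (e₀ : Edge β) : EdgeRing β →ₐ[ℚ] ReducedRing β :=
  Ideal.Quotient.liftₐ _ (translateEdge e₀) fun p hp => by
    have : Ideal.span (relators β) ≤ RingHom.ker (translateEdge e₀) :=
      Ideal.span_le.2 fun p hp => translateEdge_relator e₀ hp
    exact this hp

theorem edgeRetraction_edgeVar (e₀ e : Edge β) :
    edgeRetraction e₀ (edgeVar β e) = edgeDiff β e e₀ :=
  MvPolynomial.aeval_X _ _

theorem edgeRetraction_coe (e₀ : Edge β) (x : ReducedRing β) : edgeRetraction e₀ x = x := by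
  obtain ⟨x, hx⟩ := x
  change edgeRetraction e₀ x = _
  induction hx using Algebra.adjoin_induction with
  | mem x h =>
    obtain ⟨e, f, rfl⟩ := h
    rw [map_sub, edgeRetraction_edgeVar, edgeRetraction_edgeVar, edgeDiff_sub]
    rfl
  | algebraMap r => exact AlgHom.commutes _ _
  | add x y hx hy h1 h2 => rw [map_add, h1, h2]; rfl
  | mul x y hx hy h1 h2 => rw [map_mul, h1, h2]; rfl

theorem translateEdge_mem (e₀ : Edge β) {n : ℤ} {p : MvPolynomial (Edge β) ℚ}
    (hp : p ∈ polyDeg _ n) : translateEdge e₀ p ∈ reducedRingDeg β n := by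
  -- This is the substitution `X_e ↦ X_e - X_{e₀}` in the polynomial ring itself; it yields a
  -- homogeneous representative.
  let f : (Edge β → ℚ) →ₗ[ℚ] (Edge β → ℚ) :=
    LinearMap.id - (Fintype.linearCombination ℚ fun _ => Pi.single e₀ 1)
  refine ⟨linHom f p, linHom_mem f hp, ?_⟩
  have : (Ideal.Quotient.mkₐ ℚ (Ideal.span (relators β))).comp (linHom f) =
      (ReducedRing β).val.comp (translateEdge e₀) := by
    refine MvPolynomial.algHom_ext fun e => ?_
    have : linHom f (MvPolynomial.X e) = MvPolynomial.X e - MvPolynomial.X e₀ := by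
      rw [← linForm_single, linHom_linForm, ← linForm_single, ← map_sub]
      simp [f]
    rw [AlgHom.comp_apply, this, AlgHom.comp_apply, translateEdge, MvPolynomial.aeval_X]
    rfl
  exact AlgHom.congr_fun this p

variable {n : ℕ} {e₀ : Edge β} {f : (Edge β → ℚ) →ₗ[ℚ] (Fin n → ℚ)}
  {g : (Fin n → ℚ) →ₗ[ℚ] (Edge β → ℚ)} (hfg : ∀ v, f (g v) = v)
  (hf : LinearMap.ker f = basedRelations β e₀)

include hf

theorem linHom_relator {p : MvPolynomial (Edge β) ℚ} (hp : p ∈ Ideal.span (relators β)) :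
    linHom f p = 0 := by
  have : Ideal.span (relators β) ≤ RingHom.ker (linHom f) := by
    rw [Ideal.span_le, ← linForm_image_relatorVectors]
    rintro _ ⟨v, hv, rfl⟩
    have : v ∈ LinearMap.ker f := by
      rw [hf]
      exact Submodule.mem_sup_left (Submodule.subset_span hv)
    change linHom f (linForm _ v) = 0
    rw [linHom_linForm, this, map_zero]
  exact this hp

/-- The map from the reduced ring to a polynomial ring. -/
def reducedToPoly : ReducedRing β →ₐ[ℚ] MvPolynomial (Fin n) ℚ :=
  (Ideal.Quotient.liftₐ _ (linHom f) fun _ => linHom_relator hf).comp (ReducedRing β).val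

theorem reducedToPoly_eq {x : ReducedRing β} {p : MvPolynomial (Edge β) ℚ}
    (h : Ideal.Quotient.mk (Ideal.span (relators β)) p = x) :
    reducedToPoly hf x = linHom f p := by
  change Ideal.Quotient.liftₐ _ (linHom f) (fun _ => linHom_relator hf) (x : EdgeRing β) = _
  rw [← h]
  rfl

theorem reducedToPoly_edgeDiff (e e' : Edge β) :
    reducedToPoly hf (edgeDiff β e e') = linForm _ (f (Pi.single e 1 - Pi.single e' 1)) := by
  rw [← linHom_linForm, map_sub, linForm_single, linForm_single]
  rfl

theorem reducedToPoly_mem {d : ℤ} {x : ReducedRing β} (hx : x ∈ reducedRingDeg β d) :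
    reducedToPoly hf x ∈ polyDeg (Fin n) d := by
  obtain ⟨p, hp, h⟩ := hx
  rw [reducedToPoly_eq hf h]
  exact linHom_mem f hp

theorem translateEdge_linForm {v : Edge β → ℚ} (hv : v ∈ LinearMap.ker f) :
    translateEdge e₀ (linForm _ v) = 0 := by
  have : LinearMap.ker f ≤ LinearMap.ker ((translateEdge e₀).toLinearMap ∘ₗ linForm (Edge β)) := by
    rw [hf, basedRelations, sup_le_iff, Submodule.span_le, Submodule.span_le]
    constructor
    · intro v hv
      exact translateEdge_relator e₀ (linForm_image_relatorVectors β ▸ ⟨v, hv, rfl⟩)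
    · rintro _ rfl
      change translateEdge e₀ (linForm _ _) = 0
      rw [linForm_single, translateEdge, MvPolynomial.aeval_X]
      exact Subtype.ext (sub_self _)
  exact this hv

-- The reduced ring is the polynomial ring modulo the relators and `X_{e₀}`. A polynomial and its
-- image under `g ∘ f` differ by an element of the ideal of `ker f`, which the translation kills,
-- and the translation restricts to the identity on the reduced ring.
include hfg in
theorem translateEdge_reducedToPoly (x : ReducedRing β) :
    translateEdge e₀ (linHom g (reducedToPoly hf x)) = x := by
  obtain ⟨p, hp⟩ := Ideal.Quotient.mk_surjective (x : EdgeRing β)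
  have h1 := reducedToPoly_eq hf hp
  have h2 : Ideal.span (linForm _ '' LinearMap.ker f) ≤ RingHom.ker (translateEdge e₀) := by
    rw [Ideal.span_le]
    rintro _ ⟨v, hv, rfl⟩
    exact translateEdge_linForm hf hv
  have h3 : translateEdge e₀ (p - linHom g (linHom f p)) = 0 := h2 (sub_linHom_linHom_mem hfg p)
  rw [map_sub, sub_eq_zero] at h3
  rw [h1, ← h3, ← edgeRetraction_coe e₀ x, ← hp]
  rfl

include hfg in
theorem reducedToPoly_translateEdge (p : MvPolynomial (Fin n) ℚ) :
    reducedToPoly hf (translateEdge e₀ (linHom g p)) = p := by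
  have h : (reducedToPoly hf).comp (translateEdge e₀) = linHom f := by
    refine MvPolynomial.algHom_ext fun e => ?_
    rw [AlgHom.comp_apply, translateEdge, MvPolynomial.aeval_X, reducedToPoly_edgeDiff,
      ← linForm_single, linHom_linForm, map_sub]
    have : f (Pi.single e₀ 1) = 0 := by
      rw [← LinearMap.mem_ker, hf]
      exact Submodule.mem_sup_right (Submodule.mem_span_singleton_self _)
    rw [this, sub_zero]
  exact (AlgHom.congr_fun h _).trans (linHom_linHom hfg p)

include hfg in
/-- The projections of the reduced ring to its homogeneous parts. -/
def reducedProjection : GradedProjection (reducedRingDeg β) where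
  proj k := (translateEdge e₀).toLinearMap ∘ₗ (linHom g).toLinearMap ∘ₗ
    (polyProjection (Fin n)).proj k ∘ₗ (reducedToPoly hf).toLinearMap
  mem k a := translateEdge_mem e₀ (linHom_mem g ((polyProjection _).mem k _))
  self {k a} ha := by
    change translateEdge e₀ (linHom g ((polyProjection (Fin n)).proj k (reducedToPoly hf a))) = a
    rw [(polyProjection _).self (reducedToPoly_mem hf ha), translateEdge_reducedToPoly hfg hf]
  mul {m a} ha k x := by
    change translateEdge e₀ (linHom g ((polyProjection (Fin n)).proj (m + k)
      (reducedToPoly hf (a * x)))) =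
      a * translateEdge e₀ (linHom g ((polyProjection (Fin n)).proj k (reducedToPoly hf x)))
    rw [map_mul, (polyProjection _).mul (reducedToPoly_mem hf ha), map_mul, map_mul,
      translateEdge_reducedToPoly hfg hf]

end ReducedRing

theorem reducedRingDeg_isGraded {b : ℕ} (β : BraidWord b) : IsGraded (reducedRingDeg β) :=
  ⟨one_mem_reducedRingDeg β, reducedRingDeg_mul β⟩

/-! ### Ranks of spaces of linear relations -/

section Ranks

theorem finrank_map_add_finrank_ker {V W : Type} [AddCommGroup V] [Module ℚ V]
    [FiniteDimensional ℚ V] [AddCommGroup W] [Module ℚ W] (f : V →ₗ[ℚ] W) (S : Submodule ℚ V) :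
    Module.finrank ℚ (S.map f) + Module.finrank ℚ (LinearMap.ker f) =
      Module.finrank ℚ (LinearMap.ker f ⊔ S : Submodule ℚ V) := by
  have h := (f.domRestrict (LinearMap.ker f ⊔ S)).finrank_range_add_finrank_ker
  have h1 : (LinearMap.ker f).map f = ⊥ := LinearMap.le_ker_iff_map.1 le_rfl
  rw [LinearMap.range_domRestrict, Submodule.map_sup, h1, bot_sup_eq, LinearMap.ker_domRestrict] at h
  rwa [← (Submodule.submoduleOfEquivOfLe (le_sup_left : _ ≤ LinearMap.ker f ⊔ S)).finrank_eq]

variable {E : Type} [Fintype E] [DecidableEq E]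

/-- The space spanned by the differences of the basis vectors of related elements. -/
def differenceSpan (r : E → E → Prop) : Submodule ℚ (E → ℚ) :=
  Submodule.span ℚ {v | ∃ e f, r e f ∧ v = Pi.single f 1 - Pi.single e 1}

omit [Fintype E] in
theorem single_sub_single_mem_differenceSpan {r : E → E → Prop} {e f : E}
    (h : Quot.mk r e = Quot.mk r f) :
    (Pi.single f 1 - Pi.single e 1 : E → ℚ) ∈ differenceSpan r := by
  have h' := Quot.eqvGen_exact h
  clear h
  induction h' with
  | rel e f h => exact Submodule.subset_span ⟨e, f, h, rfl⟩
  | refl e => rw [sub_self]; exact zero_mem _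
  | symm e f _ ih =>
    rw [← neg_sub]
    exact neg_mem ih
  | trans e f g _ _ ih1 ih2 =>
    rw [← sub_add_sub_cancel]
    exact add_mem ih2 ih1

/-- Sending each basis vector to that of its class is a surjection onto `Quot r → ℚ`; choosing
representatives splits it and shows that its kernel is no larger than the span. -/
theorem finrank_differenceSpan (r : E → E → Prop) :
    Module.finrank ℚ (differenceSpan r) + Nat.card (Quot r) = Fintype.card E := by
  classical
  have : Fintype (Quot r) := Fintype.ofFinite _
  let P : (E → ℚ) →ₗ[ℚ] (Quot r → ℚ) :=
    Fintype.linearCombination ℚ fun e => Pi.single (Quot.mk r e) 1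
  let g : (Quot r → ℚ) →ₗ[ℚ] (E → ℚ) := Fintype.linearCombination ℚ fun x => Pi.single x.out 1
  have hP : ∀ e, P (Pi.single e 1) = Pi.single (Quot.mk r e) 1 := fun e => by simp [P]
  have hg : ∀ x, g (Pi.single x 1) = Pi.single x.out 1 := fun e => by simp [g]
  have h1 : ∀ v, P (g v) = v := by
    intro v
    have : P ∘ₗ g = LinearMap.id := LinearMap.pi_ext' fun x => LinearMap.ext_ring <| by
      change P (g (Pi.single x 1)) = Pi.single x 1
      rw [hg, hP, Quot.out_eq]
    exact LinearMap.congr_fun this v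
  have h2 : ∀ v, v - g (P v) ∈ differenceSpan r := by
    intro v
    have : (differenceSpan r).mkQ ∘ₗ (LinearMap.id - g ∘ₗ P) = 0 :=
      LinearMap.pi_ext' fun e => LinearMap.ext_ring <| by
        change (differenceSpan r).mkQ (Pi.single e 1 - g (P (Pi.single e 1))) = 0
        rw [hP, hg, Submodule.mkQ_apply, Submodule.Quotient.mk_eq_zero]
        exact single_sub_single_mem_differenceSpan (Quot.out_eq _)
    exact (Submodule.Quotient.mk_eq_zero _).1 (LinearMap.congr_fun this v)
  have h3 : LinearMap.ker P = differenceSpan r := by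
    refine le_antisymm (fun v hv => ?_) (Submodule.span_le.2 ?_)
    · have := h2 v
      rwa [hv, map_zero, sub_zero] at this
    · rintro _ ⟨e, f, h, rfl⟩
      change P _ = 0
      rw [map_sub, hP, hP, Quot.sound h, sub_self]
  have h4 := P.finrank_range_add_finrank_ker
  rw [LinearMap.range_eq_top.2 fun v => ⟨g v, h1 v⟩, finrank_top, h3,
    Module.finrank_fintype_fun_eq_card, Module.finrank_fintype_fun_eq_card] at h4
  rw [Nat.card_eq_fintype_card, ← h4, add_comm]

/-- The sum of the coordinates vanishes on `U` but not on the basis vector at `e₀`. -/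
theorem finrank_sup_span_single {U : Submodule ℚ (E → ℚ)} (hU : ∀ v ∈ U, ∑ e, v e = 0) (e₀ : E) :
    Module.finrank ℚ (U ⊔ Submodule.span ℚ {Pi.single e₀ 1} : Submodule ℚ (E → ℚ)) =
      Module.finrank ℚ U + 1 := by
  have h0 : (Pi.single e₀ 1 : E → ℚ) ≠ 0 := by simp
  have h1 : U ⊓ Submodule.span ℚ {Pi.single e₀ 1} = ⊥ := by
    rw [eq_bot_iff]
    rintro v ⟨hv, hv'⟩
    obtain ⟨r, rfl⟩ := Submodule.mem_span_singleton.1 hv'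
    have := hU _ hv
    simp only [Pi.smul_apply, smul_eq_mul, ← Finset.mul_sum, Finset.sum_pi_single',
      Finset.mem_univ, if_true, mul_one] at this
    simp [this]
  have h2 := Submodule.finrank_sup_add_finrank_inf_eq U (Submodule.span ℚ {Pi.single e₀ 1})
  rwa [h1, finrank_bot, add_zero, finrank_span_singleton h0] at h2

theorem sum_eq_zero_of_mem_differenceSpan {r : E → E → Prop} {v : E → ℚ}
    (hv : v ∈ differenceSpan r) : ∑ e, v e = 0 := by
  induction hv using Submodule.span_induction with
  | mem v h =>
    obtain ⟨e, f, _, rfl⟩ := h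
    simp [Finset.sum_sub_distrib]
  | zero => simp
  | add v w _ _ h1 h2 => simp [Finset.sum_add_distrib, h1, h2]
  | smul c v _ h => simp [← Finset.mul_sum, h]

end Ranks

/-! ### Linear relations of a closed braid: link components and diagram components. -/

section BraidRanks

variable {b : ℕ} (β : BraidWord b)

/-- The coefficient vectors of the parameters of the crossings. -/
def paramVectors : Submodule ℚ (Edge β → ℚ) :=
  Submodule.span ℚ (Set.range fun t : Fin β.length =>
    Pi.single (crossing β t).k 1 - Pi.single (crossing β t).j 1)

/-- Subtracting `X_k - X_j` from the crossing relator leaves `X_l - X_i`: together they identify the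
edges that follow each other straight through the crossing. -/
theorem relatorVectors_sup_paramVectors :
    Submodule.span ℚ (relatorVectors β) ⊔ paramVectors β = differenceSpan (LinkStep β) := by
  have hr : ∀ t : Fin β.length, (Pi.single (crossing β t).k 1 + Pi.single (crossing β t).l 1
      - Pi.single (crossing β t).i 1 - Pi.single (crossing β t).j 1 : Edge β → ℚ) =
      (Pi.single (crossing β t).l 1 - Pi.single (crossing β t).i 1) +
      (Pi.single (crossing β t).k 1 - Pi.single (crossing β t).j 1) := fun t => by abel
  apply le_antisymm
  · rw [sup_le_iff, Submodule.span_le, paramVectors, Submodule.span_le]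
    constructor
    · rintro _ (⟨t, rfl⟩ | ⟨e, f, h, rfl⟩)
      · rw [hr]
        exact add_mem (Submodule.subset_span ⟨_, _, Or.inr ⟨t, Or.inl ⟨rfl, rfl⟩⟩, rfl⟩)
          (Submodule.subset_span ⟨_, _, Or.inr ⟨t, Or.inr ⟨rfl, rfl⟩⟩, rfl⟩)
      · exact Submodule.subset_span ⟨e, f, Or.inl h, rfl⟩
    · rintro _ ⟨t, rfl⟩
      exact Submodule.subset_span ⟨_, _, Or.inr ⟨t, Or.inr ⟨rfl, rfl⟩⟩, rfl⟩
  · rw [differenceSpan, Submodule.span_le]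
    have h1 : ∀ t : Fin β.length, (Pi.single (crossing β t).k 1 - Pi.single (crossing β t).j 1) ∈
        Submodule.span ℚ (relatorVectors β) ⊔ paramVectors β := fun t =>
      Submodule.mem_sup_right (Submodule.subset_span ⟨t, rfl⟩)
    rintro _ ⟨e, f, h | ⟨t, ⟨rfl, rfl⟩ | ⟨rfl, rfl⟩⟩, rfl⟩
    · exact Submodule.mem_sup_left (Submodule.subset_span (Or.inr ⟨e, f, h, rfl⟩))
    · rw [← add_sub_cancel_right (Pi.single (crossing β t).l 1 - Pi.single (crossing β t).i 1)
        (Pi.single (crossing β t).k 1 - Pi.single (crossing β t).j 1), ← hr]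
      exact sub_mem (Submodule.mem_sup_left (Submodule.subset_span (Or.inl ⟨t, rfl⟩))) (h1 t)
    · exact h1 t

theorem finrank_basedRelations_sup_paramVectors (e₀ : Edge β) :
    Module.finrank ℚ (basedRelations β e₀ ⊔ paramVectors β : Submodule ℚ (Edge β → ℚ)) +
      numLinkComponents β = Fintype.card (Edge β) + 1 := by
  rw [basedRelations, sup_right_comm, relatorVectors_sup_paramVectors,
    finrank_sup_span_single fun v => sum_eq_zero_of_mem_differenceSpan, numLinkComponents,
    ← finrank_differenceSpan (LinkStep β)]
  omega

variable {β}

/-- The edge in the same position on the next level. -/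
def nextEdge (e : Edge β) : Edge β := (e.1 + 1, e.2)

variable (β)

theorem nextEdge_surjective : Function.Surjective (nextEdge : Edge β → Edge β) := fun e =>
  ⟨(e.1 - 1, e.2), Prod.ext (sub_add_cancel _ _) rfl⟩

theorem nextEdge_i (t : Fin β.length) : nextEdge (crossing β t).i = (crossing β t).k :=
  Prod.ext (Fin.coeSucc_eq_succ) rfl

theorem nextEdge_j (t : Fin β.length) : nextEdge (crossing β t).j = (crossing β t).l :=
  Prod.ext (Fin.coeSucc_eq_succ) rfl

/-- Addition in `Fin (β.length + 1)` wraps around, so the closing arcs are covered too. -/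
theorem IsMark.eq_nextEdge {e f : Edge β} (h : IsMark β e f) : f = nextEdge e := by
  rcases h with ⟨t, u, _, _, rfl, rfl⟩ | ⟨u, rfl, rfl⟩
  · exact Prod.ext Fin.coeSucc_eq_succ.symm rfl
  · exact Prod.ext (Fin.last_add_one _).symm rfl

/-- The differences of the values of a function on the two outgoing edges of each crossing. -/
def outgoingDifference : (Edge β → ℚ) →ₗ[ℚ] (Fin β.length → ℚ) where
  toFun φ t := φ (crossing β t).k - φ (crossing β t).l
  map_add' _ _ := funext fun _ => add_sub_add_comm _ _ _ _
  map_smul' c _ := funext fun _ => (mul_sub c _ _).symm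

/-- The functions on the edges with the same value on the two outgoing edges of each crossing:
functions on the vertices, where a vertex is given by its outgoing edges. -/
def vertexFunctions : Submodule ℚ (Edge β → ℚ) :=
  LinearMap.ker (outgoingDifference β)

variable {β} in
theorem mem_vertexFunctions {φ : Edge β → ℚ} :
    φ ∈ vertexFunctions β ↔ ∀ t, φ (crossing β t).k = φ (crossing β t).l := by
  rw [vertexFunctions, LinearMap.mem_ker, funext_iff]
  exact forall_congr' fun t => sub_eq_zero

theorem left_ne_right (g : BraidGen b) : g.left ≠ g.right := fun h => by
  have := congrArg Fin.val h
  simp [BraidGen.left, BraidGen.right] at this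

theorem finrank_vertexFunctions :
    Module.finrank ℚ (vertexFunctions β) + β.length = Fintype.card (Edge β) := by
  have h := (outgoingDifference β).finrank_range_add_finrank_ker
  rw [LinearMap.range_eq_top.2, finrank_top, Module.finrank_fintype_fun_eq_card,
    Module.finrank_fintype_fun_eq_card, Fintype.card_fin] at h
  · rw [← h, vertexFunctions, add_comm]
  · intro y
    -- Each edge above level `0` leaves the braid step just below it, so the value `y t` can be
    -- prescribed on the left outgoing edge of each crossing independently.
    refine ⟨fun e => Fin.cases 0 (fun t => if e.2 = (β.get t).left then y t else 0) e.1, ?_⟩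
    ext t
    have := (left_ne_right (β.get t)).symm
    simp [outgoingDifference, crossing, -List.get_eq_getElem, this]

/-- The coboundary: a function on the vertices is sent to the function whose value on an edge is
the difference of the values at its origin and its end. -/
def coboundary : (Edge β → ℚ) →ₗ[ℚ] (Edge β → ℚ) := LinearMap.id - LinearMap.funLeft ℚ ℚ nextEdge

theorem coboundary_single (e : Edge β) :
    coboundary β (Pi.single (nextEdge e) 1) = Pi.single (nextEdge e) 1 - Pi.single e 1 := by
  have hinj : Function.Injective (nextEdge : Edge β → Edge β) :=
    Finite.injective_iff_surjective.2 (nextEdge_surjective β)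
  ext x
  simp [coboundary, LinearMap.funLeft_apply, Pi.single_apply, hinj.eq_iff]

/-- The indicator function of a vertex is sent to its relator: the outgoing edges minus the incoming
ones. -/
theorem map_coboundary_vertexFunctions :
    (vertexFunctions β).map (coboundary β) = Submodule.span ℚ (relatorVectors β) := by
  have hk : ∀ t, coboundary β (Pi.single (crossing β t).k 1) =
      Pi.single (crossing β t).k 1 - Pi.single (crossing β t).i 1 := fun t => by
    rw [← nextEdge_i, coboundary_single]
  have hl : ∀ t, coboundary β (Pi.single (crossing β t).l 1) =
      Pi.single (crossing β t).l 1 - Pi.single (crossing β t).j 1 := fun t => by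
    rw [← nextEdge_j, coboundary_single]
  apply le_antisymm
  · rintro _ ⟨φ, hφ, rfl⟩
    have hφ := mem_vertexFunctions.1 hφ
    have h1 : φ = ∑ t, ∑ u, φ (t, u) • Pi.single (t, u) 1 := by
      rw [← Fintype.sum_prod_type']
      exact pi_eq_sum_univ' φ
    -- Edges at level `0` leave the closing marks; an edge at level `t + 1` leaves the crossing `t`
    -- or a mark beside it.
    rw [h1, Fin.sum_univ_succ, map_add, map_sum, map_sum]
    refine add_mem (sum_mem fun u _ => ?_) (sum_mem fun t _ => ?_)
    · rw [map_smul]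
      refine Submodule.smul_mem _ _ (Submodule.subset_span (Or.inr
        ⟨(Fin.last _, u), (0, u), Or.inr ⟨u, rfl, rfl⟩, ?_⟩))
      have : ((0, u) : Edge β) = nextEdge (Fin.last _, u) :=
        IsMark.eq_nextEdge β (Or.inr ⟨u, rfl, rfl⟩)
      rw [this, coboundary_single]
    · rw [← Finset.add_sum_erase _ _ (Finset.mem_univ (β.get t).left),
        ← Finset.add_sum_erase _ _ (Finset.mem_erase.2
          ⟨(left_ne_right (β.get t)).symm, Finset.mem_univ (β.get t).right⟩), ← add_assoc, map_add,
        map_sum]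
      refine add_mem ?_ (sum_mem fun u hu => ?_)
      · change coboundary β (φ (crossing β t).k • Pi.single (crossing β t).k 1 +
          φ (crossing β t).l • Pi.single (crossing β t).l 1) ∈ _
        rw [hφ t, ← smul_add, map_smul, map_add, hk, hl]
        refine Submodule.smul_mem _ _ (Submodule.subset_span (Or.inl ⟨t, ?_⟩))
        abel
      · simp only [Finset.mem_erase, Finset.mem_univ, and_true] at hu
        have hm : IsMark β (t.castSucc, u) (t.succ, u) := Or.inl ⟨t, u, hu.2, hu.1, rfl, rfl⟩
        rw [map_smul]
        refine Submodule.smul_mem _ _ (Submodule.subset_span (Or.inr ⟨_, _, hm, ?_⟩))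
        rw [IsMark.eq_nextEdge β hm, coboundary_single]
  · rw [Submodule.span_le]
    rintro _ (⟨t, rfl⟩ | ⟨e, f, h, rfl⟩)
    · refine ⟨Pi.single (crossing β t).k 1 + Pi.single (crossing β t).l 1,
        mem_vertexFunctions.2 fun t' => ?_, ?_⟩
      · have := left_ne_right (β.get t)
        by_cases h : t = t'
        · subst h
          simp [crossing, -List.get_eq_getElem, this, this.symm]
        · simp [crossing, Ne.symm h]
      · rw [map_add, hk, hl]
        abel
    · refine ⟨Pi.single f 1, mem_vertexFunctions.2 fun t => ?_, ?_⟩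
      · rcases h with ⟨t', u, h1, h2, rfl, rfl⟩ | ⟨u, rfl, rfl⟩
        · by_cases h : t = t'
          · subst h
            simp [crossing, -List.get_eq_getElem, h1.symm, h2.symm]
          · simp [crossing, h]
        · simp [crossing, Fin.succ_ne_zero]
      · rw [IsMark.eq_nextEdge β h, coboundary_single]

/-- This is the zeroth cohomology of the diagram as a graph: a function without coboundary is
constant along edges, hence on connected components. -/
theorem ker_coboundary_inf_vertexFunctions :
    LinearMap.ker (coboundary β) ⊓ vertexFunctions β =
      LinearMap.range (LinearMap.funLeft ℚ ℚ (Quot.mk (DiagramStep β))) := by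
  ext φ
  constructor
  · rintro ⟨h1, h2⟩
    have h1 : ∀ e, φ e = φ (nextEdge e) := fun e => sub_eq_zero.1 (congrFun h1 e)
    have h2 := mem_vertexFunctions.1 h2
    refine ⟨Quot.lift φ ?_, rfl⟩
    rintro e f (h | ⟨t, rfl | rfl, rfl | rfl⟩)
    · rw [IsMark.eq_nextEdge β h]
      exact h1 e
    · rw [h1, nextEdge_i]
    · rw [h1, nextEdge_i, h2]
    · rw [h1, nextEdge_j, h2]
    · rw [h1, nextEdge_j]
  · rintro ⟨φ, rfl⟩
    refine ⟨?_, mem_vertexFunctions.2 fun t => ?_⟩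
    · refine funext fun e => sub_eq_zero.2 ?_
      change φ (Quot.mk _ e) = φ (Quot.mk _ (nextEdge e))
      refine congrArg φ (Quot.sound ?_)
      obtain ⟨t, u⟩ := e
      induction t using Fin.lastCases with
      | last =>
        have : IsMark β (Fin.last _, u) (0, u) := Or.inr ⟨u, rfl, rfl⟩
        rw [← IsMark.eq_nextEdge β this]
        exact Or.inl this
      | cast t =>
        by_cases h1 : u = (β.get t).left
        · subst h1
          exact Or.inr ⟨t, Or.inl rfl, Or.inl (nextEdge_i β t)⟩
        by_cases h2 : u = (β.get t).right
        · subst h2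
          exact Or.inr ⟨t, Or.inr rfl, Or.inr (nextEdge_j β t)⟩
        have : IsMark β (t.castSucc, u) (t.succ, u) := Or.inl ⟨t, u, h1, h2, rfl, rfl⟩
        rw [← IsMark.eq_nextEdge β this]
        exact Or.inl this
    · have h : ∀ f, f = (crossing β t).k ∨ f = (crossing β t).l →
          Quot.mk (DiagramStep β) (crossing β t).i = Quot.mk (DiagramStep β) f := fun f hf =>
        Quot.sound (Or.inr ⟨t, Or.inl rfl, hf⟩)
      exact congrArg φ ((h _ (Or.inl rfl)).symm.trans (h _ (Or.inr rfl)))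

/-- The diagram has `card Edge - length` vertices, as each crossing has two outgoing edges and each
mark has one. The relators of its vertices satisfy one linear dependence per connected component. -/
theorem finrank_span_relatorVectors :
    Module.finrank ℚ (Submodule.span ℚ (relatorVectors β)) + β.length + numDiagramComponents β =
      Fintype.card (Edge β) := by
  classical
  have : Fintype (Quot (DiagramStep β)) := Fintype.ofFinite _
  have h := ((coboundary β).domRestrict (vertexFunctions β)).finrank_range_add_finrank_ker
  have h1 := (Submodule.submoduleOfEquivOfLe (inf_le_right :
    LinearMap.ker (coboundary β) ⊓ vertexFunctions β ≤ vertexFunctions β)).finrank_eq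
  have h2 : (LinearMap.ker (coboundary β) ⊓ vertexFunctions β).submoduleOf (vertexFunctions β) =
      LinearMap.ker ((coboundary β).domRestrict (vertexFunctions β)) := by
    ext x
    exact and_iff_left x.2
  have h3 : Module.finrank ℚ (LinearMap.range (LinearMap.funLeft ℚ ℚ (Quot.mk (DiagramStep β)))) =
      numDiagramComponents β := by
    rw [LinearMap.finrank_range_of_inj
      (LinearMap.funLeft_injective_of_surjective ℚ ℚ _ Quot.mk_surjective),
      Module.finrank_fintype_fun_eq_card, numDiagramComponents, Nat.card_eq_fintype_card]
  rw [h2, ker_coboundary_inf_vertexFunctions, h3] at h1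
  rw [LinearMap.range_domRestrict, map_coboundary_vertexFunctions, h1] at h
  rw [← finrank_vertexFunctions, ← h]
  omega

theorem span_relatorVectors_le :
    Submodule.span ℚ (relatorVectors β) ≤ differenceSpan (LinkStep β) := by
  rw [← relatorVectors_sup_paramVectors]
  exact le_sup_left

theorem finrank_basedRelations (e₀ : Edge β) :
    Module.finrank ℚ (basedRelations β e₀) + β.length + numDiagramComponents β =
      Fintype.card (Edge β) + 1 := by
  rw [basedRelations, finrank_sup_span_single (fun v hv =>
    sum_eq_zero_of_mem_differenceSpan (span_relatorVectors_le β hv)), ← finrank_span_relatorVectors]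
  omega

end BraidRanks

/-! ### The homology of the total complex of a closed braid -/

section TotalHomology

variable {b : ℕ} (β : BraidWord b)

/-- The local factor of a crossing. -/
def crossingFactor (t : Fin β.length) : LocalFactor (reducedRingDeg β) :=
  if (crossing β t).positive then
    .positive (edgeDiff β (crossing β t).k (crossing β t).i)
      (edgeDiff β (crossing β t).k (crossing β t).j) (edgeDiff_mem β _ _) (edgeDiff_mem β _ _)
  else
    .negative (edgeDiff β (crossing β t).k (crossing β t).i)
      (edgeDiff β (crossing β t).k (crossing β t).j) (edgeDiff_mem β _ _) (edgeDiff_mem β _ _)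

/-- The local factors of the globally reduced complex. -/
def localFactors : List (LocalFactor (reducedRingDeg β)) :=
  List.ofFn (crossingFactor β) ++ List.replicate (numDiagramComponents β - 1) .unreduced

theorem reducedComplex_eq_total :
    reducedComplex β = LocalFactor.total (reducedRingDeg_isGraded β) (localFactors β) := by
  rw [reducedComplex, LocalFactor.total, localFactors, List.map_append, List.map_ofFn,
    List.map_replicate]
  congr 3
  ext t
  simp only [crossingComplex, Function.comp_apply, crossingFactor]
  split_ifs <;> rfl

theorem crossingFactor_param (t : Fin β.length) : (crossingFactor β t).param =
    edgeDiff β (crossing β t).k (crossing β t).j := by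
  rw [crossingFactor]
  split_ifs <;> rfl

theorem crossingFactor_sign (t : Fin β.length) : (crossingFactor β t).sign =
    if (β.get t).positive then 1 else -1 := by
  rw [crossingFactor]
  split_ifs with h h' h' <;> first | rfl | exact absurd h h' | exact absurd h' h

theorem sum_sign_localFactors : ((localFactors β).map LocalFactor.sign).sum = writhe β := by
  have h : LocalFactor.sign ∘ crossingFactor β =
      (fun g => if g.positive then (1 : ℤ) else -1) ∘ β.get := funext (crossingFactor_sign β)
  rw [localFactors, List.map_append, List.map_ofFn, List.map_replicate, List.sum_append, h,
    ← List.map_ofFn, List.ofFn_get, List.sum_replicate, writhe]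
  simp [LocalFactor.sign]

theorem paramSpan_localFactors : LocalFactor.paramSpan (localFactors β) =
    Submodule.span ℚ (Set.range fun t => edgeDiff β (crossing β t).k (crossing β t).j) := by
  rw [LocalFactor.paramSpan]
  apply le_antisymm <;> rw [Submodule.span_le]
  · rintro _ ⟨x, hx, rfl⟩
    rw [localFactors, List.mem_append, List.mem_ofFn, List.mem_replicate] at hx
    rcases hx with ⟨t, rfl⟩ | ⟨_, rfl⟩
    · rw [crossingFactor_param]
      exact Submodule.subset_span ⟨t, rfl⟩
    · exact zero_mem _
  · rintro _ ⟨t, rfl⟩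
    refine Submodule.subset_span ⟨crossingFactor β t, ?_, crossingFactor_param β t⟩
    rw [localFactors, List.mem_append, List.mem_ofFn]
    exact Or.inl ⟨t, rfl⟩

theorem length_localFactors :
    (localFactors β).length = β.length + (numDiagramComponents β - 1) := by
  simp [localFactors]

variable {β}

theorem exists_edge (hb : 0 < b) (β : BraidWord b) : Nonempty (Edge β) := ⟨(0, ⟨0, hb⟩)⟩

theorem numDiagramComponents_pos (e₀ : Edge β) : 0 < numDiagramComponents β := by
  have : Nonempty (Quot (DiagramStep β)) := ⟨Quot.mk _ e₀⟩
  exact Nat.card_pos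

theorem numLinkComponents_pos (e₀ : Edge β) : 0 < numLinkComponents β := by
  have : Nonempty (Quot (LinkStep β)) := ⟨Quot.mk _ e₀⟩
  exact Nat.card_pos

/-- The number of variables of the reduced ring equals the number of local factors, so subtracting
the rank of the parameters leaves equally many of both. -/
theorem exists_basedQuotient (e₀ : Edge β) :
    ∃ (f : (Edge β → ℚ) →ₗ[ℚ] (Fin (β.length + (numDiagramComponents β - 1)) → ℚ))
      (g : (Fin (β.length + (numDiagramComponents β - 1)) → ℚ) →ₗ[ℚ] (Edge β → ℚ)),
      (∀ v, f (g v) = v) ∧ LinearMap.ker f = basedRelations β e₀ := by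
  refine exists_linear_quotient _ ?_
  have h1 := finrank_basedRelations β e₀
  have h2 := numDiagramComponents_pos e₀
  omega

theorem nonempty_reducedProjection (e₀ : Edge β) :
    Nonempty (GradedProjection (reducedRingDeg β)) := by
  obtain ⟨f, g, hfg, hf⟩ := exists_basedQuotient e₀
  exact ⟨reducedProjection hfg hf⟩

/-- The parameters are the images of `X_k - X_j` modulo the based relations, so their rank is the
growth of rank when these vectors are adjoined. That growth is governed by the number of link
components. -/
theorem finrank_paramSpan_localFactors {n : ℕ} {e₀ : Edge β}
    {f : (Edge β → ℚ) →ₗ[ℚ] (Fin n → ℚ)} (hf : LinearMap.ker f = basedRelations β e₀) :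
    Module.finrank ℚ (LocalFactor.paramSpan ((localFactors β).map
      (LocalFactor.map (reducedToPoly hf) (reducedToPoly_mem hf)))) +
        Module.finrank ℚ (basedRelations β e₀) + numLinkComponents β =
      Fintype.card (Edge β) + 1 := by
  have h : LocalFactor.paramSpan ((localFactors β).map
      (LocalFactor.map (reducedToPoly hf) (reducedToPoly_mem hf))) =
      ((paramVectors β).map f).map (linForm (Fin n)) := by
    rw [LocalFactor.paramSpan_map, paramSpan_localFactors, paramVectors, Submodule.map_span,
      Submodule.map_span, Submodule.map_span, ← Set.range_comp, ← Set.range_comp, ← Set.range_comp]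
    congr 2
    ext1 t
    exact reducedToPoly_edgeDiff hf _ _
  rw [h, ← (Submodule.equivMapOfInjective _ linForm_injective _).finrank_eq, ← hf,
    finrank_map_add_finrank_ker, hf, finrank_basedRelations_sup_paramVectors]

/-- The homology of the total complex only depends on the number of components of the link. -/
theorem totH_reducedComplex_equiv (hb : 0 < b) (β : BraidWord b) (s t : ℤ) :
    Nonempty ((reducedComplex β).totH (s - twiceGrPlus (shift β)) (t - grMinusOne (shift β)) ≃ₗ[ℚ]
      (LocalFactor.standard (numLinkComponents β - 1) (numLinkComponents β - 1)).totH s t) := by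
  obtain ⟨e₀⟩ := exists_edge hb β
  obtain ⟨f, g, hfg, hf⟩ := exists_basedQuotient e₀
  have h1 := finrank_basedRelations β e₀
  have h2 := numDiagramComponents_pos e₀
  have h3 := numLinkComponents_pos e₀
  have h4 := finrank_paramSpan_localFactors hf
  have h5 := length_localFactors β
  rw [reducedComplex_eq_total]
  obtain ⟨e₁⟩ := (LocalFactor.total (reducedRingDeg_isGraded β) (localFactors β)).totH_map_equiv
    (reducedToPoly_mem hf) (Function.LeftInverse.injective (g := fun p => translateEdge e₀ (linHom g p))
      (translateEdge_reducedToPoly hfg hf))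
    (fun {_ p} hp => ⟨translateEdge e₀ (linHom g p), translateEdge_mem e₀ (linHom_mem g hp),
      reducedToPoly_translateEdge hfg hf p⟩) (reducedRingDeg_mul β)
    (s - twiceGrPlus (shift β)) (t - grMinusOne (shift β))
  rw [LocalFactor.total_map _ _ (polyDeg_isGraded _)] at e₁
  obtain ⟨e₂⟩ := LocalFactor.totH_equiv_standard (n' := numLinkComponents β - 1)
    (m := numLinkComponents β - 1) ((localFactors β).map
      (LocalFactor.map (reducedToPoly hf) (reducedToPoly_mem hf))) (by omega)
    (by rw [List.length_map]; omega)
    (s - twiceGrPlus (shift β)) (t - grMinusOne (shift β))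
  have h6 : ((localFactors β).map (LocalFactor.map (reducedToPoly hf) (reducedToPoly_mem hf))).map
      LocalFactor.sign = (localFactors β).map LocalFactor.sign := by
    rw [List.map_map]
    exact List.map_congr_left fun y _ => LocalFactor.sign_map _ y
  -- The crossings shift the bidegree by `(2w, -2w)` in total, which the overall shift compensates
  -- exactly; the strand number cancels.
  rw [h6, sum_sign_localFactors,
    show s - twiceGrPlus (shift β) + 2 * writhe β = s by simp only [twiceGrPlus, shift]; ring,
    show t - grMinusOne (shift β) - 2 * writhe β = t by simp only [grMinusOne, shift]; ring] at e₂
  exact ⟨e₁ ≪≫ₗ e₂⟩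

/-! ### The unlink and the case of a knot. -/

theorem numLinkComponents_unlink (n : ℕ) : numLinkComponents (unlink n) = n := by
  have h : ∀ e f : Edge (unlink n), LinkStep (unlink n) e f → e.2 = f.2 := by
    rintro e f ((⟨t, _⟩ | ⟨u, rfl, rfl⟩) | ⟨t, _⟩)
    · exact t.elim0
    · rfl
    · exact t.elim0
  let e : Quot (LinkStep (unlink n)) ≃ Fin n :=
    { toFun := Quot.lift Prod.snd h
      invFun := fun u => Quot.mk _ (0, u)
      left_inv := by
        rintro ⟨t, u⟩
        exact congrArg (fun t => Quot.mk _ (t, u)) (Subsingleton.elim (α := Fin 1) _ _)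
      right_inv := fun _ => rfl }
  rw [numLinkComponents, Nat.card_congr e, Nat.card_fin]

theorem FreeComplex.tensor_differentials_eq_zero {A : Type} [CommRing A] [Algebra ℚ A]
    {𝒜 : ℤ → Submodule ℚ A} {C D : FreeComplex A 𝒜} (h1 : C.dp = 0) (h2 : C.dv = 0)
    (h3 : D.dp = 0) (h4 : D.dv = 0) : (C.tensor D).dp = 0 ∧ (C.tensor D).dv = 0 := by
  constructor
  · change C.dp ⊗ₖ (1 : Matrix D.ι D.ι A) + signMatrix A C.h ⊗ₖ D.dp = 0
    rw [h1, h3, Matrix.zero_kronecker, Matrix.kronecker_zero, add_zero]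
  · change C.dv ⊗ₖ (1 : Matrix D.ι D.ι A) + signMatrix A C.v ⊗ₖ D.dv = 0
    rw [h2, h4, Matrix.zero_kronecker, Matrix.kronecker_zero, add_zero]

theorem total_replicate_unreduced {A : Type} [CommRing A] [Algebra ℚ A] {𝒜 : ℤ → Submodule ℚ A}
    (h𝒜 : IsGraded 𝒜) (m : ℕ) :
    (LocalFactor.total h𝒜 (List.replicate m .unreduced)).dp = 0 ∧
      (LocalFactor.total h𝒜 (List.replicate m .unreduced)).dv = 0 := by
  induction m with
  | zero => exact ⟨rfl, rfl⟩
  | succ m ih => exact FreeComplex.tensor_differentials_eq_zero rfl rfl ih.1 ih.2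

theorem reducedComplex_unlink (n : ℕ) :
    (reducedComplex (unlink n)).dp = 0 ∧ (reducedComplex (unlink n)).dv = 0 := by
  rw [reducedComplex_eq_total]
  exact total_replicate_unreduced _ _

/-- Without crossings there are no differentials, so the collapsed HOMFLY homology is the total
homology, and the general computation applies to the unlink itself. -/
theorem reducedHomflyBigraded_unlink_equiv {n : ℕ} (hn : 0 < n) (s t : ℤ) :
    Nonempty (reducedHomflyBigraded (unlink n) s t ≃ₗ[ℚ]
      (LocalFactor.standard (n - 1) (n - 1)).totH s t) := by
  obtain ⟨e₁⟩ := (reducedComplex (unlink n)).totH_equiv_iSup_doubleHomologyPiece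
    (reducedComplex_unlink n).1 (reducedComplex_unlink n).2 (shift (unlink n)) s t
  have h := totH_reducedComplex_equiv hn (unlink n) s t
  rw [numLinkComponents_unlink] at h
  obtain ⟨e₂⟩ := h
  exact ⟨e₁.symm ≪≫ₗ e₂⟩

/-- There is a single generator in degree zero over a polynomial ring without variables, which is
`ℚ` concentrated in degree zero. -/
theorem totH_standard_zero (s t : ℤ) :
    Nonempty ((LocalFactor.standard 0 0).totH s t ≃ₗ[ℚ] rationalBigraded s t) := by
  change Nonempty ((FreeComplex.unit (polyDeg (Fin 0))).totH s t ≃ₗ[ℚ] _)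
  set C := FreeComplex.unit (polyDeg (Fin 0))
  have hD : C.totD = 0 := LinearMap.ext fun m => by
    change C.dPlus m + C.parity (C.dVert m) = 0
    have h : (0 : Matrix Unit Unit (MvPolynomial (Fin 0) ℚ)).mulVec m = 0 := Matrix.zero_mulVec m
    rw [show C.dPlus m = 0 from h, show C.dVert m = 0 from h, map_zero, add_zero]
  by_cases h : s = 0 ∧ t = 0
  · obtain ⟨rfl, rfl⟩ := h
    rw [show rationalBigraded 0 0 = ModuleCat.of ℚ ℚ from if_pos ⟨rfl, rfl⟩]
    let g : ℚ →ₗ[ℚ] C.Carrier :=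
      { toFun := fun r _ => MvPolynomial.C r
        map_add' := fun x y => funext fun _ => map_add MvPolynomial.C x y
        map_smul' := fun x y => funext fun _ =>
          (map_mul MvPolynomial.C x y).trans (MvPolynomial.smul_eq_C_mul _ _).symm }
    have hg : ∀ r, g r ∈ C.totPiece 0 0 := fun r _ =>
      ⟨MvPolynomial.isWeightedHomogeneous_C _ r, fun _ => rfl⟩
    obtain ⟨e⟩ := subquotient_equiv (Z := LinearMap.ker C.totD ⊓ C.totPiece 0 0)
      (B := (C.totPiece (0 - 2) 0).map C.totD) (Z' := (⊤ : Submodule ℚ ℚ)) (B' := ⊥) g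
      LinearMap.id (fun m _ => ⟨MvPolynomial.constantCoeff (m ()), funext fun _ =>
        (MvPolynomial.eq_C_of_isEmpty (m ())).symm, trivial⟩)
      (fun r _ => ⟨r, rfl, by rw [hD]; rfl, hg r⟩) (fun r _ _ => by
        rw [hD, Submodule.map_zero, Submodule.mem_bot, Submodule.mem_bot]
        refine ⟨fun h => MvPolynomial.C_injective (Fin 0) ℚ ?_, fun h => ?_⟩
        · rw [map_zero]
          exact congrFun h ()
        · obtain rfl : r = 0 := h
          exact map_zero g)
    refine ⟨e ≪≫ₗ Submodule.quotEquivOfEqBot _ ?_ ≪≫ₗ Submodule.topEquiv⟩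
    rw [Submodule.submoduleOf, Submodule.comap_bot, Submodule.ker_subtype]
  · have h1 : C.totPiece s t ≤ ⊥ := by
      intro m hm
      refine (Submodule.mem_bot ℚ).2 (funext fun x => ?_)
      by_contra h0
      obtain ⟨h1, h2⟩ := hm x
      refine h ⟨(h2 h0).symm, ?_⟩
      have h3 : t + 2 * 0 - 0 = 0 := MvPolynomial.IsWeightedHomogeneous.inj_right h0 h1
        (MvPolynomial.isWeightedHomogeneous_of_isEmpty ℚ _ _)
      omega
    have := subquotient_subsingleton (Z := LinearMap.ker C.totD ⊓ C.totPiece s t)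
      (B := (C.totPiece (s - 2) t).map C.totD) ((inf_le_right.trans h1).trans bot_le)
    have : Subsingleton (rationalBigraded s t) := by
      rw [rationalBigraded, if_neg h]
      exact inferInstanceAs (Subsingleton PUnit)
    exact ⟨LinearEquiv.ofSubsingleton _ _⟩

end TotalHomology

end KR

end

/-! ### Assembly of the theorem. -/

theorem mainTheorem3 (b : ℕ) (hb : 0 < b) (β : KR.BraidWord b) (ℓ : ℕ)
    (hℓ : KR.numLinkComponents β = ℓ) :
    ∃ E : KR.TripleSpectralSequence,
      (∀ d : ℤ × ℤ × ℤ, Nonempty ((E.page 2 le_rfl).X d ≅ KR.reducedHomfly β d)) ∧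
      KR.ConvergesTo E (KR.reducedHomflyBigraded (KR.unlink ℓ)) ∧
      (ℓ = 1 → KR.ConvergesTo E KR.rationalBigraded) ∧
      ∀ (r : ℤ) (hr : 2 ≤ r) (d d' : ℤ × ℤ × ℤ), (E.page r hr).d d d' ≠ 0 →
        d' = d + (2 - 2 * r, 2 - 2 * r, 2 * r) ∧
        KR.twiceGrPlus d' = KR.twiceGrPlus d + 2 ∧ KR.grMinusOne d' = KR.grMinusOne d := by
  subst hℓ
  obtain ⟨e₀⟩ := KR.exists_edge hb β
  obtain ⟨π⟩ := KR.nonempty_reducedProjection e₀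
  let S := (KR.reducedComplex β).filteredSpace (KR.reducedRingDeg_mul β) (KR.shift β)
  have hS : ∀ s t, Nonempty (S.H s t ≃ₗ[ℚ] (KR.LocalFactor.standard (KR.numLinkComponents β - 1)
      (KR.numLinkComponents β - 1)).totH s t) := fun s t => by
    -- The boundaries in `S.H` come from degree `s - 2` before the shift, those in `totH` from two
    -- below the shifted degree. The degrees agree only up to `ring`, hence the auxiliary `u`.
    have h : ∀ u, u = s - KR.twiceGrPlus (KR.shift β) - 2 → Nonempty
        (KR.Subquotient (LinearMap.ker S.D ⊓ S.P s t)
          (((KR.reducedComplex β).totPiece u (t - KR.grMinusOne (KR.shift β))).map S.D) ≃ₗ[ℚ]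
        (KR.LocalFactor.standard (KR.numLinkComponents β - 1)
          (KR.numLinkComponents β - 1)).totH s t) := by
      rintro _ rfl
      exact KR.totH_reducedComplex_equiv hb β s t
    exact h _ (by ring)
  refine ⟨S.spectralSequence, fun d => ?_, S.convergesTo _ fun s t => ?_,
    fun h => S.convergesTo _ fun s t => ?_, fun r hr d d' => S.spectralSequence_d_ne_zero hr⟩
  · obtain ⟨e⟩ := (KR.reducedComplex β).second_page_equiv (KR.reducedRingDeg_mul β) π
      (KR.shift β) d
    exact ⟨e.toModuleIso⟩
  · obtain ⟨e₁⟩ := hS s t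
    obtain ⟨e₂⟩ := KR.reducedHomflyBigraded_unlink_equiv (KR.numLinkComponents_pos e₀) s t
    exact ⟨e₁ ≪≫ₗ e₂.symm⟩
  · obtain ⟨e₁⟩ := hS s t
    rw [h] at e₁
    obtain ⟨e₂⟩ := KR.totH_standard_zero s t
    exact ⟨e₁ ≪≫ₗ e₂⟩
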